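/- Let $\hat{\mathcal F}$ be a germ of formal foliation at $p=0\in\mathbb C^2$, given by a formal $1$-form $\hat\omega=P\,dx+Q\,dy$ with $P,Q\in\mathbb C[[x,y]]$ without common factor. A separatrix is an irreducible formal curve $f=0$ such that $f$ divides $\hat\omega\wedge df$. Consider the minimal reduction of singularities of $\hat{\mathcal F}$: the minimal finite sequence of punctual blow-ups, with exceptional divisor $\mathcal D$, after which all singularities are reduced (linear part $y\,dx-\lambda x\,dy$ with $\lambda\notin\mathbb Q^+$, or $x\,dy$ — a saddle-node — in suitable coordinates) and all separatrices are smooth, pairwise disjoint, transverse to $\mathcal D$ and pass through no corner of $\mathcal D$. A component $D$ of $\mathcal D$ is dicritical if it is not invariant by the transformed foliation; $\mathrm{val}(D)$ is the number of other components meeting $D$; a separatrix is isolated if its strict transform meets no dicritical component. The foliation is a generalized curve if there are no saddle-nodes in its reduction. A balanced equation of separatrices is a formal meromorphic function $\hat F=G/H$ (with $G,H$ coprime) whose divisor $(\hat F)_0-(\hat F)_\infty$ is the sum of all isolated separatrices, each with coefficient $1$, and of finitely many separatrices meeting the dicritical components, with integer coefficients whose sum over the separatrices meeting $D$ is $2-\mathrm{val}(D)$,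 for each dicritical component $D$. For an irreducible curve $B$ with Puiseux parametrization $\gamma$ and a formal meromorphic $1$-form $\eta=(A\,dx+B'\,dy)/K$ with $B\not\subset\{K=0\}$, leaving $B$ invariant, set $(\mathcal P^\eta,B)_p=\mathrm{ord}_{t=0}\big(\frac{aA+bB'}{K}\circ\gamma\big)$ for generic $(a:b)\in\mathbb P^1_{\mathbb C}$. For a union $C=\bigcup_i C_i$ of separatrices, the polar excess is $\Delta_p(\hat{\mathcal F},C)=\sum_i\big((\mathcal P^{\hat\omega},C_i)_p-(\mathcal P^{d\hat F},C_i)_p\big)$. The formal $GSV$-index along one separatrix $B=\{f=0\}$ is $GSV_p(\hat{\mathcal F},B)=\mathrm{ord}_{t=0}\big(\frac kg\circ\gamma\big)$, for any decomposition $g\hat\omega=k\,df+f\eta$ with $g$ and $f$ coprime; for a union of two disjoint sets of separatrices, $GSV_p(\hat{\mathcal F},C_0\cup C_1)=GSV_p(\hat{\mathcal F},C_0)+GSV_p(\hat{\mathcal F},C_1)-2(C_0,C_1)_p$. Here $(\cdot,\cdot)_p$ is the intersection number, $\dim_{\mathbb C}\mathbb C[[x,y]]/(f,g)$ for the curves $f=0$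 and $g=0$. Theorem. Let $\hat F$ be a balanced equation of separatrices of $\hat{\mathcal F}$, and let $C\subset(\hat F)_0$ be a finite union of distinct irreducible components along which $\hat F$ has simple zeros. Then $$GSV_p(\hat{\mathcal F},C)=\Delta_p(\hat{\mathcal F},C)+(C,(\hat F)_0\setminus C)_p-(C,(\hat F)_\infty)_p ,$$ where $(\hat F)_0\setminus C$ is the divisor $(\hat F)_0-C$. In particular, if $\hat{\mathcal F}$ is a generalized curve and all the zeros of $\hat F$ are simple, then $$GSV_p(\hat{\mathcal F},(\hat F)_0)=-((\hat F)_0,(\hat F)_\infty)_p .$$ -/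

import Mathlib

/-- The ring `ℂ[[x, y]]` of formal power series, with `x = X 0` and `y = X 1`. -/
abbrev FormalSeries : Type := MvPowerSeries (Fin 2) ℂ

namespace FormalSeries

/-- Formal partial derivative with respect to `x`. -/
noncomputable def dx (f : FormalSeries) : FormalSeries := MvPowerSeries.pderiv ℂ 0 f

/-- Formal partial derivative with respect to `y`. -/
noncomputable def dy (f : FormalSeries) : FormalSeries := MvPowerSeries.pderiv ℂ 1 f

/-- The coefficient of the coordinate `X i` in `f`. -/
noncomputable def lin (f : FormalSeries) (i : Fin 2) : ℂ :=
  MvPowerSeries.coeff (Finsupp.single i 1) f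

/-- The quotient `f / x ^ m`, for `f` divisible by `x ^ m`. -/
noncomputable def divX (m : ℕ) (f : FormalSeries) : FormalSeries :=
  fun n => MvPowerSeries.coeff (n + Finsupp.single 0 m) f

end FormalSeries

/-- A formal `1`-form `a dx + b dy`. It defines a germ of formal foliation (with at most an
isolated singularity) when `a` and `b` have no common factor. -/
structure FormalOneForm where
  a : FormalSeries
  b : FormalSeries

/-- A formal meromorphic function `num / den` in lowest terms, not identically zero.
Its divisor of zeros is the divisor of `num`, its divisor of poles is the divisor of `den`. -/
structure FormalMeroFunction where
  num : FormalSeries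
  den : FormalSeries
  num_ne_zero : num ≠ 0
  den_ne_zero : den ≠ 0
  coprime : IsRelPrime num den

/-- A formal meromorphic `1`-form `(P dx + Q dy) / H`. -/
structure FormalMeroForm where
  P : FormalSeries
  Q : FormalSeries
  H : FormalSeries

/-- A formal `1`-form, seen as a meromorphic one. -/
noncomputable def FormalOneForm.toMero (ω : FormalOneForm) : FormalMeroForm := ⟨ω.a, ω.b, 1⟩

/-- The differential `d (G / H) = (H dG - G dH) / H ^ 2`. -/
noncomputable def FormalMeroFunction.differential (F : FormalMeroFunction) : FormalMeroForm where
  P := F.den * F.num.dx - F.num * F.den.dx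
  Q := F.den * F.num.dy - F.num * F.den.dy
  H := F.den ^ 2

/-- The order of a meromorphic function along the irreducible curve `f = 0`, that is,
the coefficient of this curve in the divisor `(F)_0 - (F)_∞`. -/
noncomputable def FormalMeroFunction.ordAt (F : FormalMeroFunction) (f : FormalSeries) : ℤ :=
  (multiplicity f F.num : ℤ) - (multiplicity f F.den : ℤ)

/-! ### Infinitely near points and blow-ups -/

/-- A point of the exceptional line of the blow-up of a point with coordinates `(x, y)`: the
direction `y = c x`, or the direction `x = 0`. -/
inductive BlowUpDirection : Type
  | slope (c : ℂ)
  | vertical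

/-- A point infinitely near to the origin. The empty list is the origin, and `d :: p` is the point
of direction `d` on the exceptional line of the blow-up of the point `p`. Each such point comes
with the formal coordinates `(x, y)` of the charts below. For `d :: p`, the exceptional line of
the blow-up of `p` is `x = 0`. -/
abbrev InfNearPoint : Type := List BlowUpDirection

/-- The blow-up map in the coordinates at the point of direction `d`:
`(x, y) ↦ (x, x (y + c))`, respectively `(x, y) ↦ (x y, x)`. -/
noncomputable def blowUpChart : BlowUpDirection → Fin 2 → FormalSeries
  | .slope c =>
      ![MvPowerSeries.X 0, MvPowerSeries.X 0 * (MvPowerSeries.X 1 + MvPowerSeries.C c)]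
  | .vertical => ![MvPowerSeries.X 0 * MvPowerSeries.X 1, MvPowerSeries.X 0]

/-- Total transform of a series. -/
noncomputable def totalTransform (d : BlowUpDirection) (f : FormalSeries) : FormalSeries :=
  MvPowerSeries.subst (blowUpChart d) f

/-- Strict transform of a curve `f = 0`: the total transform, divided by the largest possible
power of the equation `x` of the exceptional line. -/
noncomputable def strictTransform (d : BlowUpDirection) (f : FormalSeries) : FormalSeries :=
  (totalTransform d f).divX
    (emultiplicity (MvPowerSeries.X 0 : FormalSeries) (totalTransform d f)).toNat

namespace FormalOneForm

/-- The pull-back of the `1`-form `a dx + b dy` by the blow-up. -/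
noncomputable def pullBack : BlowUpDirection → FormalOneForm → FormalOneForm
  | .slope c, ω =>
      ⟨totalTransform (.slope c) ω.a +
          (MvPowerSeries.X 1 + MvPowerSeries.C c) * totalTransform (.slope c) ω.b,
        MvPowerSeries.X 0 * totalTransform (.slope c) ω.b⟩
  | .vertical, ω =>
      ⟨MvPowerSeries.X 1 * totalTransform .vertical ω.a + totalTransform .vertical ω.b,
        MvPowerSeries.X 0 * totalTransform .vertical ω.a⟩

/-- The transform of the foliation defined by `ω`: the pull-back, divided by the largest
possible power of the equation `x` of the exceptional line. -/
noncomputable def blowUp (d : BlowUpDirection) (ω : FormalOneForm) : FormalOneForm :=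
  let η := pullBack d ω
  let m : ℕ := (min (emultiplicity (MvPowerSeries.X 0 : FormalSeries) η.a)
    (emultiplicity (MvPowerSeries.X 0 : FormalSeries) η.b)).toNat
  ⟨η.a.divX m, η.b.divX m⟩

/-- The transform of the foliation at the infinitely near point `p`. -/
noncomputable def transformAt (ω : FormalOneForm) : InfNearPoint → FormalOneForm
  | [] => ω
  | d :: p => blowUp d (transformAt ω p)

/-- The curve `f = 0` is invariant: `f` divides `ω ∧ df`. -/
def Invariant (ω : FormalOneForm) (f : FormalSeries) : Prop :=
  f ∣ ω.a * f.dy - ω.b * f.dx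

/-- A separatrix (given by an equation): an irreducible invariant curve. -/
def IsSeparatrix (ω : FormalOneForm) (f : FormalSeries) : Prop :=
  Irreducible f ∧ ω.Invariant f

/-- The foliation is singular at the origin of the coordinates. -/
def IsSingular (ω : FormalOneForm) : Prop :=
  MvPowerSeries.constantCoeff ω.a = 0 ∧ MvPowerSeries.constantCoeff ω.b = 0

/-- The matrix `N` of the linear part: the linear parts of `a` and `b` are the entries of
`N (x, y)ᵀ`. A change of coordinates with linear part `M` changes `N` into `Mᵀ N M`. -/
noncomputable def linearPart (ω : FormalOneForm) : Matrix (Fin 2) (Fin 2) ℂ :=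
  !![ω.a.lin 0, ω.a.lin 1; ω.b.lin 0, ω.b.lin 1]

/-- In suitable formal coordinates, the linear part is that of the given matrix. -/
def HasLinearNormalForm (ω : FormalOneForm) (N : Matrix (Fin 2) (Fin 2) ℂ) : Prop :=
  ∃ M : Matrix (Fin 2) (Fin 2) ℂ, IsUnit M.det ∧ M.transpose * ω.linearPart * M = N

/-- A saddle-node: a singularity with linear part `x dy` in suitable coordinates. -/
def IsSaddleNode (ω : FormalOneForm) : Prop :=
  ω.IsSingular ∧ ω.HasLinearNormalForm !![0, 0; 1, 0]

/-- A reduced (or simple) singularity: its linear part is, in suitable coordinates,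
`y dx - lam x dy` with `lam` not a positive rational number, or `x dy`. -/
def IsReducedSingularity (ω : FormalOneForm) : Prop :=
  ω.IsSingular ∧
    ((∃ lam : ℂ, (¬ ∃ r : ℚ, 0 < r ∧ lam = (r : ℂ)) ∧
        ω.HasLinearNormalForm !![0, 1; -lam, 0]) ∨
      ω.HasLinearNormalForm !![0, 0; 1, 0])

end FormalOneForm

/-- The strict transform, at the infinitely near point `p`, of the curve `f = 0`. It is a unit
when the strict transform of the curve does not pass through `p`. -/
noncomputable def strictTransformAt (f : FormalSeries) : InfNearPoint → FormalSeries
  | [] => f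
  | d :: p => strictTransform d (strictTransformAt f p)

namespace InfNearPoint

/-- The component of the exceptional divisor with local equation `x = 0` at the given point.
Components are named after the point whose blow-up creates them. -/
def axisX : InfNearPoint → Option InfNearPoint
  | [] => none
  | _ :: p => some p

/-- The component of the exceptional divisor with local equation `y = 0` at the given point, if
there is one. The point is a corner exactly when there is one. -/
noncomputable def axisY : InfNearPoint → Option InfNearPoint
  | [] => none
  | .slope c :: p => if c = 0 then axisY p else none
  | .vertical :: p => axisX p

/-- The point `q` lies on (the strict transform of) the component created by the blow-up
of `p`. -/
def OnComponent (q p : InfNearPoint) : Prop := axisX q = some p ∨ axisY q = some p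

end InfNearPoint

open InfNearPoint

/-- A finite sequence of punctual blow-ups over the origin, given by the finite set of all its
centers. -/
def IsBlowUpSequence (T : Finset InfNearPoint) : Prop :=
  ∀ (d : BlowUpDirection) (p : InfNearPoint), d :: p ∈ T → p ∈ T

/-- The points over the origin in the surface obtained by the blow-ups with centers in `T`, that
is, the points of the exceptional divisor (if `T` is empty: the origin). -/
def IsTerminalPoint (T : Finset InfNearPoint) (q : InfNearPoint) : Prop :=
  q ∉ T ∧ ∀ (d : BlowUpDirection) (p : InfNearPoint), q = d :: p → p ∈ T

/-- The separatrices through `q` of the transformed foliation that are not contained in the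
exceptional divisor; these are the transforms of the separatrices at the origin. -/
def IsSeparatrixOffDivisor (ω : FormalOneForm) (q : InfNearPoint) (f : FormalSeries) : Prop :=
  (ω.transformAt q).IsSeparatrix f ∧
    (q ≠ [] → ¬ Associated f (MvPowerSeries.X 0)) ∧
    (axisY q ≠ none → ¬ Associated f (MvPowerSeries.X 1))

/-- The conditions on a reduction of singularities at one point `q` of the final surface. -/
structure IsReducedAt (ω : FormalOneForm) (q : InfNearPoint) : Prop where
  /-- singularities are reduced -/
  reduced : (ω.transformAt q).IsSingular → (ω.transformAt q).IsReducedSingularity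
  /-- the separatrices have become smooth -/
  smooth : ∀ f, IsSeparatrixOffDivisor ω q f → f.lin 0 ≠ 0 ∨ f.lin 1 ≠ 0
  /-- they are transverse to the exceptional divisor -/
  transverse : q ≠ [] → ∀ f, IsSeparatrixOffDivisor ω q f → f.lin 1 ≠ 0
  /-- they do not pass through a corner -/
  no_corner : axisY q ≠ none → ∀ f, ¬ IsSeparatrixOffDivisor ω q f
  /-- they are disjoint -/
  disjoint : ∀ f g, IsSeparatrixOffDivisor ω q f → IsSeparatrixOffDivisor ω q g → Associated f g

/-- A reduction of singularities. -/
def IsReduction (ω : FormalOneForm) (T : Finset InfNearPoint) : Prop :=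
  IsBlowUpSequence T ∧ ∀ q, IsTerminalPoint T q → IsReducedAt ω q

/-- The minimal reduction of singularities. -/
def IsMinimalReduction (ω : FormalOneForm) (T : Finset InfNearPoint) : Prop :=
  Minimal (IsReduction ω) T

/-- The foliation is a generalized curve: there are no saddle-nodes in its (minimal) reduction of
singularities. -/
def IsGeneralizedCurve (ω : FormalOneForm) : Prop :=
  ∃ T, IsMinimalReduction ω T ∧ ∀ q, IsTerminalPoint T q → ¬ (ω.transformAt q).IsSaddleNode

/-- The component created by the blow-up of `p` is dicritical: it is not invariant. -/
def IsDicritical (ω : FormalOneForm) (p : InfNearPoint) : Prop :=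
  ¬ ∀ d : BlowUpDirection, (ω.transformAt (d :: p)).Invariant (MvPowerSeries.X 0)

/-- The valence of a component: the number of other components that it meets. -/
noncomputable def valence (T : Finset InfNearPoint) (p : InfNearPoint) : ℕ :=
  Set.ncard {p' : InfNearPoint | p' ∈ T ∧ p' ≠ p ∧
    ∃ q, IsTerminalPoint T q ∧ OnComponent q p ∧ OnComponent q p'}

/-- The strict transform of the irreducible curve `f = 0` meets the component `p`. -/
def IsAttachedTo (T : Finset InfNearPoint) (f : FormalSeries) (p : InfNearPoint) : Prop :=
  ∃ q, IsTerminalPoint T q ∧ OnComponent q p ∧ ¬ IsUnit (strictTransformAt f q)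

/-- Curvets of the component `p`: separatrices attached to it (used for dicritical `p`). -/
def IsCurvet (ω : FormalOneForm) (T : Finset InfNearPoint) (p : InfNearPoint)
    (f : FormalSeries) : Prop :=
  ω.IsSeparatrix f ∧ IsAttachedTo T f p

/-- Isolated separatrices: those not attached to a dicritical component. -/
def IsIsolatedSeparatrix (ω : FormalOneForm) (T : Finset InfNearPoint)
    (f : FormalSeries) : Prop :=
  ω.IsSeparatrix f ∧ ∀ p ∈ T, IsDicritical ω p → ¬ IsAttachedTo T f p

/-- The divisor of `F` is the sum of the isolated separatrices and of finitely many curvets of each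
dicritical component, whose coefficients add up to two minus the valence. -/
structure IsBalancedFor (ω : FormalOneForm) (T : Finset InfNearPoint)
    (F : FormalMeroFunction) : Prop where
  support : ∀ f, Irreducible f → ¬ ω.IsSeparatrix f → F.ordAt f = 0
  isolated : ∀ f, IsIsolatedSeparatrix ω T f → F.ordAt f = 1
  /-- `s` contains one equation of every curvet that has a non-zero coefficient -/
  dicritical : ∀ p ∈ T, IsDicritical ω p → ∃ s : Finset FormalSeries,
    (∀ f ∈ s, IsCurvet ω T p f) ∧
    (∀ f ∈ s, ∀ g ∈ s, Associated f g → f = g) ∧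
    (∀ f, IsCurvet ω T p f → F.ordAt f ≠ 0 → ∃ g ∈ s, Associated f g) ∧
    ∑ f ∈ s, F.ordAt f = 2 - (valence T p : ℤ)

/-- `F` is a balanced equation of separatrices of the foliation. -/
def IsBalancedEquation (ω : FormalOneForm) (F : FormalMeroFunction) : Prop :=
  ∃ T, IsMinimalReduction ω T ∧ IsBalancedFor ω T F

/-! ### Puiseux parametrizations, intersection numbers and indices -/

/-- `γ` is a (primitive) Puiseux parametrization `t ↦ (x(t), y(t))` of the irreducible curve
`f = 0`: the series that vanish on `γ` are the multiples of `f`, and `γ` is generically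
one-to-one, that is, `ℂ[[t]]` is the normalization of `ℂ[[x, y]] / (f)`. -/
structure IsPuiseuxParam (f : FormalSeries) (γ : Fin 2 → PowerSeries ℂ) : Prop where
  center : ∀ i, PowerSeries.constantCoeff (γ i) = 0
  ker : ∀ g : FormalSeries, MvPowerSeries.subst γ g = (0 : PowerSeries ℂ) ↔ f ∣ g
  primitive : ∃ N : ℕ, ∀ h : PowerSeries ℂ, (PowerSeries.X : PowerSeries ℂ) ^ N ∣ h →
    ∃ g : FormalSeries, MvPowerSeries.subst γ g = h

/-- A Puiseux parametrization of the irreducible curve `f = 0`. -/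
noncomputable def puiseuxParam (f : FormalSeries) : Fin 2 → PowerSeries ℂ :=
  Classical.epsilon (IsPuiseuxParam f)

/-- `ord_{t = 0} (g ∘ γ)` for a Puiseux parametrization `γ` of the curve `f = 0`
(used for `g` not divisible by `f`). -/
noncomputable def ordAlong (f g : FormalSeries) : ℤ :=
  (PowerSeries.order (MvPowerSeries.subst (puiseuxParam f) g : PowerSeries ℂ)).toNat

open LinearAlgebra.Projectivization in
/-- Intersection number of the curve `f = 0` with the polar curve `(a P + b Q) / H` of the
meromorphic `1`-form, for the point `(a : b)` of the projective line. -/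
noncomputable def polarOrd (η : FormalMeroForm) (f : FormalSeries) (v : ℙ ℂ (Fin 2 → ℂ)) : ℤ :=
  ordAlong f (v.rep 0 • η.P + v.rep 1 • η.Q) - ordAlong f η.H

/-- The polar intersection number: the value of `polarOrd` for a generic point `(a : b)`, that is,
for all but finitely many. -/
noncomputable def polarIntersection (η : FormalMeroForm) (f : FormalSeries) : ℤ :=
  Classical.epsilon fun n : ℤ => {v | polarOrd η f v ≠ n}.Finite

/-- The polar excess of the foliation with respect to the union of the irreducible
curves of the list `C`. -/
noncomputable def polarExcess (ω : FormalOneForm) (F : FormalMeroFunction)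
    (C : List FormalSeries) : ℤ :=
  (C.map fun f => polarIntersection ω.toMero f - polarIntersection F.differential f).sum

/-- The intersection number at the origin `dim_ℂ ℂ[[x, y]] / (f, g)` (used for coprime `f`
and `g`). -/
noncomputable def intersectionNumber (f g : FormalSeries) : ℤ :=
  (Module.finrank ℂ (FormalSeries ⧸ Ideal.span ({f, g} : Set FormalSeries)) : ℤ)

/-- The `GSV`-index with respect to one separatrix `f = 0`: the number `ord_{t = 0} (k / g) ∘ γ`
for a decomposition `g ω = k df + f η` with `g` and `f` relatively prime. -/
noncomputable def gsvBranch (ω : FormalOneForm) (f : FormalSeries) : ℤ :=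
  Classical.epsilon fun n : ℤ => ∃ (g k : FormalSeries) (η : FormalOneForm),
    IsRelPrime g f ∧
    g * ω.a = k * f.dx + f * η.a ∧
    g * ω.b = k * f.dy + f * η.b ∧
    n = ordAlong f k - ordAlong f g

/-- The `GSV`-index with respect to the union of the separatrices of the list `C`, defined
inductively by `GSV(C₀ ∪ C₁) = GSV(C₀) + GSV(C₁) - 2 (C₀, C₁)`. -/
noncomputable def gsvIndex (ω : FormalOneForm) : List FormalSeries → ℤ
  | [] => 0
  | f :: C => gsvBranch ω f + gsvIndex ω C - 2 * intersectionNumber f C.prod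

/-!
The first formula holds branch by branch. Along a separatrix `f` with primitive parametrization `γ`,
the form `ω` is proportional to `df`, and `GSV(f)` is the order of the factor of proportionality,
which is the difference of the polar intersection numbers of `ω` and of `df` (`gsvBranch_eq`).
If `F = f u / w`, then the polar intersection number of `dF` is that of `df`, shifted by the order of
`u / w` along `γ` (`polarIntersection_differential`). The other branches of `C` contribute to `u`;
summation over `C` counts each intersection number of two branches of `C` twice, which agrees with the
correction term of the `GSV`-index of a union (`gsvIndex_eq`). This uses that intersection numbers
are orders along parametrizations (`intersection_branch`), and thus the existence of primitive
parametrizations, by the Newton-Puiseux theorem (`exists_arc_of_order_resX`,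
`FormalArc.NonConst.exists_primitive`).

For the second formula it remains to show that the polar excess vanishes if there are no
saddle-nodes, that is, that `ω` and `dF` have the same order along each branch of `C`
(`IsBalancedReduction.polarIntersection_eq`). Let `ν_q` be the multiplicity of the transform of the
foliation at the infinitely near point `q`, let `m_q` be that of the divisor of `F`, and let `i_q`
be the number of invariant components of the exceptional divisor through `q`. The key is the relation
`m_q + i_q = ν_q + 1` at all centers `q` of the reduction (`IsBalancedReduction.relations`). It is
proved together with analogous relations along the components of the exceptional divisor, from the
final surface downwards.

* At the points of the final surface, the relations along the components express that the foliation
  is reduced without saddle-nodes there (`IsBalancedReduction.corner_relations`,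
  `IsBalancedReduction.smooth_relation`). The number of separatrices enters here: there are two at a
  singular point (`FormalOneForm.exists_two_separatrices`), and one at a regular point.
* The relation at a center `q` is the sum of the relations at the points of the exceptional line of
  the blow-up of `q`. On this line, the foliation has `ν + 1` singularities if the line is
  invariant, and `ν - 1` tangencies if it is not (`FormalOneForm.blowUp_of_not_dicritical`,
  `FormalOneForm.blowUp_of_dicritical`), and the strict transform of a curve has `m` intersections
  (`finsum_ordX_strictTransform`). On a dicritical component, the curvets and the corners contribute
  `(2 - val) + val = 2` (`IsBalancedReduction.finsum_dicritical`).
* The relation along an older component at `q` follows from the relation at `q` and from the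
  relation at the point of this component infinitely near to `q`.

A blow-up divides the pull-back of the foliation by `x ^ ν` or `x ^ (ν + 1)`, and the pull-back of
`F` by `x ^ m`. Hence the relation says that the order of `ω / dF` along a branch, corrected by the
intersection numbers with the invariant components, is not changed by the blow-up
(`IsBalancedReduction.isComparison_cons`). On the final surface it vanishes
(`IsBalancedReduction.isComparison_terminal`).
-/

local notation "𝕆" => PowerSeries ℂ
local notation "𝕣" => FormalSeries
local notation "𝕥" => (PowerSeries.X : PowerSeries ℂ)
local notation "𝕩" => (MvPowerSeries.X 0 : FormalSeries)
local notation "𝕪" => (MvPowerSeries.X 1 : FormalSeries)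

/-! ### Arcs and substitutions -/

/-- A formal arc `t ↦ (x(t), y(t))` through the origin, possibly constant. -/
@[ext] structure FormalArc where
  x : 𝕆
  y : 𝕆
  x_zero : PowerSeries.constantCoeff x = 0
  y_zero : PowerSeries.constantCoeff y = 0

namespace FormalArc

/-- The pair of coordinates of an arc. -/
def toPair (γ : FormalArc) : Fin 2 → 𝕆 := ![γ.x, γ.y]

theorem hasSubst (γ : FormalArc) : MvPowerSeries.HasSubst γ.toPair :=
  MvPowerSeries.hasSubst_of_constantCoeff_zero fun i => by
    fin_cases i
    exacts [γ.x_zero, γ.y_zero]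

/-- Restriction of a series to an arc. -/
noncomputable def ev (γ : FormalArc) : 𝕣 →ₐ[ℂ] 𝕆 := MvPowerSeries.substAlgHom γ.hasSubst

theorem ev_apply (γ : FormalArc) (f : 𝕣) :
    γ.ev f = (MvPowerSeries.subst γ.toPair f : 𝕆) := by
  rw [ev, MvPowerSeries.substAlgHom_apply]

@[simp] theorem ev_X0 (γ : FormalArc) : γ.ev 𝕩 = γ.x := by
  rw [ev_apply, MvPowerSeries.subst_X γ.hasSubst]; rfl

@[simp] theorem ev_X1 (γ : FormalArc) : γ.ev 𝕪 = γ.y := by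
  rw [ev_apply, MvPowerSeries.subst_X γ.hasSubst]; rfl

@[simp] theorem ev_C (γ : FormalArc) (c : ℂ) : γ.ev (MvPowerSeries.C c) = PowerSeries.C c := by
  rw [ev_apply, MvPowerSeries.subst_C]; rfl

@[simp] theorem constantCoeff_ev (γ : FormalArc) (f : 𝕣) :
    PowerSeries.constantCoeff (γ.ev f) = MvPowerSeries.constantCoeff f := by
  have h : MvPowerSeries.constantCoeff (f - MvPowerSeries.C (MvPowerSeries.constantCoeff f)) = 0 := by
    simp
  have h2 := MvPowerSeries.constantCoeff_subst_eq_zero γ.hasSubst (fun i => by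
    fin_cases i
    exacts [γ.x_zero, γ.y_zero]) h
  change PowerSeries.constantCoeff (MvPowerSeries.subst γ.toPair _ : 𝕆) = 0 at h2
  rw [← ev_apply, map_sub, map_sub, ev_C, PowerSeries.constantCoeff_C, sub_eq_zero] at h2
  exact h2

end FormalArc

/-- The substitution `(x, y) ↦ (u, v)` in two variables. -/
noncomputable def substPair (u v : 𝕣) (hu : MvPowerSeries.constantCoeff u = 0)
    (hv : MvPowerSeries.constantCoeff v = 0) : 𝕣 →ₐ[ℂ] 𝕣 :=
  MvPowerSeries.substAlgHom (a := ![u, v])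
    (MvPowerSeries.hasSubst_of_constantCoeff_zero fun i => by fin_cases i; exacts [hu, hv])

section substPair
variable {u v : 𝕣} (hu : MvPowerSeries.constantCoeff u = 0) (hv : MvPowerSeries.constantCoeff v = 0)

theorem hasSubst_pair (hu : MvPowerSeries.constantCoeff u = 0)
    (hv : MvPowerSeries.constantCoeff v = 0) : MvPowerSeries.HasSubst ![u, v] :=
  MvPowerSeries.hasSubst_of_constantCoeff_zero fun i => by fin_cases i; exacts [hu, hv]

theorem substPair_apply (f : 𝕣) : substPair u v hu hv f = MvPowerSeries.subst ![u, v] f := by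
  rw [substPair, MvPowerSeries.substAlgHom_apply]

@[simp] theorem substPair_X0 : substPair u v hu hv 𝕩 = u := by
  rw [substPair_apply, MvPowerSeries.subst_X (hasSubst_pair hu hv)]; rfl

@[simp] theorem substPair_X1 : substPair u v hu hv 𝕪 = v := by
  rw [substPair_apply, MvPowerSeries.subst_X (hasSubst_pair hu hv)]; rfl

@[simp] theorem substPair_C (c : ℂ) :
    substPair u v hu hv (MvPowerSeries.C c) = MvPowerSeries.C c := by
  rw [substPair_apply, MvPowerSeries.subst_C]

/-- The image of an arc under `(x, y) ↦ (u, v)`. -/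
noncomputable def FormalArc.map (γ : FormalArc) (u v : 𝕣) (hu : MvPowerSeries.constantCoeff u = 0)
    (hv : MvPowerSeries.constantCoeff v = 0) : FormalArc :=
  ⟨γ.ev u, γ.ev v, by simpa using hu, by simpa using hv⟩

theorem FormalArc.ev_substPair (γ : FormalArc) (f : 𝕣) :
    γ.ev (substPair u v hu hv f) = (γ.map u v hu hv).ev f := by
  rw [ev_apply, ev_apply, substPair_apply,
    MvPowerSeries.subst_comp_subst_apply (hasSubst_pair hu hv) γ.hasSubst]
  congr 1
  funext i
  fin_cases i
  · change _ = γ.ev u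
    rw [ev_apply]; rfl
  · change _ = γ.ev v
    rw [ev_apply]; rfl

@[simp] theorem constantCoeff_substPair (f : 𝕣) :
    MvPowerSeries.constantCoeff (substPair u v hu hv f) = MvPowerSeries.constantCoeff f := by
  have h := FormalArc.ev_substPair hu hv ⟨0, 0, by simp, by simp⟩ f
  simpa using congrArg PowerSeries.constantCoeff h

end substPair

/-- Substitution of a series without constant term into a series in one variable. -/
noncomputable def substOne (θ : 𝕆) (hθ : PowerSeries.constantCoeff θ = 0) : 𝕆 →ₐ[ℂ] 𝕆 :=
  PowerSeries.substAlgHom (PowerSeries.HasSubst.of_constantCoeff_zero' hθ)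

section substOne
variable {θ : 𝕆} (hθ : PowerSeries.constantCoeff θ = 0)

theorem substOne_apply (a : 𝕆) : substOne θ hθ a = a.subst θ := by
  rw [substOne, PowerSeries.coe_substAlgHom]

@[simp] theorem substOne_X : substOne θ hθ 𝕥 = θ := by
  rw [substOne_apply, PowerSeries.subst_X (PowerSeries.HasSubst.of_constantCoeff_zero' hθ)]

@[simp] theorem substOne_C (c : ℂ) : substOne θ hθ (PowerSeries.C c) = PowerSeries.C c := by
  rw [substOne_apply, PowerSeries.subst_C]; rfl

theorem exists_eq_C_add_X_mul (a : 𝕆) :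
    ∃ b, a = PowerSeries.C (PowerSeries.constantCoeff a) + 𝕥 * b := by
  have : 𝕥 ∣ a - PowerSeries.C (PowerSeries.constantCoeff a) := by
    rw [PowerSeries.X_dvd_iff]; simp
  obtain ⟨b, hb⟩ := this
  exact ⟨b, by rw [← hb]; ring⟩

@[simp] theorem constantCoeff_substOne (a : 𝕆) :
    PowerSeries.constantCoeff (substOne θ hθ a) = PowerSeries.constantCoeff a := by
  obtain ⟨b, hb⟩ := exists_eq_C_add_X_mul a
  rw [hb]
  simp [hθ]

/-- The reparametrization of an arc by `t ↦ θ(t)`. -/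
noncomputable def FormalArc.reparam (γ : FormalArc) (θ : 𝕆)
    (hθ : PowerSeries.constantCoeff θ = 0) : FormalArc :=
  ⟨substOne θ hθ γ.x, substOne θ hθ γ.y, by simpa using γ.x_zero, by simpa using γ.y_zero⟩

theorem FormalArc.ev_reparam (γ : FormalArc) (f : 𝕣) :
    (γ.reparam θ hθ).ev f = substOne θ hθ (γ.ev f) := by
  rw [ev_apply, ev_apply, substOne_apply, PowerSeries.subst_def]
  rw [MvPowerSeries.subst_comp_subst_apply γ.hasSubst
    (PowerSeries.HasSubst.const (PowerSeries.HasSubst.of_constantCoeff_zero' hθ))]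
  congr 1
  funext i
  fin_cases i
  · change substOne θ hθ γ.x = _
    rw [substOne_apply]; rfl
  · change substOne θ hθ γ.y = _
    rw [substOne_apply]; rfl

theorem order_substOne (a : 𝕆) : (substOne θ hθ a).order = a.order * θ.order := by
  by_cases ha : a = 0
  · subst ha
    have : θ.order ≠ 0 := by rwa [PowerSeries.order_ne_zero_iff_constCoeff_eq_zero]
    simp [ENat.top_mul this]
  have h0 := PowerSeries.X_pow_order_mul_divXPowOrder (f := a)
  have h1 : PowerSeries.constantCoeff a.divXPowOrder ≠ 0 := by
    rwa [Ne, PowerSeries.constantCoeff_divXPowOrder_eq_zero_iff]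
  conv_lhs => rw [← h0]
  rw [map_mul, map_pow, substOne_X, PowerSeries.order_mul, PowerSeries.order_pow,
    PowerSeries.order_zero_of_unit (f := substOne θ hθ _), add_zero, nsmul_eq_mul, PowerSeries.coe_toNat_order ha]
  rw [PowerSeries.isUnit_iff_constantCoeff]
  simpa using h1

end substOne

/-- A series in `x`, seen in two variables. -/
noncomputable def inX : 𝕆 →ₐ[ℂ] 𝕣 :=
  PowerSeries.substAlgHom (PowerSeries.HasSubst.X (0 : Fin 2) (S := ℂ))

/-- A series in `y`, seen in two variables. -/
noncomputable def inY : 𝕆 →ₐ[ℂ] 𝕣 :=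
  PowerSeries.substAlgHom (PowerSeries.HasSubst.X (1 : Fin 2) (S := ℂ))

theorem inX_apply (a : 𝕆) : inX a = a.subst 𝕩 := by rw [inX, PowerSeries.coe_substAlgHom]
theorem inY_apply (a : 𝕆) : inY a = a.subst 𝕪 := by rw [inY, PowerSeries.coe_substAlgHom]

@[simp] theorem inX_X : inX 𝕥 = 𝕩 := by
  rw [inX_apply, PowerSeries.subst_X (PowerSeries.HasSubst.X _)]
@[simp] theorem inX_C (c : ℂ) : inX (PowerSeries.C c) = MvPowerSeries.C c := by
  rw [inX_apply, PowerSeries.subst_C]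

theorem FormalArc.ev_inX (γ : FormalArc) (a : 𝕆) : γ.ev (inX a) = substOne γ.x γ.x_zero a := by
  rw [ev_apply, inX_apply, substOne_apply, PowerSeries.subst_def, PowerSeries.subst_def]
  rw [MvPowerSeries.subst_comp_subst_apply
    (PowerSeries.HasSubst.const (PowerSeries.HasSubst.X _)) γ.hasSubst]
  congr 1
  funext i
  rw [MvPowerSeries.subst_X γ.hasSubst]; rfl

theorem FormalArc.ev_inY (γ : FormalArc) (a : 𝕆) : γ.ev (inY a) = substOne γ.y γ.y_zero a := by
  rw [ev_apply, inY_apply, substOne_apply, PowerSeries.subst_def, PowerSeries.subst_def]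
  rw [MvPowerSeries.subst_comp_subst_apply
    (PowerSeries.HasSubst.const (PowerSeries.HasSubst.X _)) γ.hasSubst]
  congr 1
  funext i
  rw [MvPowerSeries.subst_X γ.hasSubst]; rfl

/-- The restriction `f(t, 0)`. -/
noncomputable def resY : 𝕣 →ₐ[ℂ] 𝕆 := FormalArc.ev ⟨𝕥, 0, by simp, by simp⟩

/-- The restriction `f(0, t)`. -/
noncomputable def resX : 𝕣 →ₐ[ℂ] 𝕆 := FormalArc.ev ⟨0, 𝕥, by simp, by simp⟩

@[simp] theorem resY_X0 : resY 𝕩 = 𝕥 := by simp [resY]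
@[simp] theorem resY_X1 : resY 𝕪 = 0 := by simp [resY]
@[simp] theorem resX_X0 : resX 𝕩 = 0 := by simp [resX]
@[simp] theorem resX_X1 : resX 𝕪 = 𝕥 := by simp [resX]
@[simp] theorem resX_C (c : ℂ) : resX (MvPowerSeries.C c) = PowerSeries.C c := by simp [resX]
@[simp] theorem constantCoeff_resX (f : 𝕣) :
    PowerSeries.constantCoeff (resX f) = MvPowerSeries.constantCoeff f := by simp [resX]
@[simp] theorem constantCoeff_resY (f : 𝕣) :
    PowerSeries.constantCoeff (resY f) = MvPowerSeries.constantCoeff f := by simp [resY]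

theorem substOne_id (h : PowerSeries.constantCoeff 𝕥 = 0) (a : 𝕆) : substOne 𝕥 h a = a := by
  rw [substOne_apply, PowerSeries.X_subst]

@[simp] theorem resY_inX (a : 𝕆) : resY (inX a) = a := by
  rw [resY, FormalArc.ev_inX]; exact substOne_id _ a
@[simp] theorem resX_inY (a : 𝕆) : resX (inY a) = a := by
  rw [resX, FormalArc.ev_inY]; exact substOne_id _ a

/-- Division by `y`. -/
theorem exists_eq_inX_add (f : 𝕣) : ∃ h : 𝕣, f = inX (resY f) + 𝕪 * h := by
  obtain ⟨a, h, e⟩ : ∃ a h, f = inX a + 𝕪 * h := by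
    have : 𝕪 ∣ f - inX (PowerSeries.mk fun k => MvPowerSeries.coeff (Finsupp.single 0 k) f) := by
      rw [MvPowerSeries.X_dvd_iff]
      intro m hm
      rw [map_sub, inX_apply, PowerSeries.coeff_subst_single, if_pos, PowerSeries.coeff_mk]
      · have : m = Finsupp.single 0 (m 0) := by
          ext i; fin_cases i <;> simp [hm]
        rw [← this, sub_self]
      · ext i; fin_cases i <;> simp [hm]
    obtain ⟨h, e⟩ := this
    exact ⟨_, h, by rw [← e]; ring⟩
  refine ⟨h, ?_⟩
  have : resY f = a := by rw [e]; simp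
  rw [this, e]

/-- Division by `x`. -/
theorem exists_eq_inY_add (f : 𝕣) : ∃ h : 𝕣, f = inY (resX f) + 𝕩 * h := by
  obtain ⟨a, h, e⟩ : ∃ a h, f = inY a + 𝕩 * h := by
    have : 𝕩 ∣ f - inY (PowerSeries.mk fun k => MvPowerSeries.coeff (Finsupp.single 1 k) f) := by
      rw [MvPowerSeries.X_dvd_iff]
      intro m hm
      rw [map_sub, inY_apply, PowerSeries.coeff_subst_single, if_pos, PowerSeries.coeff_mk]
      · have : m = Finsupp.single 1 (m 1) := by
          ext i; fin_cases i <;> simp [hm]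
        rw [← this, sub_self]
      · ext i; fin_cases i <;> simp [hm]
    obtain ⟨h, e⟩ := this
    exact ⟨_, h, by rw [← e]; ring⟩
  refine ⟨h, ?_⟩
  have : resX f = a := by rw [e]; simp
  rw [this, e]

theorem X0_dvd_iff (f : 𝕣) : 𝕩 ∣ f ↔ resX f = 0 := by
  constructor
  · rintro ⟨g, rfl⟩; simp
  · intro h
    obtain ⟨g, hg⟩ := exists_eq_inY_add f
    exact ⟨g, by rw [hg, h]; simp⟩

theorem X1_dvd_iff (f : 𝕣) : 𝕪 ∣ f ↔ resY f = 0 := by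
  constructor
  · rintro ⟨g, rfl⟩; simp
  · intro h
    obtain ⟨g, hg⟩ := exists_eq_inX_add f
    exact ⟨g, by rw [hg, h]; simp⟩

theorem exists_eq_C_add (f : 𝕣) : ∃ g h : 𝕣,
    f = MvPowerSeries.C (MvPowerSeries.constantCoeff f) + 𝕩 * g + 𝕪 * h := by
  obtain ⟨h, e⟩ := exists_eq_inX_add f
  obtain ⟨b, hb⟩ := exists_eq_C_add_X_mul (resY f)
  refine ⟨inX b, h, ?_⟩
  conv_lhs => rw [e, hb]
  simp

/-- A series of order at least `n` is a combination of the monomials of degree `n`. -/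
theorem exists_eq_sum_of_le_order (n : ℕ) : ∀ (f : 𝕣), (n : ℕ∞) ≤ MvPowerSeries.order f →
    ∃ g : ℕ → 𝕣, f = ∑ j ∈ Finset.range (n + 1), 𝕩 ^ (n - j) * 𝕪 ^ j * g j := by
  induction n with
  | zero => intro f _; exact ⟨fun _ => f, by simp⟩
  | succ n ih =>
    intro f hf
    obtain ⟨h, e⟩ := exists_eq_inX_add f
    have hc : ∀ k ≤ n, PowerSeries.coeff k (resY f) = 0 := by
      intro k hk
      have h1 : MvPowerSeries.coeff (Finsupp.single 0 k) f = 0 := by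
        apply MvPowerSeries.coeff_of_lt_order
        refine lt_of_lt_of_le ?_ hf
        simp only [Finsupp.degree_single]
        exact_mod_cast Nat.lt_succ_of_le hk
      rw [e, map_add, mul_comm, MvPowerSeries.X_def (1 : Fin 2)] at h1
      rw [MvPowerSeries.coeff_mul_monomial, if_neg, add_zero, inX_apply,
        PowerSeries.coeff_subst_single, if_pos (by simp)] at h1
      · simpa using h1
      · intro hle
        have := hle 1
        simp at this
    obtain ⟨b, hb⟩ := PowerSeries.X_pow_dvd_iff.mpr fun k (hk : k < n + 1) =>
      hc k (Nat.lt_succ_iff.mp hk)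
    have hh : (n : ℕ∞) ≤ MvPowerSeries.order h := by
      have h1 : ((n + 1 : ℕ) : ℕ∞) ≤ MvPowerSeries.order (𝕪 * h) := by
        have : 𝕪 * h = f - inX (resY f) := by
          conv_rhs => rw [e]
          rw [map_add, map_mul, resY_X1, zero_mul, add_zero, resY_inX]; ring
        rw [this, sub_eq_add_neg]
        refine le_trans (le_min hf ?_) MvPowerSeries.min_order_le_add
        rw [MvPowerSeries.order_neg, hb, map_mul, map_pow, inX_X, MvPowerSeries.order_mul]
        refine le_trans ?_ le_self_add
        rw [MvPowerSeries.X_pow_eq, MvPowerSeries.order_monomial_of_ne_zero one_ne_zero]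
        simp
      rw [MvPowerSeries.order_mul, MvPowerSeries.X_def,
        MvPowerSeries.order_monomial_of_ne_zero one_ne_zero] at h1
      simp only [Finsupp.degree_single, Nat.cast_add, Nat.cast_one] at h1
      rw [add_comm] at h1
      exact (ENat.add_le_add_iff_left (by simp)).mp h1
    obtain ⟨g, hg⟩ := ih h hh
    refine ⟨fun j => if j = 0 then inX b else g (j - 1), ?_⟩
    rw [Finset.sum_range_succ']
    simp only [Nat.add_eq_zero_iff, one_ne_zero, and_false, if_false, Nat.add_sub_cancel,
      if_true, Nat.sub_zero, pow_zero, mul_one]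
    conv_lhs => rw [e, hb, hg]
    rw [map_mul, map_pow, inX_X, Finset.mul_sum, add_comm]
    congr 1
    refine Finset.sum_congr rfl fun j hj => ?_
    rw [Nat.add_sub_add_right]
    ring

/-! ### Orders of series in one variable -/

theorem eq_zero_of_forall_X_pow_dvd {a : 𝕆} (h : ∀ n : ℕ, 𝕥 ^ n ∣ a) : a = 0 := by
  ext n
  exact PowerSeries.X_pow_dvd_iff.mp (h (n + 1)) n (Nat.lt_succ_self n)

theorem le_order_iff_X_pow_dvd {a : 𝕆} {n : ℕ} : (n : ℕ∞) ≤ a.order ↔ 𝕥 ^ n ∣ a := by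
  rw [PowerSeries.X_pow_dvd_iff]
  constructor
  · intro h m hm
    exact PowerSeries.coeff_of_lt_order m (lt_of_lt_of_le (by exact_mod_cast hm) h)
  · intro h
    exact PowerSeries.nat_le_order a n h

theorem dvd_of_order_le {a b : 𝕆} (h : a.order ≤ b.order) : a ∣ b := by
  by_cases ha : a = 0
  · subst ha
    rw [PowerSeries.order_zero, top_le_iff, PowerSeries.order_eq_top] at h
    rw [h]
  have h0 := PowerSeries.X_pow_order_mul_divXPowOrder (f := a)
  have hu : IsUnit a.divXPowOrder := by
    rw [PowerSeries.isUnit_iff_constantCoeff, isUnit_iff_ne_zero]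
    rwa [Ne, PowerSeries.constantCoeff_divXPowOrder_eq_zero_iff]
  rw [← h0, hu.mul_right_dvd, ← le_order_iff_X_pow_dvd, PowerSeries.coe_toNat_order ha]
  exact h

theorem constantCoeff_eq_zero_iff_X_dvd {a : 𝕆} : PowerSeries.constantCoeff a = 0 ↔ 𝕥 ∣ a :=
  PowerSeries.X_dvd_iff.symm

theorem isUnit_iff_constantCoeff_ne_zero {a : 𝕆} :
    IsUnit a ↔ PowerSeries.constantCoeff a ≠ 0 := by
  rw [PowerSeries.isUnit_iff_constantCoeff, isUnit_iff_ne_zero]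

theorem series_isUnit_iff {f : 𝕣} : IsUnit f ↔ MvPowerSeries.constantCoeff f ≠ 0 := by
  rw [MvPowerSeries.isUnit_iff_constantCoeff, isUnit_iff_ne_zero]

theorem order_eq_zero_iff_isUnit {a : 𝕆} : a.order = 0 ↔ IsUnit a := by
  rw [isUnit_iff_constantCoeff_ne_zero, ← not_iff_not, not_not]
  exact PowerSeries.order_ne_zero_iff_constCoeff_eq_zero

/-- A contracting map of `ℂ[[t]]` has a fixed point. -/
theorem exists_fixedPoint (Φ : 𝕆 → 𝕆)
    (h : ∀ (n : ℕ) (s s' : 𝕆), 𝕥 ^ n ∣ s - s' → 𝕥 ^ (n + 1) ∣ Φ s - Φ s') : ∃ s, Φ s = s := by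
  have h1 : ∀ k, 𝕥 ^ k ∣ Φ^[k + 1] 0 - Φ^[k] 0 := by
    intro k
    induction k with
    | zero => simp
    | succ k ih =>
      rw [Function.iterate_succ_apply' Φ (k + 1), Function.iterate_succ_apply' Φ k]
      refine h _ _ _ ?_
      rwa [← Function.iterate_succ_apply' Φ k]
  have h1' : ∀ k j, k ≤ j → 𝕥 ^ k ∣ Φ^[j] 0 - Φ^[k] 0 := by
    intro k j hkj
    induction j, hkj using Nat.le_induction with
    | base => simp
    | succ j hj ih =>
      have := dvd_add (dvd_trans (pow_dvd_pow _ hj) (h1 j)) ih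
      simpa using this
  set s : 𝕆 := PowerSeries.mk fun k => PowerSeries.coeff k (Φ^[k + 1] 0) with hs
  have h2 : ∀ k, 𝕥 ^ k ∣ s - Φ^[k] 0 := by
    intro k
    rw [PowerSeries.X_pow_dvd_iff]
    intro m hm
    have := PowerSeries.X_pow_dvd_iff.mp (h1' (m + 1) k hm) m (Nat.lt_succ_self m)
    rw [map_sub, sub_eq_zero] at this
    rw [map_sub, hs, PowerSeries.coeff_mk, this, sub_self]
  refine ⟨s, ?_⟩
  rw [← sub_eq_zero]
  apply eq_zero_of_forall_X_pow_dvd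
  intro n
  have h3 := dvd_sub (h n _ _ (h2 n)) (h2 (n + 1))
  rw [Function.iterate_succ_apply'] at h3
  have h4 := dvd_trans (pow_dvd_pow 𝕥 (Nat.le_succ n)) h3
  simpa using h4

/-- Congruent arcs take congruent values. -/
theorem FormalArc.X_pow_dvd_ev_sub (γ γ' : FormalArc) (n : ℕ) (hx : 𝕥 ^ n ∣ γ.x - γ'.x)
    (hy : 𝕥 ^ n ∣ γ.y - γ'.y) (f : 𝕣) : 𝕥 ^ n ∣ γ.ev f - γ'.ev f := by
  suffices ∀ m ≤ n, ∀ f, 𝕥 ^ m ∣ γ.ev f - γ'.ev f from this n le_rfl f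
  intro m
  induction m with
  | zero => simp
  | succ m ih =>
    intro hm f
    obtain ⟨g, k, e⟩ := exists_eq_C_add f
    have e2 : γ.ev f - γ'.ev f = (γ.x - γ'.x) * γ.ev g + γ'.x * (γ.ev g - γ'.ev g)
        + ((γ.y - γ'.y) * γ.ev k + γ'.y * (γ.ev k - γ'.ev k)) := by
      rw [e]
      simp only [map_add, map_mul, ev_C, ev_X0, ev_X1]
      ring
    rw [e2]
    have hx' := constantCoeff_eq_zero_iff_X_dvd.mp γ'.x_zero
    have hy' := constantCoeff_eq_zero_iff_X_dvd.mp γ'.y_zero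
    refine dvd_add (dvd_add ?_ ?_) (dvd_add ?_ ?_)
    · exact Dvd.dvd.mul_right (dvd_trans (pow_dvd_pow _ hm) hx) _
    · rw [pow_succ']
      exact mul_dvd_mul hx' (ih (by omega) g)
    · exact Dvd.dvd.mul_right (dvd_trans (pow_dvd_pow _ hm) hy) _
    · rw [pow_succ']
      exact mul_dvd_mul hy' (ih (by omega) k)

/-! ### Chain rules -/

namespace FormalSeries

@[simp] theorem dx_add (f g : 𝕣) : (f + g).dx = f.dx + g.dx := map_add _ _ _
@[simp] theorem dy_add (f g : 𝕣) : (f + g).dy = f.dy + g.dy := map_add _ _ _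
@[simp] theorem dx_mul (f g : 𝕣) : (f * g).dx = f * g.dx + g * f.dx := by
  simp [dx, Derivation.leibniz]
@[simp] theorem dy_mul (f g : 𝕣) : (f * g).dy = f * g.dy + g * f.dy := by
  simp [dy, Derivation.leibniz]
@[simp] theorem dx_C (c : ℂ) : FormalSeries.dx (MvPowerSeries.C c) = 0 := MvPowerSeries.pderiv_C
@[simp] theorem dy_C (c : ℂ) : FormalSeries.dy (MvPowerSeries.C c) = 0 := MvPowerSeries.pderiv_C
@[simp] theorem dx_X0 : FormalSeries.dx 𝕩 = 1 := MvPowerSeries.pderiv_X_self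
@[simp] theorem dy_X1 : FormalSeries.dy 𝕪 = 1 := MvPowerSeries.pderiv_X_self
@[simp] theorem dx_X1 : FormalSeries.dx 𝕪 = 0 := MvPowerSeries.pderiv_X_of_ne (by decide)
@[simp] theorem dy_X0 : FormalSeries.dy 𝕩 = 0 := MvPowerSeries.pderiv_X_of_ne (by decide)

end FormalSeries

theorem FormalArc.derivative_ev (γ : FormalArc) (f : 𝕣) :
    PowerSeries.derivative ℂ (γ.ev f) =
      γ.ev f.dx * PowerSeries.derivative ℂ γ.x + γ.ev f.dy * PowerSeries.derivative ℂ γ.y := by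
  rw [← sub_eq_zero]
  apply eq_zero_of_forall_X_pow_dvd
  intro n
  induction n generalizing f with
  | zero => simp
  | succ n ih =>
    obtain ⟨g, k, e⟩ := exists_eq_C_add f
    have hx' := constantCoeff_eq_zero_iff_X_dvd.mp γ.x_zero
    have hy' := constantCoeff_eq_zero_iff_X_dvd.mp γ.y_zero
    have h := dvd_add (mul_dvd_mul hx' (ih g)) (mul_dvd_mul hy' (ih k))
    rw [← pow_succ'] at h
    convert h using 1
    rw [e]
    simp only [map_add, map_mul, ev_C, ev_X0, ev_X1, FormalSeries.dx_add, FormalSeries.dx_mul,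
      FormalSeries.dx_C, FormalSeries.dx_X0, FormalSeries.dx_X1, FormalSeries.dy_add,
      FormalSeries.dy_mul, FormalSeries.dy_C, FormalSeries.dy_X0, FormalSeries.dy_X1,
      Derivation.leibniz, PowerSeries.derivative_C, smul_eq_mul, map_zero, mul_zero, mul_one]
    ring

theorem eq_zero_of_forall_le_order {f : 𝕣} (h : ∀ n : ℕ, (n : ℕ∞) ≤ MvPowerSeries.order f) :
    f = 0 := by
  rw [← MvPowerSeries.order_eq_top_iff]
  exact ENat.eq_top_iff_forall_ge.mpr h

theorem one_le_order_iff {f : 𝕣} :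
    1 ≤ MvPowerSeries.order f ↔ MvPowerSeries.constantCoeff f = 0 :=
  MvPowerSeries.one_le_order_iff_constCoeff_eq_zero

/-- The chain rule for a substitution and any derivation. -/
theorem derivation_substPair (D : Derivation ℂ 𝕣 𝕣) {u v : 𝕣}
    (hu : MvPowerSeries.constantCoeff u = 0) (hv : MvPowerSeries.constantCoeff v = 0) (f : 𝕣) :
    D (substPair u v hu hv f) =
      substPair u v hu hv f.dx * D u + substPair u v hu hv f.dy * D v := by
  rw [← sub_eq_zero]
  apply eq_zero_of_forall_le_order
  intro n
  induction n generalizing f with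
  | zero => simp
  | succ n ih =>
    obtain ⟨g, k, e⟩ := exists_eq_C_add f
    have hC : D (MvPowerSeries.C (MvPowerSeries.constantCoeff f)) = 0 :=
      D.map_algebraMap (MvPowerSeries.constantCoeff f)
    have key : D (substPair u v hu hv f) -
        (substPair u v hu hv f.dx * D u + substPair u v hu hv f.dy * D v) =
        u * (D (substPair u v hu hv g) -
          (substPair u v hu hv g.dx * D u + substPair u v hu hv g.dy * D v)) +
        v * (D (substPair u v hu hv k) -
          (substPair u v hu hv k.dx * D u + substPair u v hu hv k.dy * D v)) := by
      rw [e]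
      simp only [map_add, map_mul, substPair_C, substPair_X0, substPair_X1, FormalSeries.dx_add,
        FormalSeries.dx_mul, hC,
        FormalSeries.dx_C, FormalSeries.dx_X0, FormalSeries.dx_X1, FormalSeries.dy_add,
        FormalSeries.dy_mul, FormalSeries.dy_C, FormalSeries.dy_X0, FormalSeries.dy_X1,
        Derivation.leibniz, smul_eq_mul, map_zero, mul_zero, mul_one]
      ring
    rw [key]
    refine le_trans (le_min ?_ ?_) MvPowerSeries.min_order_le_add
    · rw [MvPowerSeries.order_mul, Nat.cast_succ, add_comm]
      exact add_le_add (one_le_order_iff.mpr hu) (ih g)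
    · rw [MvPowerSeries.order_mul, Nat.cast_succ, add_comm]
      exact add_le_add (one_le_order_iff.mpr hv) (ih k)

/-! ### The ring of series in two variables -/

/-- Series in `x, y` are series in `y` with coefficients series in `x`. -/
noncomputable def seriesEquiv : 𝕣 ≃ₐ[ℂ] PowerSeries (PowerSeries ℂ) :=
  (MvPowerSeries.renameEquiv ℂ (finSuccEquiv 1 |>.trans
    (Equiv.optionCongr (Equiv.ofUnique (Fin 1) Unit)))).trans
    (MvPowerSeries.optionEquivLeft Unit ℂ)

noncomputable instance : UniqueFactorizationMonoid FormalSeries :=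
  (seriesEquiv.symm : PowerSeries (PowerSeries ℂ) ≃* 𝕣).uniqueFactorizationMonoid inferInstance

theorem prime_X0 : Prime 𝕩 := by
  refine ⟨fun h => PowerSeries.X_ne_zero (R := ℂ) (by simpa using congrArg resY h), ?_, ?_⟩
  · rw [series_isUnit_iff]; simp
  · intro a b h
    rw [X0_dvd_iff, map_mul, mul_eq_zero] at h
    rwa [X0_dvd_iff, X0_dvd_iff]

theorem prime_X1 : Prime 𝕪 := by
  refine ⟨fun h => PowerSeries.X_ne_zero (R := ℂ) (by simpa using congrArg resX h), ?_, ?_⟩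
  · rw [series_isUnit_iff]; simp
  · intro a b h
    rw [X1_dvd_iff, map_mul, mul_eq_zero] at h
    rwa [X1_dvd_iff, X1_dvd_iff]

/-- The arc is not reduced to a point. -/
def FormalArc.NonConst (γ : FormalArc) : Prop := γ.x ≠ 0 ∨ γ.y ≠ 0

theorem isPrime_span_X0_X1 : (Ideal.span {𝕩, 𝕪}).IsPrime := by
  have : Ideal.span {𝕩, 𝕪} = RingHom.ker (MvPowerSeries.constantCoeff (R := ℂ) (σ := Fin 2)) := by
    ext f
    rw [RingHom.mem_ker, Ideal.mem_span_pair]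
    constructor
    · rintro ⟨a, b, rfl⟩; simp
    · intro h
      obtain ⟨g, k, e⟩ := exists_eq_C_add f
      refine ⟨g, k, ?_⟩
      conv_rhs => rw [e, h]
      simp
      ring
  rw [this]
  exact RingHom.ker_isPrime _

theorem height_maximal_le_two : (Ideal.span {𝕩, 𝕪}).height ≤ 2 := by
  have hp := isPrime_span_X0_X1
  have h := Ideal.height_le_card_of_mem_minimalPrimes_span (p := Ideal.span {𝕩, 𝕪})
    (s := {𝕩, 𝕪}) (by simp) ⟨⟨hp, le_rfl⟩, fun q hq _ => hq.2⟩
  refine h.trans ?_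
  exact_mod_cast Set.ncard_insert_le _ _ |>.trans (by simp)

/-- The series that vanish on a non-constant arc of an irreducible curve are the multiples of
the equation of the curve: `ℂ[[x, y]]` has dimension two. -/
theorem FormalArc.NonConst.ev_eq_zero_iff {γ : FormalArc} (hγ : γ.NonConst) {f : 𝕣}
    (hf : Irreducible f) (h : γ.ev f = 0) (g : 𝕣) : γ.ev g = 0 ↔ f ∣ g := by
  have hprime : Prime f := hf.prime
  constructor
  swap
  · rintro ⟨k, rfl⟩; rw [map_mul, h, zero_mul]
  intro hg
  by_contra hfg
  set P : Ideal 𝕣 := RingHom.ker γ.ev with hP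
  have : P.IsPrime := RingHom.ker_isPrime _
  have : (Ideal.span {f}).IsPrime := (Ideal.span_singleton_prime hprime.ne_zero).mpr hprime
  -- otherwise `0 < (f) < ker γ < (x, y)` would be a chain of prime ideals of length three
  have h1 : Ideal.span {f} < P := by
    refine lt_of_le_of_ne ?_ ?_
    · rw [Ideal.span_singleton_le_iff_mem]; exact h
    · intro e
      apply hfg
      rw [← Ideal.mem_span_singleton, e]
      exact hg
  have h2 : P < Ideal.span {𝕩, 𝕪} := by
    refine lt_of_le_of_ne ?_ ?_
    · intro k hk
      have hk : γ.ev k = 0 := hk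
      have h0 : MvPowerSeries.constantCoeff k = 0 := by
        rw [← γ.constantCoeff_ev, hk, map_zero]
      obtain ⟨a, b, e⟩ := exists_eq_C_add k
      rw [Ideal.mem_span_pair]
      refine ⟨a, b, ?_⟩
      conv_rhs => rw [e, h0]
      simp
      ring
    · intro e
      have hx : 𝕩 ∈ P := by rw [e]; exact Ideal.subset_span (by simp)
      have hy : 𝕪 ∈ P := by rw [e]; exact Ideal.subset_span (by simp)
      have hx : γ.ev 𝕩 = 0 := hx
      have hy : γ.ev 𝕪 = 0 := hy
      rw [ev_X0] at hx
      rw [ev_X1] at hy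
      rcases hγ with h | h
      · exact h hx
      · exact h hy
  have h0 : (⊥ : Ideal 𝕣) < Ideal.span {f} := by
    rw [bot_lt_iff_ne_bot, Ne, Ideal.span_singleton_eq_bot]
    exact hprime.ne_zero
  have hm := isPrime_span_X0_X1
  have e1 := Ideal.height_add_one_le_of_lt_of_isPrime h0
  have e2 := Ideal.height_add_one_le_of_lt_of_isPrime h1
  have e3 := Ideal.height_add_one_le_of_lt_of_isPrime h2
  have e4 : (⊥ : Ideal 𝕣).height + 1 + 1 + 1 ≤ 2 :=
    le_trans (add_le_add_left (le_trans (add_le_add_left e1 1) e2) 1)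
      (e3.trans height_maximal_le_two)
  rw [Ideal.height_bot] at e4
  norm_num at e4

/-! ### Arcs: equations and primitive parametrizations -/

theorem substOne_expand {u : 𝕆} (hu : PowerSeries.constantCoeff u = 0) (P : 𝕆) (K : ℕ) :
    𝕥 ^ K ∣ substOne u hu P - ∑ k ∈ Finset.range K, PowerSeries.C (PowerSeries.coeff k P) * u ^ k := by
  induction K generalizing P with
  | zero => simp
  | succ K ih =>
    obtain ⟨Q, hQ⟩ := exists_eq_C_add_X_mul P
    have h1 : substOne u hu P - ∑ k ∈ Finset.range (K + 1),
        PowerSeries.C (PowerSeries.coeff k P) * u ^ k =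
        u * (substOne u hu Q - ∑ k ∈ Finset.range K,
          PowerSeries.C (PowerSeries.coeff k Q) * u ^ k) := by
      have h2 : ∀ k, PowerSeries.coeff (k + 1) P = PowerSeries.coeff k Q := by
        intro k
        rw [hQ, map_add, PowerSeries.coeff_succ_X_mul, PowerSeries.coeff_C]
        simp
      rw [Finset.sum_range_succ', mul_sub, Finset.mul_sum]
      simp only [h2, pow_zero, mul_one, PowerSeries.coeff_zero_eq_constantCoeff_apply]
      conv_lhs => rw [hQ]
      simp only [map_add, map_mul, substOne_C, substOne_X, pow_succ]
      have h3 : ∑ x ∈ Finset.range K, u * (PowerSeries.C (PowerSeries.coeff x Q) * u ^ x) =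
          ∑ x ∈ Finset.range K, PowerSeries.C (PowerSeries.coeff x Q) * (u ^ x * u) :=
        Finset.sum_congr rfl fun _ _ => by ring
      rw [h3]
      simp
      ring
    rw [h1, pow_succ']
    exact mul_dvd_mul (constantCoeff_eq_zero_iff_X_dvd.mp hu) (ih Q)

/-- A series whose successive remainders can be killed by multiples of powers of `θ` is a series
in `θ`. -/
theorem exists_eq_substOne {θ : 𝕆} (hθ : PowerSeries.constantCoeff θ = 0) (P : ℕ → 𝕆 → Prop)
    (step : ∀ k r, P k r → ∃ c : ℂ, P (k + 1) (r - PowerSeries.C c * θ ^ k))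
    (hdvd : ∀ k r, P k r → 𝕥 ^ k ∣ r) {a : 𝕆} (ha : P 0 a) : ∃ α, a = substOne θ hθ α := by
  choose c hc using step
  let r : (k : ℕ) → {r : 𝕆 // P k r} := fun k => Nat.rec ⟨a, ha⟩
    (fun k r => ⟨r.1 - PowerSeries.C (c k r.1 r.2) * θ ^ k, hc k r.1 r.2⟩) k
  have hr : ∀ K, a - ∑ k ∈ Finset.range K, PowerSeries.C (c k (r k).1 (r k).2) * θ ^ k = (r K).1 := by
    intro K
    induction K with
    | zero => simp [r]
    | succ K ih =>
      rw [Finset.sum_range_succ, ← sub_sub, ih]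
  refine ⟨PowerSeries.mk fun k => c k (r k).1 (r k).2, ?_⟩
  rw [← sub_eq_zero]
  apply eq_zero_of_forall_X_pow_dvd
  intro K
  have h1 := substOne_expand hθ (PowerSeries.mk fun k => c k (r k).1 (r k).2) K
  have h2 := hdvd K _ (r K).2
  rw [← hr K] at h2
  have h3 := dvd_sub h2 h1
  simp only [PowerSeries.coeff_mk] at h3
  convert h3 using 1
  ring

/-- Series of consecutive orders `N, ..., N + n - 1` generate the series of order at least `N`
over the series in a given `u` of order `n`. -/
theorem exists_eq_sum_mul_substOne {u : 𝕆} (hu : PowerSeries.constantCoeff u = 0) {n N : ℕ}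
    (hn : u.order = n) {v : ℕ → 𝕆} (hv : ∀ i < n, (v i).order = (N + i : ℕ)) {h : 𝕆}
    (hh : 𝕥 ^ N ∣ h) :
    ∃ P : ℕ → 𝕆, h = ∑ i ∈ Finset.range n, v i * substOne u hu (P i) := by
  -- the first `n` coefficients are removed with constant multiples of the `v i`; what remains is
  -- `u` times a series to which the same applies
  have block : ∀ h : 𝕆, 𝕥 ^ N ∣ h → ∃ (c : ℕ → ℂ) (h' : 𝕆), 𝕥 ^ N ∣ h' ∧
      h = ∑ i ∈ Finset.range n, PowerSeries.C (c i) * v i + u * h' := by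
    intro h hh
    have : ∀ j ≤ n, ∃ (c : ℕ → ℂ) (r : 𝕆), 𝕥 ^ (N + j) ∣ r ∧
        h = ∑ i ∈ Finset.range j, PowerSeries.C (c i) * v i + r := by
      intro j
      induction j with
      | zero => intro _; exact ⟨0, h, by simpa using hh, by simp⟩
      | succ j ih =>
        intro hj
        obtain ⟨c, r, hr, e⟩ := ih (by omega)
        have hvj := hv j (by omega)
        have hne : PowerSeries.coeff (N + j) (v j) ≠ 0 := by
          have h0 : v j ≠ 0 := by
            intro h0
            rw [h0, PowerSeries.order_zero] at hvj
            exact absurd hvj.symm (ENat.natCast_ne_top _)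
          have := PowerSeries.coeff_order h0
          rwa [hvj, ENat.toNat_natCast] at this
        set d := PowerSeries.coeff (N + j) r / PowerSeries.coeff (N + j) (v j) with hd
        refine ⟨fun i => if i = j then d else c i, r - PowerSeries.C d * v j, ?_, ?_⟩
        · rw [PowerSeries.X_pow_dvd_iff]
          intro m hm
          rw [map_sub, PowerSeries.coeff_C_mul]
          rcases Nat.lt_succ_iff_lt_or_eq.mp (show m < (N + j) + 1 by omega) with hm | hm
          · rw [PowerSeries.X_pow_dvd_iff.mp hr m hm, PowerSeries.coeff_of_lt_order m
              (by rw [hvj]; exact_mod_cast hm)]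
            simp
          · rw [hm, hd, div_mul_cancel₀ _ hne, sub_self]
        · rw [Finset.sum_range_succ, e]
          simp only [if_true]
          have : ∑ x ∈ Finset.range j, PowerSeries.C (if x = j then d else c x) * v x =
              ∑ x ∈ Finset.range j, PowerSeries.C (c x) * v x := by
            refine Finset.sum_congr rfl fun i hi => ?_
            rw [if_neg (by have := Finset.mem_range.mp hi; omega)]
          rw [this]
          ring
    obtain ⟨c, r, ⟨s, rfl⟩, e⟩ := this n le_rfl
    have hd : u ∣ 𝕥 ^ n := dvd_of_order_le (by rw [hn, PowerSeries.order_X_pow])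
    obtain ⟨w, hw⟩ := hd
    refine ⟨c, 𝕥 ^ N * w * s, Dvd.intro (w * s) (by ring), ?_⟩
    rw [e, pow_add, hw]
    ring
  choose c h' hh' e using block
  by_cases hn0 : n = 0
  · have : u.order ≠ 0 := by rwa [PowerSeries.order_ne_zero_iff_constCoeff_eq_zero]
    rw [hn, hn0] at this
    exact absurd rfl this
  let H : ℕ → {h : 𝕆 // 𝕥 ^ N ∣ h} := fun k => Nat.rec ⟨h, hh⟩
    (fun _ r => ⟨h' r.1 r.2, hh' r.1 r.2⟩) k
  let C : ℕ → ℕ → ℂ := fun k i => c (H k).1 (H k).2 i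
  have hH : ∀ k, (H k).1 = ∑ i ∈ Finset.range n, PowerSeries.C (C k i) * v i + u * (H (k + 1)).1 :=
    fun k => e (H k).1 (H k).2
  have hK : ∀ K, h = ∑ i ∈ Finset.range n, v i *
      ∑ k ∈ Finset.range K, PowerSeries.C (C k i) * u ^ k + u ^ K * (H K).1 := by
    intro K
    induction K with
    | zero => simp [H]
    | succ K ih =>
      conv_lhs => rw [ih, hH K]
      simp only [Finset.sum_range_succ, mul_add, Finset.sum_add_distrib]
      rw [Finset.mul_sum, pow_succ]
      have : ∑ i ∈ Finset.range n, u ^ K * (PowerSeries.C (C K i) * v i) =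
          ∑ i ∈ Finset.range n, v i * (PowerSeries.C (C K i) * u ^ K) :=
        Finset.sum_congr rfl fun _ _ => by ring
      rw [this]
      ring
  refine ⟨fun i => PowerSeries.mk fun k => C k i, ?_⟩
  rw [← sub_eq_zero]
  apply eq_zero_of_forall_X_pow_dvd
  intro K
  have e1 : h - ∑ i ∈ Finset.range n, v i * substOne u hu (PowerSeries.mk fun k => C k i) =
      u ^ K * (H K).1 - ∑ i ∈ Finset.range n, v i *
        (substOne u hu (PowerSeries.mk fun k => C k i) -
          ∑ k ∈ Finset.range K, PowerSeries.C (C k i) * u ^ k) := by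
    conv_lhs => rw [hK K]
    simp only [mul_sub, Finset.sum_sub_distrib]
    ring
  rw [e1]
  refine dvd_sub (Dvd.dvd.mul_right (pow_dvd_pow_of_dvd
    (constantCoeff_eq_zero_iff_X_dvd.mp hu) K) _) (Finset.dvd_sum fun i _ => Dvd.dvd.mul_left ?_ _)
  have := substOne_expand hu (PowerSeries.mk fun k => C k i) K
  simpa only [PowerSeries.coeff_mk] using this

theorem resY_sum_inX (Q : ℕ → 𝕆) (m : ℕ) (h : ∑ k ∈ Finset.range m, inX (Q k) * 𝕪 ^ k = 0) :
    ∀ k < m, Q k = 0 := by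
  induction m generalizing Q with
  | zero => intro k hk; omega
  | succ m ih =>
    rw [Finset.sum_range_succ'] at h
    have h0 : Q 0 = 0 := by
      have := congrArg resY h
      simpa [map_sum] using this
    have h1 : 𝕪 * ∑ k ∈ Finset.range m, inX (Q (k + 1)) * 𝕪 ^ k = 0 := by
      rw [← h, h0, Finset.mul_sum]
      simp only [map_zero, zero_mul, add_zero]
      exact Finset.sum_congr rfl fun _ _ => by ring
    have h2 := (mul_eq_zero.mp h1).resolve_left prime_X1.ne_zero
    intro k hk
    rcases k with _ | k
    · exact h0
    · exact ih (fun k => Q (k + 1)) h2 k (by omega)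

/-- Every arc lies on a curve: if `x ≠ 0`, then `y` is integral over the series in `x`. -/
theorem FormalArc.exists_ev_eq_zero (γ : FormalArc) : ∃ f, f ≠ 0 ∧ γ.ev f = 0 := by
  by_cases hx : γ.x = 0
  · exact ⟨𝕩, prime_X0.ne_zero, by simpa using hx⟩
  obtain ⟨n, hn⟩ : ∃ n : ℕ, γ.x.order = n := ⟨_, (PowerSeries.coe_toNat_order hx).symm⟩
  have h1 : ∀ k : ℕ, ∃ P : ℕ → 𝕆, γ.y ^ k =
      ∑ i ∈ Finset.range n, 𝕥 ^ i * substOne γ.x γ.x_zero (P i) := fun k =>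
    exists_eq_sum_mul_substOne γ.x_zero (N := 0) hn (fun i _ => by
      rw [PowerSeries.order_X_pow, zero_add]) (by simp)
  choose P hP using h1
  -- the `n + 1` powers of `y` are dependent over the series in `γ.x`, as these series form a ring
  -- over which `ℂ[[t]]` is generated by `n` elements
  let M : Matrix (Fin (n + 1)) (Fin (n + 1)) 𝕆 := fun k i => if (i : ℕ) < n then P k i else 0
  have hM : M.det = 0 := Matrix.det_eq_zero_of_column_eq_zero (Fin.last n) fun i => by simp [M]
  obtain ⟨w, hw, hw0⟩ := Matrix.exists_vecMul_eq_zero_iff.mpr hM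
  let Q : ℕ → 𝕆 := fun k => if h : k < n + 1 then w ⟨k, h⟩ else 0
  have hQ : ∀ i < n, ∑ k ∈ Finset.range (n + 1), Q k * P k i = 0 := by
    intro i hi
    have := congrFun hw0 ⟨i, by omega⟩
    simp only [Matrix.vecMul, dotProduct, M, hi, if_true, Pi.zero_apply] at this
    rw [Finset.sum_range, ← this]
    exact Finset.sum_congr rfl fun k _ => by rw [show Q k = w k from dif_pos k.2]
  refine ⟨∑ k ∈ Finset.range (n + 1), inX (Q k) * 𝕪 ^ k, ?_, ?_⟩
  · intro h
    apply hw
    funext k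
    have := resY_sum_inX Q (n + 1) h k k.2
    rwa [show Q k = w k from dif_pos k.2] at this
  · rw [map_sum]
    simp only [map_mul, map_pow, ev_X1, γ.ev_inX, hP, Finset.mul_sum]
    rw [Finset.sum_comm]
    apply Finset.sum_eq_zero
    intro i hi
    have h2 := congrArg (substOne γ.x γ.x_zero) (hQ i (Finset.mem_range.mp hi))
    rw [map_zero, map_sum] at h2
    calc _ = 𝕥 ^ i * ∑ k ∈ Finset.range (n + 1), substOne γ.x γ.x_zero (Q k * P k i) := by
          rw [Finset.mul_sum]
          exact Finset.sum_congr rfl fun _ _ => by rw [map_mul]; ring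
      _ = 0 := by rw [h2, mul_zero]

/-- Every arc lies on an irreducible curve. -/
theorem FormalArc.exists_irreducible (γ : FormalArc) :
    ∃ f, Irreducible f ∧ γ.ev f = 0 := by
  obtain ⟨f, hf0, hf⟩ := γ.exists_ev_eq_zero
  induction f using UniqueFactorizationMonoid.induction_on_prime with
  | h₁ => exact absurd rfl hf0
  | h₂ u hu =>
    have := hu.map γ.ev
    rw [hf] at this
    exact absurd this not_isUnit_zero
  | h₃ a p ha hp ih =>
    rw [map_mul, mul_eq_zero] at hf
    rcases hf with h | h
    · exact ⟨p, hp.irreducible, h⟩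
    · exact ih ha h

/-- A primitive arc: `ℂ[[t]]` is the normalization of the ring of the curve. -/
def FormalArc.Primitive (γ : FormalArc) : Prop :=
  ∃ N : ℕ, ∀ h : 𝕆, 𝕥 ^ N ∣ h → ∃ g : 𝕣, γ.ev g = h

/-- Every non-constant arc is a reparametrization of a primitive one. The parameter of the latter
is a quotient of two elements of the ring of the curve whose order is the greatest common divisor
of all orders. -/
theorem FormalArc.NonConst.exists_primitive {γ : FormalArc} (hγ : γ.NonConst) :
    ∃ (γ' : FormalArc) (θ : 𝕆) (hθ : PowerSeries.constantCoeff θ = 0),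
      γ = γ'.reparam θ hθ ∧ γ'.Primitive := by
  -- the semigroup of the orders of the elements of the ring of the curve
  let M : AddSubmonoid ℕ :=
    { carrier := {n | ∃ a : 𝕣, (γ.ev a).order = n}
      zero_mem' := ⟨1, by simp⟩
      add_mem' := by
        rintro m n ⟨a, ha⟩ ⟨b, hb⟩
        exact ⟨a * b, by rw [map_mul, PowerSeries.order_mul, ha, hb]; simp⟩ }
  have hM : ∀ n, n ∈ M ↔ ∃ a : 𝕣, (γ.ev a).order = n := fun n => Iff.rfl
  set e := Nat.setGcd (M : Set ℕ) with he
  have he0 : e ≠ 0 := by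
    rw [he, Ne, Nat.setGcd_eq_zero_iff]
    intro hsub
    have key : ∀ u : 𝕣, MvPowerSeries.constantCoeff u = 0 → γ.ev u ≠ 0 → False := by
      intro u hu hne
      have h1 : (γ.ev u).order.toNat ∈ M := ⟨u, (PowerSeries.coe_toNat_order hne).symm⟩
      have h2 : (γ.ev u).order.toNat = 0 := hsub h1
      have h3 : (γ.ev u).order = 0 := by
        rw [← PowerSeries.coe_toNat_order hne, h2]; rfl
      rw [order_eq_zero_iff_isUnit, isUnit_iff_constantCoeff_ne_zero] at h3
      simp [hu] at h3
    rcases hγ with h | h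
    · exact key 𝕩 (by simp) (by simpa using h)
    · exact key 𝕪 (by simp) (by simpa using h)
  have hdvd : ∀ (a : 𝕣), γ.ev a ≠ 0 → e ∣ (γ.ev a).order.toNat := fun a ha =>
    Nat.setGcd_dvd_of_mem (show _ ∈ (M : Set ℕ) from ⟨a, (PowerSeries.coe_toNat_order ha).symm⟩)
  obtain ⟨N, hN⟩ := Nat.exists_mem_closure_of_ge (s := (M : Set ℕ))
  rw [AddSubmonoid.closure_eq] at hN
  have hN' : ∀ m ≥ N, ∃ a : 𝕣, (γ.ev a).order = (e * m : ℕ) := fun m hm =>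
    hN (e * m) (le_trans hm (Nat.le_mul_of_pos_left _ (Nat.pos_of_ne_zero he0))) (dvd_mul_right _ _)
  obtain ⟨a₁, h₁⟩ := hN' (N + 1) (by omega)
  obtain ⟨a₂, h₂⟩ := hN' N le_rfl
  have ha2 : γ.ev a₂ ≠ 0 := by
    intro h
    rw [h, PowerSeries.order_zero] at h₂
    exact absurd h₂.symm (ENat.natCast_ne_top _)
  -- the quotient of elements of orders `e (N + 1)` and `e N` has order `e`
  obtain ⟨θ, hθ⟩ : γ.ev a₂ ∣ γ.ev a₁ := dvd_of_order_le (by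
    rw [h₁, h₂]
    exact_mod_cast Nat.mul_le_mul_left e (Nat.le_succ N))
  have hθo : θ.order = e := by
    have := congrArg PowerSeries.order hθ
    rw [PowerSeries.order_mul, h₁, h₂, mul_add, mul_one, Nat.cast_add] at this
    exact (ENat.add_right_injective_of_ne_top (ENat.natCast_ne_top _) this).symm
  have hθ0 : PowerSeries.constantCoeff θ = 0 := by
    rw [← PowerSeries.order_ne_zero_iff_constCoeff_eq_zero, hθo]
    exact_mod_cast he0
  -- the successive remainders are quotients of elements of the ring by powers of `a₂`, so that their
  -- orders are multiples of `e` and can be raised with multiples of powers of `θ`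
  have series : ∀ a : 𝕣, ∃ α, γ.ev a = substOne θ hθ0 α := by
    intro a
    refine exists_eq_substOne hθ0
      (fun k r => 𝕥 ^ (e * k) ∣ r ∧ ∃ b, γ.ev b = r * γ.ev a₂ ^ k) ?_ ?_ ⟨by simp, a, by simp⟩
    · rintro k r ⟨hr, b, hb⟩
      have hθk : (θ ^ k).order = (e * k : ℕ) := by
        rw [PowerSeries.order_pow, hθo, nsmul_eq_mul, mul_comm]; simp
      have hne : PowerSeries.coeff (e * k) (θ ^ k) ≠ 0 := by
        have h0 : θ ^ k ≠ 0 := by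
          intro h0
          rw [h0, PowerSeries.order_zero] at hθk
          exact absurd hθk.symm (ENat.natCast_ne_top _)
        have := PowerSeries.coeff_order h0
        rwa [hθk, ENat.toNat_natCast] at this
      set d := PowerSeries.coeff (e * k) r / PowerSeries.coeff (e * k) (θ ^ k) with hd
      have h1 : 𝕥 ^ (e * k + 1) ∣ r - PowerSeries.C d * θ ^ k := by
        rw [PowerSeries.X_pow_dvd_iff]
        intro m hm
        rw [map_sub, PowerSeries.coeff_C_mul]
        rcases Nat.lt_succ_iff_lt_or_eq.mp hm with hm | hm
        · rw [PowerSeries.X_pow_dvd_iff.mp hr m hm, PowerSeries.coeff_of_lt_order m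
            (by rw [hθk]; exact_mod_cast hm)]
          simp
        · rw [hm, hd, div_mul_cancel₀ _ hne, sub_self]
      have h2 : ∃ b', γ.ev b' = (r - PowerSeries.C d * θ ^ k) * γ.ev a₂ ^ (k + 1) := by
        refine ⟨b * a₂ - MvPowerSeries.C d * a₁ ^ k * a₂, ?_⟩
        rw [map_sub, map_mul, map_mul, map_mul, map_pow, ev_C, hb, hθ]
        ring
      refine ⟨d, ?_, h2⟩
      obtain ⟨b', hb'⟩ := h2
      rw [← le_order_iff_X_pow_dvd] at h1 ⊢
      by_cases h0 : r - PowerSeries.C d * θ ^ k = 0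
      · rw [h0]; simp
      have h3 := hdvd b' (by rw [hb']; exact mul_ne_zero h0 (pow_ne_zero _ ha2))
      obtain ⟨j, hj⟩ : ∃ j : ℕ, (r - PowerSeries.C d * θ ^ k).order = j :=
        ⟨_, (PowerSeries.coe_toNat_order h0).symm⟩
      have h4 : (γ.ev b').order = (j + (k + 1) * (e * N) : ℕ) := by
        rw [hb', PowerSeries.order_mul, PowerSeries.order_pow, hj, h₂, nsmul_eq_mul]
        push_cast
        ring
      rw [h4, ENat.toNat_natCast] at h3
      have h5 : e ∣ j := (Nat.dvd_add_left (Dvd.intro ((k + 1) * N) (by ring))).mp h3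
      rw [hj] at h1 ⊢
      have h6 : e * k + 1 ≤ j := by exact_mod_cast h1
      obtain ⟨j', rfl⟩ := h5
      have h7 : k < j' := lt_of_mul_lt_mul_left (Nat.lt_of_succ_le h6) (Nat.zero_le e)
      exact_mod_cast Nat.mul_le_mul_left e h7
    · rintro k r ⟨hr, -⟩
      exact dvd_trans (pow_dvd_pow _ (Nat.le_mul_of_pos_left _ (Nat.pos_of_ne_zero he0))) hr
  obtain ⟨α, hα⟩ := series 𝕩
  obtain ⟨β, hβ⟩ := series 𝕪
  rw [ev_X0] at hα
  rw [ev_X1] at hβ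
  let γ' : FormalArc := ⟨α, β, by
    have := γ.x_zero
    rwa [hα, constantCoeff_substOne] at this, by
    have := γ.y_zero
    rwa [hβ, constantCoeff_substOne] at this⟩
  have hγγ' : γ = γ'.reparam θ hθ0 := FormalArc.ext hα hβ
  refine ⟨γ', θ, hθ0, hγγ', N, ?_⟩
  -- the semigroup of the new arc contains all large numbers, which gives a conductor
  have hord : ∀ m ≥ N, ∃ a : 𝕣, (γ'.ev a).order = m := by
    intro m hm
    obtain ⟨a, ha⟩ := hN' m hm
    refine ⟨a, ?_⟩
    rw [hγγ', ev_reparam, order_substOne, hθo] at ha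
    have h0 : γ'.ev a ≠ 0 := by
      intro h0
      rw [h0, PowerSeries.order_zero, ENat.top_mul (by exact_mod_cast he0)] at ha
      exact absurd ha.symm (ENat.natCast_ne_top _)
    rw [← PowerSeries.coe_toNat_order h0] at ha ⊢
    have ha' : (γ'.ev a).order.toNat * e = e * m := by exact_mod_cast ha
    rw [mul_comm] at ha'
    exact_mod_cast Nat.eq_of_mul_eq_mul_left (Nat.pos_of_ne_zero he0) ha'
  intro h hh
  choose! g hg using hord
  have main : ∀ (u : 𝕆) (hu : PowerSeries.constantCoeff u = 0), u ≠ 0 →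
      (∀ P, ∃ k, γ'.ev k = substOne u hu P) → ∃ k, γ'.ev k = h := by
    intro u hu hu0 hk
    choose k hk using hk
    obtain ⟨P, hP⟩ := exists_eq_sum_mul_substOne hu (n := u.order.toNat) (N := N)
      (PowerSeries.coe_toNat_order hu0).symm (v := fun i => γ'.ev (g (N + i)))
      (fun i _ => hg (N + i) (by omega)) hh
    refine ⟨∑ i ∈ Finset.range u.order.toNat, g (N + i) * k (P i), ?_⟩
    rw [map_sum, hP]
    exact Finset.sum_congr rfl fun i _ => by rw [map_mul, hk]
  by_cases h0 : γ'.x = 0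
  · have hy : γ'.y ≠ 0 := by
      intro hy
      rw [hγγ'] at hγ
      rcases hγ with h | h
      · apply h; change substOne θ hθ0 γ'.x = 0; rw [h0, map_zero]
      · apply h; change substOne θ hθ0 γ'.y = 0; rw [hy, map_zero]
    exact main γ'.y γ'.y_zero hy fun P => ⟨inY P, γ'.ev_inY P⟩
  · exact main γ'.x γ'.x_zero h0 fun P => ⟨inX P, γ'.ev_inX P⟩

theorem FormalArc.NonConst.of_reparam {γ : FormalArc} {θ : 𝕆}
    {hθ : PowerSeries.constantCoeff θ = 0} (h : (γ.reparam θ hθ).NonConst) : γ.NonConst := by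
  rcases h with h | h
  · exact Or.inl fun h0 => h (by change substOne θ hθ γ.x = 0; rw [h0, map_zero])
  · exact Or.inr fun h0 => h (by change substOne θ hθ γ.y = 0; rw [h0, map_zero])

theorem substOne_eq_zero_iff {θ : 𝕆} (hθ : PowerSeries.constantCoeff θ = 0) (h0 : θ ≠ 0) (a : 𝕆) :
    substOne θ hθ a = 0 ↔ a = 0 := by
  constructor
  · intro h
    by_contra ha
    have h1 := order_substOne hθ a
    rw [h, PowerSeries.order_zero, ← PowerSeries.coe_toNat_order ha,
      ← PowerSeries.coe_toNat_order h0] at h1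
    exact ENat.natCast_ne_top (a.order.toNat * θ.order.toNat) (by rw [h1]; push_cast; rfl)
  · rintro rfl; exact map_zero _

theorem FormalArc.NonConst.param_ne_zero {γ : FormalArc} {θ : 𝕆}
    {hθ : PowerSeries.constantCoeff θ = 0} (h : (γ.reparam θ hθ).NonConst) : θ ≠ 0 := by
  rintro rfl
  have key : ∀ a : 𝕆, PowerSeries.constantCoeff a = 0 → substOne 0 hθ a = 0 := by
    intro a ha
    obtain ⟨b, hb⟩ := exists_eq_C_add_X_mul a
    rw [hb, ha]
    simp
  rcases h with h | h
  · exact h (key _ γ.x_zero)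
  · exact h (key _ γ.y_zero)

/-- `γ` is a primitive parametrization of the irreducible curve `f = 0`. -/
structure FormalArc.Parametrizes (γ : FormalArc) (f : 𝕣) : Prop where
  ker : ∀ g, γ.ev g = 0 ↔ f ∣ g
  primitive : γ.Primitive

theorem FormalArc.Parametrizes.nonConst {γ : FormalArc} {f : 𝕣} (h : γ.Parametrizes f) :
    γ.NonConst := by
  by_contra hc
  rw [FormalArc.NonConst, not_or, not_not, not_not] at hc
  obtain ⟨N, hN⟩ := h.primitive
  have h1 : 𝕥 ^ N ∣ 𝕥 ^ (N + 1) := pow_dvd_pow _ (Nat.le_succ N)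
  obtain ⟨g, hg⟩ := hN _ h1
  obtain ⟨a, b, e⟩ := exists_eq_C_add g
  rw [e] at hg
  simp only [map_add, map_mul, ev_X0, ev_X1, hc.1, hc.2, zero_mul, add_zero, ev_C] at hg
  have h2 := congrArg (PowerSeries.coeff (N + 1)) hg
  rw [PowerSeries.coeff_X_pow_self, PowerSeries.coeff_C] at h2
  simp at h2

theorem FormalArc.Parametrizes.irreducible {γ : FormalArc} {f : 𝕣} (h : γ.Parametrizes f) :
    Irreducible f := by
  obtain ⟨p, hp, h0⟩ := γ.exists_irreducible
  have h1 : f ∣ p := (h.ker p).mp h0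
  have h2 : p ∣ f := (h.nonConst.ev_eq_zero_iff hp h0 f).mp ((h.ker f).mpr dvd_rfl)
  exact (associated_of_dvd_dvd h2 h1).irreducible hp

theorem FormalArc.Parametrizes.of_associated {γ : FormalArc} {f g : 𝕣} (h : γ.Parametrizes f)
    (hfg : Associated f g) : γ.Parametrizes g :=
  ⟨fun k => by rw [h.ker, hfg.dvd_iff_dvd_left], h.primitive⟩

/-- A curve on which a non-constant arc lies has a primitive parametrization. -/
theorem FormalArc.NonConst.exists_parametrizes {γ : FormalArc} (hγ : γ.NonConst) {f : 𝕣}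
    (hf : Irreducible f) (h : γ.ev f = 0) : ∃ γ' : FormalArc, γ'.Parametrizes f := by
  obtain ⟨γ', θ, hθ, e, hp⟩ := hγ.exists_primitive
  rw [e] at hγ
  have h1 : γ'.ev f = 0 := by
    rw [e, ev_reparam, substOne_eq_zero_iff hθ hγ.param_ne_zero] at h
    exact h
  exact ⟨γ', hγ.of_reparam.ev_eq_zero_iff hf h1, hp⟩

/-! ### Existence of parametrizations -/

/-- The formal implicit function theorem. -/
theorem exists_implicit {f : 𝕣} (h0 : MvPowerSeries.constantCoeff f = 0)
    (h1 : (resX f).order = 1) :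
    ∃ (s : 𝕆) (hs : PowerSeries.constantCoeff s = 0), FormalArc.ev ⟨𝕥, s, by simp, hs⟩ f = 0 := by
  obtain ⟨g, h, e⟩ := exists_eq_C_add f
  rw [h0, map_zero, zero_add] at e
  have hh : IsUnit h := by
    rw [series_isUnit_iff]
    intro hc
    have h2 : resX f = 𝕥 * resX h := by rw [e]; simp
    rw [h2, PowerSeries.order_mul, PowerSeries.order_X] at h1
    have h3 : (resX h).order = 0 := by
      exact ENat.add_right_injective_of_ne_top (n := 1) (by simp) (by simpa using h1)
    rw [order_eq_zero_iff_isUnit, isUnit_iff_constantCoeff_ne_zero] at h3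
    simp [hc] at h3
  obtain ⟨w, hw⟩ := hh.exists_right_inv
  let A : 𝕆 → FormalArc := fun σ => ⟨𝕥, 𝕥 * σ, by simp, by simp⟩
  obtain ⟨σ, hσ⟩ := exists_fixedPoint (fun σ => - (A σ).ev (g * w)) (by
    intro n s s' hss
    have h3 := (A s').X_pow_dvd_ev_sub (A s) (n + 1) (by simp [A]) (by
      change 𝕥 ^ (n + 1) ∣ 𝕥 * s' - 𝕥 * s
      rw [← mul_sub, pow_succ', ← neg_sub s s']
      exact mul_dvd_mul_left _ (dvd_neg.mpr hss)) (g * w)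
    convert h3 using 1
    ring)
  refine ⟨𝕥 * σ, by simp, ?_⟩
  change (A σ).ev f = 0
  rw [e, map_add, map_mul, map_mul, FormalArc.ev_X0, FormalArc.ev_X1]
  have h4 : (A σ).ev h * (A σ).ev w = 1 := by rw [← map_mul, hw, map_one]
  have h5 : -((A σ).ev g * (A σ).ev w) = σ := by rw [← map_mul]; exact hσ
  change 𝕥 * (A σ).ev g + 𝕥 * σ * (A σ).ev h = 0
  calc _ = 𝕥 * (A σ).ev g + 𝕥 * (-((A σ).ev g * (A σ).ev w)) * (A σ).ev h := by rw [h5]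
    _ = 𝕥 * (A σ).ev g * (1 - (A σ).ev h * (A σ).ev w) := by ring
    _ = 0 := by rw [h4]; ring

theorem resX_dy (f : 𝕣) : resX f.dy = PowerSeries.derivative ℂ (resX f) := by
  rw [resX, FormalArc.derivative_ev]
  simp

theorem order_derivative {a : 𝕆} {n : ℕ} (h : a.order = (n + 1 : ℕ)) :
    (PowerSeries.derivative ℂ a).order = n := by
  rw [PowerSeries.order_eq_nat]
  have h0 : a ≠ 0 := by
    rintro rfl
    rw [PowerSeries.order_zero] at h
    exact absurd h.symm (ENat.natCast_ne_top _)
  constructor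
  · rw [PowerSeries.coeff_derivative]
    have := PowerSeries.coeff_order h0
    rw [h, ENat.toNat_natCast] at this
    exact mul_ne_zero this (by exact_mod_cast Nat.succ_ne_zero n)
  · intro i hi
    rw [PowerSeries.coeff_derivative, PowerSeries.coeff_of_lt_order, zero_mul]
    rw [h]
    exact_mod_cast Nat.succ_lt_succ hi

theorem order_coe_polynomial {p : Polynomial ℂ} (hp : p ≠ 0) :
    (p : 𝕆).order = p.natTrailingDegree := by
  rw [PowerSeries.order_eq_nat]
  constructor
  · rw [Polynomial.coeff_coe]
    exact Polynomial.trailingCoeff_nonzero_iff_nonzero.mpr hp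
  · intro i hi
    rw [Polynomial.coeff_coe, Polynomial.coeff_eq_zero_of_lt_natTrailingDegree hi]

theorem exists_eq_sum_inX (n : ℕ) (f : 𝕣) : ∃ (a : ℕ → 𝕆) (h : 𝕣),
    f = ∑ i ∈ Finset.range n, inX (a i) * 𝕪 ^ i + 𝕪 ^ n * h := by
  induction n with
  | zero => exact ⟨0, f, by simp⟩
  | succ n ih =>
    obtain ⟨a, h, e⟩ := ih
    obtain ⟨k, hk⟩ := exists_eq_inX_add h
    refine ⟨fun i => if i = n then resY h else a i, k, ?_⟩
    rw [Finset.sum_range_succ]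
    have : ∑ i ∈ Finset.range n, inX (if i = n then resY h else a i) * 𝕪 ^ i =
        ∑ i ∈ Finset.range n, inX (a i) * 𝕪 ^ i := by
      refine Finset.sum_congr rfl fun i hi => ?_
      rw [if_neg (by have := Finset.mem_range.mp hi; omega)]
    rw [this]
    simp only [if_true]
    conv_lhs => rw [e, hk]
    ring


theorem dy_inX (a : 𝕆) : FormalSeries.dy (inX a) = 0 := by
  apply eq_zero_of_forall_le_order
  intro n
  induction n generalizing a with
  | zero => simp
  | succ n ih =>
    obtain ⟨b, hb⟩ := exists_eq_C_add_X_mul a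
    have : FormalSeries.dy (inX a) = 𝕩 * FormalSeries.dy (inX b) := by
      rw [hb]; simp
    rw [this, MvPowerSeries.order_mul, Nat.cast_succ, add_comm]
    exact add_le_add (one_le_order_iff.mpr (by simp)) (ih b)

theorem iterate_dy_add_X1_mul (k : ℕ) (a : 𝕆) (g : 𝕣) :
    FormalSeries.dy^[k + 1] (inX a + 𝕪 * g) =
      𝕪 * FormalSeries.dy^[k + 1] g + ((k : ℂ) + 1) • FormalSeries.dy^[k] g := by
  induction k with
  | zero => simp [dy_inX]
  | succ k ih =>
    rw [Function.iterate_succ_apply', ih, Function.iterate_succ_apply' _ (k + 1) g,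
      Function.iterate_succ_apply' _ k g]
    have hs : ∀ (c : ℂ) (f : 𝕣), FormalSeries.dy (c • f) = c • FormalSeries.dy f := fun c f =>
      (MvPowerSeries.pderiv ℂ 1).map_smul c f
    simp only [FormalSeries.dy_add, FormalSeries.dy_mul, FormalSeries.dy_X1, hs, mul_one]
    push_cast
    rw [add_smul ((k : ℂ) + 1) 1, one_smul]
    ring

theorem resY_iterate_dy (n : ℕ) (a : ℕ → 𝕆) (h : 𝕣) :
    ∃ c : ℂ, c ≠ 0 ∧ resY (FormalSeries.dy^[n]
      (∑ i ∈ Finset.range (n + 1), inX (a i) * 𝕪 ^ i + 𝕪 ^ (n + 1) * h)) = c • a n := by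
  induction n generalizing a with
  | zero => exact ⟨1, one_ne_zero, by simp⟩
  | succ n ih =>
    obtain ⟨c, hc, e⟩ := ih (fun i => a (i + 1))
    refine ⟨((n : ℂ) + 1) * c, mul_ne_zero (by exact_mod_cast Nat.succ_ne_zero n) hc, ?_⟩
    have : ∑ i ∈ Finset.range (n + 1 + 1), inX (a i) * 𝕪 ^ i + 𝕪 ^ (n + 1 + 1) * h =
        inX (a 0) + 𝕪 *
          (∑ i ∈ Finset.range (n + 1), inX (a (i + 1)) * 𝕪 ^ i + 𝕪 ^ (n + 1) * h) := by
      rw [Finset.sum_range_succ', mul_add, Finset.mul_sum]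
      have h3 : ∑ i ∈ Finset.range (n + 1), inX (a (i + 1)) * 𝕪 ^ (i + 1) =
          ∑ i ∈ Finset.range (n + 1), 𝕪 * (inX (a (i + 1)) * 𝕪 ^ i) :=
        Finset.sum_congr rfl fun _ _ => by ring
      rw [h3]
      ring
    rw [this, iterate_dy_add_X1_mul, map_add, map_mul, resY_X1, zero_mul, zero_add, map_smul, e,
      smul_smul]

theorem substOne_zero (h : PowerSeries.constantCoeff (0 : 𝕆) = 0) (a : 𝕆) :
    substOne 0 h a = PowerSeries.C (PowerSeries.constantCoeff a) := by
  obtain ⟨b, hb⟩ := exists_eq_C_add_X_mul a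
  conv_lhs => rw [hb]
  simp

@[simp] theorem resX_inX (a : 𝕆) : resX (inX a) = PowerSeries.C (PowerSeries.constantCoeff a) := by
  rw [resX, FormalArc.ev_inX, substOne_zero]

theorem substPair_inX {u v : 𝕣} (hu hv) (a : 𝕆) :
    substPair u v hu hv (inX a) = PowerSeries.subst u a := by
  rw [substPair_apply, inX_apply, PowerSeries.subst_def, PowerSeries.subst_def,
    MvPowerSeries.subst_comp_subst_apply
      (PowerSeries.HasSubst.const (PowerSeries.HasSubst.X _)) (hasSubst_pair hu hv)]
  congr 1
  funext i
  rw [MvPowerSeries.subst_X (hasSubst_pair hu hv)]; rfl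

theorem inX_substOne {θ : 𝕆} (hθ : PowerSeries.constantCoeff θ = 0) (a : 𝕆) :
    inX (substOne θ hθ a) = PowerSeries.subst (inX θ) a := by
  rw [inX_apply, substOne_apply, inX_apply, PowerSeries.subst_comp_subst_apply
    (PowerSeries.HasSubst.of_constantCoeff_zero' hθ) (PowerSeries.HasSubst.X _)]

theorem constantCoeff_inX (a : 𝕆) :
    MvPowerSeries.constantCoeff (inX a) = PowerSeries.constantCoeff a := by
  rw [← constantCoeff_resX, resX_inX]; simp

theorem FormalArc.ev_map_zero {γ : FormalArc} (hx : γ.x = 0) (hy : γ.y = 0) (f : 𝕣) :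
    γ.ev f = PowerSeries.C (MvPowerSeries.constantCoeff f) := by
  obtain ⟨a, b, e⟩ := exists_eq_C_add f
  conv_lhs => rw [e]
  simp [hx, hy]

/-- A polynomial with vanishing subleading coefficient that is not a monomial has a root of
multiplicity smaller than the degree. -/
theorem exists_root_multiplicity_lt {n : ℕ} (hn : n ≠ 0) (P : Polynomial ℂ) (hdeg : P.natDegree = n)
    (h1 : P.coeff (n - 1) = 0) {i : ℕ} (hi : i < n) (hi0 : P.coeff i ≠ 0) :
    ∃ c : ℂ, P.rootMultiplicity c ≠ 0 ∧ P.rootMultiplicity c < n := by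
  have hP : P ≠ 0 := by rintro rfl; exact hi0 (by simp)
  obtain ⟨c, hc⟩ := Complex.exists_root (f := P) (by
    rw [Polynomial.degree_eq_natDegree hP, hdeg]
    exact_mod_cast Nat.pos_of_ne_zero hn)
  have h2 : P.rootMultiplicity c ≠ 0 := ((Polynomial.rootMultiplicity_pos hP).mpr hc).ne'
  have h3 : P.rootMultiplicity c ≤ n := by
    rw [← hdeg, ← Polynomial.count_roots]
    exact (Multiset.count_le_card _ _).trans (Polynomial.card_roots' P)
  refine ⟨c, h2, lt_of_le_of_ne h3 fun h4 => ?_⟩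
  obtain ⟨Q, hQ⟩ := Polynomial.pow_rootMultiplicity_dvd P c
  rw [h4] at hQ
  have hQ0 : Q ≠ 0 := by rintro rfl; exact hP (by rw [hQ, mul_zero])
  have hQd : Q.natDegree = 0 := by
    have := congrArg Polynomial.natDegree hQ
    rw [Polynomial.natDegree_mul (pow_ne_zero _ (Polynomial.X_sub_C_ne_zero c)) hQ0,
      Polynomial.natDegree_pow, Polynomial.natDegree_X_sub_C, hdeg] at this
    omega
  rw [Polynomial.eq_C_of_natDegree_eq_zero hQd] at hQ
  have hl : Q.coeff 0 ≠ 0 := by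
    intro h0
    apply hQ0
    rw [Polynomial.eq_C_of_natDegree_eq_zero hQd, h0, map_zero]
  have h5 : c = 0 := by
    have h6 := h1
    rw [hQ, Polynomial.coeff_mul_C, sub_eq_add_neg, ← map_neg, Polynomial.coeff_X_add_C_pow] at h6
    have h7 : n - (n - 1) = 1 := by omega
    rw [h7, pow_one, mul_eq_zero, or_iff_left hl, mul_eq_zero, or_iff_left, neg_eq_zero] at h6
    · exact h6
    · exact_mod_cast (Nat.choose_pos (Nat.sub_le n 1)).ne'
  apply hi0
  rw [hQ, h5, map_zero, sub_zero, Polynomial.coeff_mul_C, Polynomial.coeff_X_pow, if_neg hi.ne,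
    zero_mul]

/-- The Newton-Puiseux theorem: a curve that does not contain the axis `x = 0` has a
non-constant arc. The sum of the roots is normalized to zero, `x` is replaced by a power that
makes all slopes integral, and the first edge of the Newton polygon is resolved: no root of its
polynomial has full multiplicity, so that the order of `f(0, y)` drops. -/
theorem exists_arc_of_order_resX (n : ℕ) (hn : n ≠ 0) (f : 𝕣) (hf : (resX f).order = n) :
    ∃ γ : FormalArc, γ.x ≠ 0 ∧ γ.ev f = 0 := by
  classical
  induction n using Nat.strong_induction_on generalizing f with
  | _ n ih =>
  obtain ⟨n', rfl⟩ : ∃ n', n = n' + 1 := Nat.exists_eq_succ_of_ne_zero hn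
  -- translation along a root of the derivative of order `n - 1`
  have hD : ∀ k ≤ n', (resX (FormalSeries.dy^[k] f)).order = (n' - k + 1 : ℕ) := by
    intro k
    induction k with
    | zero => intro _; simpa using hf
    | succ k ihk =>
      intro hk
      rw [Function.iterate_succ_apply', resX_dy, order_derivative]
      rw [ihk (by omega)]
      congr 1
      omega
  have hD1 : (resX (FormalSeries.dy^[n'] f)).order = 1 := by
    rw [hD n' le_rfl]; simp
  obtain ⟨s, hs, hs1⟩ := exists_implicit (by
    rw [← constantCoeff_resX, ← PowerSeries.order_ne_zero_iff_constCoeff_eq_zero, hD1]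
    exact one_ne_zero) hD1
  have hv : MvPowerSeries.constantCoeff (𝕪 + inX s) = 0 := by
    rw [map_add, constantCoeff_inX, hs]; simp
  let T := substPair 𝕩 (𝕪 + inX s) (by simp) hv
  have hTd : ∀ (k : ℕ) (g : 𝕣), FormalSeries.dy^[k] (T g) = T (FormalSeries.dy^[k] g) := by
    intro k g
    induction k with
    | zero => rfl
    | succ k ihk =>
      rw [Function.iterate_succ_apply', ihk, Function.iterate_succ_apply']
      have := derivation_substPair (MvPowerSeries.pderiv ℂ 1) (u := 𝕩) (by simp) hv
        (FormalSeries.dy^[k] g)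
      change FormalSeries.dy (T _) = T _ * FormalSeries.dy 𝕩 + T _ * FormalSeries.dy (𝕪 + inX s) at this
      rw [this]
      simp [dy_inX]
  suffices ∃ γ : FormalArc, γ.x ≠ 0 ∧ γ.ev (T f) = 0 by
    obtain ⟨γ, h1, h2⟩ := this
    refine ⟨γ.map 𝕩 (𝕪 + inX s) (by simp) hv, ?_, ?_⟩
    · change γ.ev 𝕩 ≠ 0
      rwa [γ.ev_X0]
    · rwa [← FormalArc.ev_substPair]
  obtain ⟨a, h, e⟩ := exists_eq_sum_inX (n' + 1) (T f)
  have han : a n' = 0 := by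
    obtain ⟨c, hc, e2⟩ := resY_iterate_dy n' a h
    rw [← e, hTd] at e2
    have h3 : resY (T (FormalSeries.dy^[n'] f)) = 0 := by
      rw [resY, FormalArc.ev_substPair]
      refine Eq.trans (congrArg (fun δ : FormalArc => δ.ev _) (FormalArc.ext ?_ ?_)) hs1
      · change FormalArc.ev _ 𝕩 = _
        simp
      · change FormalArc.ev _ (𝕪 + inX s) = _
        rw [map_add, FormalArc.ev_X1, FormalArc.ev_inX, zero_add]
        exact substOne_id _ s
    rw [h3] at e2
    exact (smul_eq_zero.mp e2.symm).resolve_left hc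
  have hTf : (resX (T f)).order = (n' + 1 : ℕ) := by
    rw [← hf, resX, FormalArc.ev_substPair]
    congr 3
    ext1
    · change FormalArc.ev _ 𝕩 = _
      simp
    · change FormalArc.ev _ (𝕪 + inX s) = _
      rw [map_add, FormalArc.ev_X1, FormalArc.ev_inX, substOne_zero, hs]
      simp
  have hcoef : ∀ i, PowerSeries.coeff i (resX (T f)) =
      if i < n' + 1 then PowerSeries.constantCoeff (a i)
      else PowerSeries.coeff (i - (n' + 1)) (resX h) := by
    intro i
    rw [e]
    simp only [map_add, map_sum, map_mul, map_pow, resX_inX, resX_X1, PowerSeries.coeff_C_mul,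
      PowerSeries.coeff_X_pow, PowerSeries.coeff_X_pow_mul']
    by_cases h1 : i < n' + 1
    · rw [if_neg (by omega), if_pos h1, add_zero, Finset.sum_eq_single i]
      · simp
      · intro j _ hj; simp [hj.symm]
      · intro hi; exact absurd (Finset.mem_range.mpr h1) hi
    · rw [if_pos (by omega), if_neg h1, Finset.sum_eq_zero, zero_add]
      intro j hj
      have := Finset.mem_range.mp hj
      rw [if_neg (by omega), mul_zero]
  have ha0 : ∀ i < n' + 1, PowerSeries.constantCoeff (a i) = 0 := by
    intro i hi
    have := hcoef i
    rw [if_pos hi, PowerSeries.coeff_of_lt_order i (by rw [hTf]; exact_mod_cast hi)] at this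
    exact this.symm
  have hh0 : MvPowerSeries.constantCoeff h ≠ 0 := by
    have h1 := (PowerSeries.order_eq_nat.mp hTf).1
    rw [hcoef, if_neg (lt_irrefl _), Nat.sub_self,
      PowerSeries.coeff_zero_eq_constantCoeff_apply, constantCoeff_resX] at h1
    exact h1
  by_cases hall : ∀ i < n' + 1, a i = 0
  · refine ⟨⟨𝕥, 0, by simp, by simp⟩, PowerSeries.X_ne_zero, ?_⟩
    rw [e, Finset.sum_eq_zero (fun i hi => by
      rw [hall i (Finset.mem_range.mp hi), map_zero, zero_mul])]
    simp
  push Not at hall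
  -- the first slope of the Newton polygon, after `x` is replaced by `x ^ q`
  set q := (n' + 1).factorial with hq
  have hq0 : q ≠ 0 := Nat.factorial_ne_zero _
  have hXq : PowerSeries.constantCoeff (𝕥 ^ q) = 0 := by simp [hq0]
  have hdvd : ∀ i < n' + 1, n' + 1 - i ∣ q := fun i hi =>
    Nat.dvd_factorial (by omega) (by omega)
  let slope : ℕ → ℕ := fun i => (a i).order.toNat * (q / (n' + 1 - i))
  have hslope : ∀ i < n' + 1, slope i * (n' + 1 - i) = (a i).order.toNat * q := by
    intro i hi
    simp only [slope]
    rw [mul_assoc, Nat.div_mul_cancel (hdvd i hi)]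
  obtain ⟨i₀, hi₀, hmin⟩ := Finset.exists_min_image
    ((Finset.range (n' + 1)).filter fun i => a i ≠ 0) slope (by
      obtain ⟨i, hi, hi'⟩ := hall
      exact ⟨i, by simp [hi, hi']⟩)
  rw [Finset.mem_filter, Finset.mem_range] at hi₀
  set p := slope i₀ with hp
  have hAord : ∀ i, a i ≠ 0 →
      (substOne (𝕥 ^ q) hXq (a i)).order = ((a i).order.toNat * q : ℕ) := by
    intro i hi
    rw [order_substOne, PowerSeries.order_X_pow, Nat.cast_mul, PowerSeries.coe_toNat_order hi]
  have hb : ∀ i, ∃ b : 𝕆, i < n' + 1 →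
      substOne (𝕥 ^ q) hXq (a i) = 𝕥 ^ (p * (n' + 1 - i)) * b := by
    intro i
    by_cases hi : i < n' + 1
    swap
    · exact ⟨0, fun h => absurd h hi⟩
    by_cases h0 : a i = 0
    · exact ⟨0, fun _ => by rw [h0, map_zero, mul_zero]⟩
    · have : 𝕥 ^ (p * (n' + 1 - i)) ∣ substOne (𝕥 ^ q) hXq (a i) := by
        rw [← le_order_iff_X_pow_dvd, hAord i h0, ← hslope i hi]
        exact_mod_cast Nat.mul_le_mul_right _ (hmin i (by simp [hi, h0]))
      obtain ⟨b, hb⟩ := this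
      exact ⟨b, fun _ => hb⟩
  choose b hb using hb
  have hp0 : p ≠ 0 := by
    rw [hp]
    have h1 : (a i₀).order.toNat ≠ 0 := by
      intro h1
      have h2 : (a i₀).order = 0 := by
        rw [← PowerSeries.coe_toNat_order hi₀.2, h1]; rfl
      rw [order_eq_zero_iff_isUnit, isUnit_iff_constantCoeff_ne_zero] at h2
      exact h2 (ha0 i₀ hi₀.1)
    have h3 := hslope i₀ hi₀.1
    intro h4
    rw [h4, zero_mul] at h3
    exact (mul_ne_zero h1 hq0) h3.symm
  have hbi₀ : PowerSeries.constantCoeff (b i₀) ≠ 0 := by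
    rw [← isUnit_iff_constantCoeff_ne_zero, ← order_eq_zero_iff_isUnit]
    have h1 := congrArg PowerSeries.order (hb i₀ hi₀.1)
    rw [hAord i₀ hi₀.2, PowerSeries.order_mul, PowerSeries.order_X_pow, hp, hslope i₀ hi₀.1] at h1
    exact ENat.add_right_injective_of_ne_top
      (ENat.natCast_ne_top ((a i₀).order.toNat * q)) (h1.symm.trans (add_zero _).symm)
  have hbn : b n' = 0 := by
    have h1 := hb n' (by omega)
    rw [han, map_zero] at h1
    exact (mul_eq_zero.mp h1.symm).resolve_left (pow_ne_zero _ PowerSeries.X_ne_zero)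
  let P : Polynomial ℂ := ∑ i ∈ Finset.range (n' + 1),
    Polynomial.C (PowerSeries.constantCoeff (b i)) * Polynomial.X ^ i +
    Polynomial.C (MvPowerSeries.constantCoeff h) * Polynomial.X ^ (n' + 1)
  have hPc : ∀ i < n' + 1, P.coeff i = PowerSeries.constantCoeff (b i) := by
    intro i hi
    simp only [P, Polynomial.coeff_add, Polynomial.finsetSum_coeff, Polynomial.coeff_C_mul,
      Polynomial.coeff_X_pow]
    rw [if_neg hi.ne, mul_zero, add_zero, Finset.sum_eq_single i]
    · simp
    · intro j _ hj; rw [if_neg hj.symm, mul_zero]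
    · intro h; exact absurd (Finset.mem_range.mpr hi) h
  have hPd : P.natDegree = n' + 1 := by
    have h1 : (∑ i ∈ Finset.range (n' + 1),
        Polynomial.C (PowerSeries.constantCoeff (b i)) * Polynomial.X ^ i).degree <
        (Polynomial.C (MvPowerSeries.constantCoeff h) * Polynomial.X ^ (n' + 1)).degree := by
      rw [Polynomial.degree_C_mul_X_pow _ hh0]
      refine lt_of_le_of_lt (Polynomial.degree_sum_le _ _) ?_
      rw [Finset.sup_lt_iff (WithBot.bot_lt_coe _)]
      intro i hi
      refine lt_of_le_of_lt (Polynomial.degree_C_mul_X_pow_le _ _) ?_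
      exact_mod_cast Finset.mem_range.mp hi
    rw [Polynomial.natDegree_eq_of_degree_eq (Polynomial.degree_add_eq_right_of_degree_lt h1),
      Polynomial.natDegree_C_mul_X_pow _ _ hh0]
  obtain ⟨c, hc0, hcn⟩ := exists_root_multiplicity_lt (by omega) P hPd
    (by rw [Nat.add_sub_cancel, hPc n' (by omega), hbn, map_zero]) hi₀.1
    (by rw [hPc i₀ hi₀.1]; exact hbi₀)
  have hu : MvPowerSeries.constantCoeff (𝕩 ^ q) = 0 := by simp [hq0]
  have hv' : MvPowerSeries.constantCoeff (𝕩 ^ p * (𝕪 + MvPowerSeries.C c)) = 0 := by simp [hp0]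
  let S := substPair (𝕩 ^ q) (𝕩 ^ p * (𝕪 + MvPowerSeries.C c)) hu hv'
  let g : 𝕣 := ∑ i ∈ Finset.range (n' + 1), inX (b i) * (𝕪 + MvPowerSeries.C c) ^ i +
    (𝕪 + MvPowerSeries.C c) ^ (n' + 1) * S h
  have hSinX : ∀ a : 𝕆, S (inX a) = inX (substOne (𝕥 ^ q) hXq a) := by
    intro a
    rw [inX_substOne, substPair_inX, map_pow, inX_X]
  have hSf : S (T f) = 𝕩 ^ (p * (n' + 1)) * g := by
    have hSy : S 𝕪 = 𝕩 ^ p * (𝕪 + MvPowerSeries.C c) := substPair_X1 _ _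
    rw [e, map_add, map_sum, map_mul, map_pow, hSy]
    simp only [g]
    rw [mul_add (𝕩 ^ _) (Finset.sum _ _), Finset.mul_sum]
    congr 1
    · refine Finset.sum_congr rfl fun i hi => ?_
      have hi := Finset.mem_range.mp hi
      rw [map_mul, map_pow, hSinX, hb i hi, hSy, map_mul, map_pow, inX_X]
      have : p * (n' + 1) = p * (n' + 1 - i) + p * i := by
        rw [← mul_add, Nat.sub_add_cancel hi.le]
      rw [this, pow_add, mul_pow, ← pow_mul]
      ring
    · rw [mul_pow, ← pow_mul]
      ring
  have hresS : resX (S h) = PowerSeries.C (MvPowerSeries.constantCoeff h) := by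
    rw [resX, FormalArc.ev_substPair, FormalArc.ev_map_zero]
    · change FormalArc.ev _ (𝕩 ^ q) = 0
      rw [map_pow, FormalArc.ev_X0, zero_pow hq0]
    · change FormalArc.ev _ (𝕩 ^ p * (𝕪 + MvPowerSeries.C c)) = 0
      rw [map_mul, map_pow, FormalArc.ev_X0, zero_pow hp0, zero_mul]
  have hresg : resX g = ((P.comp (Polynomial.X + Polynomial.C c) : Polynomial ℂ) : 𝕆) := by
    have hcoe : ∀ Q : Polynomial ℂ, (Q : 𝕆) = Polynomial.coeToPowerSeries.ringHom Q := fun _ => rfl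
    simp only [g, P, map_add, map_sum, map_mul, map_pow, resX_inX, resX_X1, resX_C, hresS, hcoe,
      Polynomial.add_comp, Polynomial.mul_comp, Polynomial.sum_comp, Polynomial.C_comp,
      Polynomial.X_pow_comp]
    simp only [Polynomial.coeToPowerSeries.ringHom_apply, Polynomial.coe_C, Polynomial.coe_X]
    ring
  have hPne : P ≠ 0 := by
    intro h0
    rw [h0] at hPd
    simp at hPd
  have hordg : (resX g).order = P.rootMultiplicity c := by
    rw [hresg, Polynomial.rootMultiplicity_eq_natTrailingDegree, order_coe_polynomial]
    rw [Ne, Polynomial.comp_X_add_C_eq_zero_iff]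
    exact hPne
  obtain ⟨γ, hγ0, hγ⟩ := ih _ hcn hc0 g hordg
  refine ⟨γ.map _ _ hu hv', ?_, ?_⟩
  · change γ.ev (𝕩 ^ q) ≠ 0
    rw [map_pow, γ.ev_X0]
    exact pow_ne_zero _ hγ0
  · rw [← FormalArc.ev_substPair]
    change γ.ev (S (T f)) = 0
    rw [hSf, map_mul, hγ, mul_zero]

/-- Every irreducible curve has a primitive parametrization. -/
theorem exists_parametrizes {f : 𝕣} (hf : Irreducible f) : ∃ γ : FormalArc, γ.Parametrizes f := by
  by_cases h0 : resX f = 0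
  · have : FormalArc.NonConst ⟨0, 𝕥, by simp, by simp⟩ := Or.inr PowerSeries.X_ne_zero
    exact this.exists_parametrizes hf h0
  · have h1 : (resX f).order.toNat ≠ 0 := by
      intro h1
      have h2 : (resX f).order = 0 := by rw [← PowerSeries.coe_toNat_order h0, h1]; rfl
      rw [order_eq_zero_iff_isUnit, isUnit_iff_constantCoeff_ne_zero, constantCoeff_resX,
        ← series_isUnit_iff] at h2
      exact hf.not_isUnit h2
    obtain ⟨γ, hγ, h⟩ := exists_arc_of_order_resX _ h1 f (PowerSeries.coe_toNat_order h0).symm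
    exact FormalArc.NonConst.exists_parametrizes (Or.inl hγ) hf h

/-! ### Curves and their parametrizations -/

theorem FormalArc.parametrizes_iff {γ : FormalArc} {f : 𝕣} :
    γ.Parametrizes f ↔ IsPuiseuxParam f γ.toPair := by
  constructor
  · intro h
    refine ⟨?_, fun g => by rw [← FormalArc.ev_apply]; exact h.ker g, ?_⟩
    · intro i
      fin_cases i
      · exact γ.x_zero
      · exact γ.y_zero
    · obtain ⟨N, hN⟩ := h.primitive
      exact ⟨N, fun k hk => by simpa only [FormalArc.ev_apply] using hN k hk⟩
  · intro h
    refine ⟨fun g => by rw [FormalArc.ev_apply]; exact h.ker g, ?_⟩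
    obtain ⟨N, hN⟩ := h.primitive
    exact ⟨N, fun k hk => by simpa only [FormalArc.ev_apply] using hN k hk⟩

theorem exists_parametrizes_puiseuxParam {f : 𝕣} (hf : Irreducible f) :
    ∃ γ : FormalArc, γ.Parametrizes f ∧ γ.toPair = puiseuxParam f := by
  obtain ⟨γ, hγ⟩ := exists_parametrizes hf
  have h : IsPuiseuxParam f (puiseuxParam f) :=
    Classical.epsilon_spec (p := IsPuiseuxParam f) ⟨_, FormalArc.parametrizes_iff.mp hγ⟩
  have e : FormalArc.toPair ⟨puiseuxParam f 0, puiseuxParam f 1, h.center 0, h.center 1⟩ =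
      puiseuxParam f := by
    funext i
    fin_cases i <;> rfl
  exact ⟨_, FormalArc.parametrizes_iff.mpr (by rw [e]; exact h), e⟩

/-- The order of a series in one variable, with the value `0` at the zero series. -/
noncomputable def ordN (a : 𝕆) : ℕ := a.order.toNat

theorem coe_ordN {a : 𝕆} (h : a ≠ 0) : (ordN a : ℕ∞) = a.order := PowerSeries.coe_toNat_order h

theorem ordN_eq_iff {a : 𝕆} (h : a ≠ 0) {n : ℕ} : ordN a = n ↔ a.order = n := by
  rw [← coe_ordN h]; norm_cast

theorem ordN_mul {a b : 𝕆} (ha : a ≠ 0) (hb : b ≠ 0) : ordN (a * b) = ordN a + ordN b := by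
  rw [ordN_eq_iff (mul_ne_zero ha hb), PowerSeries.order_mul, ← coe_ordN ha, ← coe_ordN hb]
  norm_cast

theorem ordN_eq_zero_iff {a : 𝕆} (ha : a ≠ 0) : ordN a = 0 ↔ IsUnit a := by
  rw [← order_eq_zero_iff_isUnit, ← coe_ordN ha]; norm_cast

theorem ordN_of_isUnit {a : 𝕆} (ha : IsUnit a) : ordN a = 0 := (ordN_eq_zero_iff ha.ne_zero).mpr ha

theorem ordN_pow {a : 𝕆} (ha : a ≠ 0) (n : ℕ) : ordN (a ^ n) = n * ordN a := by
  induction n with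
  | zero => simp [ordN]
  | succ n ih => rw [pow_succ, ordN_mul (pow_ne_zero _ ha) ha, ih]; ring

theorem ordN_X : ordN 𝕥 = 1 := by simp [ordN]

/-- The parametrization used by `ordAlong`. -/
noncomputable def branchArc (f : 𝕣) : FormalArc :=
  open Classical in if hf : Irreducible f then (exists_parametrizes_puiseuxParam hf).choose
  else ⟨0, 0, map_zero _, map_zero _⟩

theorem branchArc_parametrizes {f : 𝕣} (hf : Irreducible f) : (branchArc f).Parametrizes f := by
  rw [branchArc, dif_pos hf]
  exact (exists_parametrizes_puiseuxParam hf).choose_spec.1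

theorem ordAlong_eq {f : 𝕣} (hf : Irreducible f) (g : 𝕣) :
    ordAlong f g = ordN ((branchArc f).ev g) := by
  rw [ordAlong, ordN, FormalArc.ev_apply, branchArc, dif_pos hf,
    (exists_parametrizes_puiseuxParam hf).choose_spec.2]

/-- Every non-constant arc on an irreducible curve factors through a primitive parametrization:
the normalization of the local ring of the curve maps to every discrete valuation ring to which
the local ring maps injectively. -/
theorem FormalArc.Parametrizes.exists_reparam {γ γ' : FormalArc} {f : 𝕣} (h : γ.Parametrizes f)
    (hγ' : γ'.NonConst) (h' : γ'.ev f = 0) : ∃ θ hθ, γ' = γ.reparam θ hθ := by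
  obtain ⟨N, hN⟩ := h.primitive
  -- `G u` is an element of the ring with value `t ^ N u`; the map `ψ` below, `u ↦ Φ u / Φ 1`, is the
  -- extension to `ℂ[[t]]` of the homomorphism from the ring of the curve given by `γ'`
  choose G hG using fun u : 𝕆 => hN (𝕥 ^ N * u) (dvd_mul_right _ _)
  have hker := hγ'.ev_eq_zero_iff h.irreducible h'
  have key : ∀ p q, γ.ev p = γ.ev q → γ'.ev p = γ'.ev q := by
    intro p q hpq
    rw [← sub_eq_zero, ← map_sub, hker, ← h.ker, map_sub, hpq, sub_self]
  let Φ : 𝕆 → 𝕆 := fun u => γ'.ev (G u)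
  have hmul : ∀ u v, Φ u * Φ v = Φ 1 * Φ (u * v) := by
    intro u v
    simp only [Φ, ← map_mul]
    apply key
    simp only [map_mul, hG]
    ring
  have h1 : Φ 1 ≠ 0 := by
    intro h0
    have := (h.ker _).mpr ((hker _).mp h0)
    rw [hG, mul_one] at this
    exact pow_ne_zero _ PowerSeries.X_ne_zero this
  have hpow : ∀ u k, Φ u ^ (k + 1) = Φ 1 ^ k * Φ (u ^ (k + 1)) := by
    intro u k
    induction k with
    | zero => simp
    | succ k ih =>
      rw [pow_succ, ih, mul_assoc, hmul, pow_succ u (k + 1)]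
      ring
  -- `Φ u / Φ 1` is integral: all its powers have the denominator `Φ 1`
  have hdvd : ∀ u, Φ 1 ∣ Φ u := by
    intro u
    by_cases hu : Φ u = 0
    · rw [hu]; exact dvd_zero _
    apply dvd_of_order_le
    have h2 : Φ (u ^ (ordN (Φ 1) + 1)) ≠ 0 := by
      intro h0
      have := hpow u (ordN (Φ 1))
      rw [h0, mul_zero] at this
      exact pow_ne_zero _ hu this
    have h3 := congrArg ordN (hpow u (ordN (Φ 1)))
    rw [ordN_pow hu, ordN_mul (pow_ne_zero _ h1) h2, ordN_pow h1] at h3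
    rw [← coe_ordN h1, ← coe_ordN hu]
    norm_cast
    by_contra hc
    push Not at hc
    nlinarith
  choose ψ hψ using hdvd
  have hψmul : ∀ u v, ψ (u * v) = ψ u * ψ v := by
    intro u v
    have := hmul u v
    rw [hψ u, hψ v, hψ (u * v)] at this
    refine (mul_left_cancel₀ (mul_ne_zero h1 h1) ?_).symm
    linear_combination this
  have hψadd : ∀ u v, ψ (u + v) = ψ u + ψ v := by
    intro u v
    have : Φ (u + v) = Φ u + Φ v := by
      simp only [Φ, ← map_add]
      apply key
      simp only [map_add, hG]
      ring
    rw [hψ u, hψ v, hψ (u + v)] at this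
    refine mul_left_cancel₀ h1 ?_
    linear_combination this
  have hψev : ∀ g, ψ (γ.ev g) = γ'.ev g := by
    intro g
    have : Φ (γ.ev g) = Φ 1 * γ'.ev g := by
      simp only [Φ, ← map_mul]
      apply key
      simp only [map_mul, hG]
      ring
    rw [hψ] at this
    exact mul_left_cancel₀ h1 this
  have hψC : ∀ c, ψ (PowerSeries.C c) = PowerSeries.C c := by
    intro c
    have := hψev (MvPowerSeries.C c)
    simpa using this
  -- a ring homomorphism cannot send the non-unit `t` to a series with non-zero constant term `c`,
  -- as `t - c` is a unit
  have hθ : PowerSeries.constantCoeff (ψ 𝕥) = 0 := by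
    by_contra hc
    have h2 : IsUnit (𝕥 - PowerSeries.C (PowerSeries.constantCoeff (ψ 𝕥))) := by
      rw [isUnit_iff_constantCoeff_ne_zero]
      simpa using hc
    obtain ⟨w, hw⟩ := h2.exists_right_inv
    have h3 := congrArg ψ hw
    rw [hψmul, ← map_one PowerSeries.C, hψC, map_one, sub_eq_add_neg, ← map_neg, hψadd, hψC] at h3
    have h4 := congrArg PowerSeries.constantCoeff h3
    simp at h4
  refine ⟨ψ 𝕥, hθ, ?_⟩
  have hsub : ∀ u, substOne (ψ 𝕥) hθ u = ψ u := by
    intro u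
    rw [← sub_eq_zero]
    apply eq_zero_of_forall_X_pow_dvd
    intro M
    induction M generalizing u with
    | zero => simp
    | succ M ih =>
      obtain ⟨b, hb⟩ := exists_eq_C_add_X_mul u
      have : substOne (ψ 𝕥) hθ u - ψ u = ψ 𝕥 * (substOne (ψ 𝕥) hθ b - ψ b) := by
        rw [hb, map_add, map_mul, substOne_C, substOne_X, hψadd, hψmul, hψC]
        ring
      rw [this, pow_succ']
      exact mul_dvd_mul (constantCoeff_eq_zero_iff_X_dvd.mp hθ) (ih b)
  apply FormalArc.ext
  · change γ'.x = substOne _ _ γ.x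
    rw [hsub, ← γ.ev_X0, ← γ'.ev_X0, hψev]
  · change γ'.y = substOne _ _ γ.y
    rw [hsub, ← γ.ev_X1, ← γ'.ev_X1, hψev]

/-! ### Intersection numbers -/

section
variable {M U V W : Type*} [AddCommGroup M] [AddCommGroup U] [AddCommGroup V] [AddCommGroup W]
  [Module ℂ M] [Module ℂ U] [Module ℂ V] [Module ℂ W]

/-- Dimensions in a short exact sequence `0 → U → V → W → 0`, where `U` is given as a quotient
of `M` and the map `U → V` by its composition with `M → U`. -/
theorem finrank_of_exact (φ : M →ₗ[ℂ] V) (κ : M →ₗ[ℂ] U) (π : V →ₗ[ℂ] W)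
    (hκ : Function.Surjective κ) (hπ : Function.Surjective π) (hk : ∀ m, φ m = 0 ↔ κ m = 0)
    (he : ∀ v, π v = 0 ↔ ∃ m, φ m = v) :
    (Module.Finite ℂ V ↔ Module.Finite ℂ U ∧ Module.Finite ℂ W) ∧
    (Module.Finite ℂ V → Module.finrank ℂ V = Module.finrank ℂ U + Module.finrank ℂ W) := by
  have hker : LinearMap.ker κ = LinearMap.ker φ := by
    ext m; exact (hk m).symm
  let eU : U ≃ₗ[ℂ] LinearMap.range φ :=
    (κ.quotKerEquivOfSurjective hκ).symm ≪≫ₗ Submodule.quotEquivOfEq _ _ hker ≪≫ₗ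
      φ.quotKerEquivRange
  have hr : LinearMap.ker π = LinearMap.range φ := by
    ext v; exact he v
  let eW : (V ⧸ LinearMap.range φ) ≃ₗ[ℂ] W :=
    Submodule.quotEquivOfEq _ _ hr.symm ≪≫ₗ π.quotKerEquivOfSurjective hπ
  refine ⟨⟨fun h => ⟨Module.Finite.equiv eU.symm, Module.Finite.of_surjective π hπ⟩, ?_⟩, ?_⟩
  · rintro ⟨hU, hW⟩
    have : Module.Finite ℂ (LinearMap.range φ) := Module.Finite.equiv eU
    have : Module.Finite ℂ (V ⧸ LinearMap.range φ) := Module.Finite.equiv eW.symm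
    exact Module.Finite.of_submodule_quotient (LinearMap.range φ)
  · intro h
    rw [eU.finrank_eq, ← eW.finrank_eq, add_comm]
    exact (Submodule.finrank_quotient_add_finrank _).symm

end

/-- The order of `h` is the dimension of `ℂ[[t]] / (h)`. -/
theorem finrank_quotient_range_mul {h : 𝕆} (h0 : h ≠ 0) :
    Module.finrank ℂ (𝕆 ⧸ LinearMap.range (LinearMap.mulLeft ℂ h)) = ordN h := by
  let φ : 𝕆 →ₗ[ℂ] (Fin (ordN h) → ℂ) := LinearMap.pi fun i => PowerSeries.coeff (R := ℂ) (i : ℕ)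
  have hφ : Function.Surjective φ := by
    intro c
    refine ⟨PowerSeries.mk fun n => if hn : n < ordN h then c ⟨n, hn⟩ else 0, ?_⟩
    funext i
    simp [φ]
  have hk : LinearMap.range (LinearMap.mulLeft ℂ h) = LinearMap.ker φ := by
    ext u
    have h1 : u ∈ LinearMap.range (LinearMap.mulLeft ℂ h) ↔ h ∣ u := by
      constructor
      · rintro ⟨v, rfl⟩; exact dvd_mul_right _ _
      · rintro ⟨v, rfl⟩; exact ⟨v, rfl⟩
    rw [h1, LinearMap.mem_ker]
    constructor
    · rintro ⟨v, rfl⟩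
      funext i
      refine PowerSeries.coeff_of_lt_order (φ := h * v) (i : ℕ) ?_
      rw [PowerSeries.order_mul, ← coe_ordN h0]
      exact lt_of_lt_of_le (by exact_mod_cast i.2) le_self_add
    · intro hu
      apply dvd_of_order_le
      rw [← coe_ordN h0]
      apply PowerSeries.nat_le_order
      intro i hi
      exact congrFun hu ⟨i, hi⟩
  rw [(Submodule.quotEquivOfEq _ _ hk).finrank_eq,
    (φ.quotKerEquivOfSurjective hφ).finrank_eq, Module.finrank_fin_fun]

theorem mem_span_pair_iff {f g u : 𝕣} : u ∈ Ideal.span ({f, g} : Set 𝕣) ↔ ∃ a b, u = a * f + b * g := by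
  rw [Ideal.mem_span_pair]
  simp only [eq_comm]

/-- The intersection number with a branch is the order along its parametrization. -/
theorem intersection_branch {γ : FormalArc} {f h : 𝕣} (hγ : γ.Parametrizes f) (hh : ¬ f ∣ h) :
    Module.Finite ℂ (𝕣 ⧸ Ideal.span ({f, h} : Set 𝕣)) ∧
      Module.finrank ℂ (𝕣 ⧸ Ideal.span ({f, h} : Set 𝕣)) = ordN (γ.ev h) := by
  set η := γ.ev h with hη
  have hη0 : η ≠ 0 := fun h0 => hh ((hγ.ker h).mp h0)
  let A : Submodule ℂ 𝕆 := LinearMap.range γ.ev.toLinearMap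
  let hA : Submodule ℂ 𝕆 := A.map (LinearMap.mulLeft ℂ η)
  have hle : hA ≤ A := by
    rintro _ ⟨_, ⟨g, rfl⟩, rfl⟩
    exact ⟨h * g, by simp [hη]⟩
  have hle' : hA ≤ LinearMap.range (LinearMap.mulLeft ℂ η) := by
    rintro _ ⟨u, _, rfl⟩
    exact ⟨u, rfl⟩
  obtain ⟨N, hN⟩ := hγ.primitive
  have hmem : ∀ u, η * u ∈ hA ↔ u ∈ A := by
    intro u
    constructor
    · rintro ⟨v, hv, e⟩
      have : v = u := mul_left_cancel₀ hη0 e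
      exact this ▸ hv
    · intro hu
      exact ⟨u, hu, rfl⟩
  -- `h A` contains the multiples of `h t ^ N`
  have hfin : Module.Finite ℂ (𝕆 ⧸ hA) := by
    let φ : 𝕆 →ₗ[ℂ] (Fin (ordN η + N) → ℂ) := LinearMap.pi fun i => PowerSeries.coeff (R := ℂ) (i : ℕ)
    have hk : LinearMap.ker φ ≤ hA := by
      intro u hu
      have h1 : η * 𝕥 ^ N ∣ u := by
        apply dvd_of_order_le
        rw [PowerSeries.order_mul, PowerSeries.order_X_pow, ← coe_ordN hη0, ← Nat.cast_add]
        apply PowerSeries.nat_le_order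
        intro i hi
        exact congrFun hu ⟨i, hi⟩
      obtain ⟨v, rfl⟩ := h1
      rw [mul_assoc, hmem]
      exact hN _ (dvd_mul_right _ _)
    have : Module.Finite ℂ (𝕆 ⧸ LinearMap.ker φ) := Module.Finite.equiv φ.quotKerEquivRange.symm
    exact Module.Finite.of_surjective _ (Submodule.factor_surjective hk)
  -- `dim A / hA + dim 𝕆 / A = dim 𝕆 / hA`
  have e1 := finrank_of_exact (hA.mkQ ∘ₗ γ.ev.toLinearMap)
    (Ideal.Quotient.mkₐ ℂ (Ideal.span ({f, h} : Set 𝕣))).toLinearMap (Submodule.factor hle)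
    Ideal.Quotient.mk_surjective (Submodule.factor_surjective hle) (by
      intro g
      change (Submodule.Quotient.mk (γ.ev g) : 𝕆 ⧸ hA) = 0 ↔ Ideal.Quotient.mk _ g = 0
      rw [Submodule.Quotient.mk_eq_zero, Ideal.Quotient.eq_zero_iff_mem, mem_span_pair_iff]
      constructor
      · rintro ⟨_, ⟨k, rfl⟩, e⟩
        have : f ∣ g - h * k := by
          rw [← hγ.ker, map_sub, map_mul, sub_eq_zero]
          exact e.symm
        obtain ⟨l, hl⟩ := this
        exact ⟨l, k, by linear_combination hl⟩
      · rintro ⟨a, b, rfl⟩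
        rw [map_add, map_mul, map_mul, (hγ.ker f).mpr dvd_rfl, mul_zero, zero_add, mul_comm, hmem]
        exact ⟨b, rfl⟩) (by
      intro v
      obtain ⟨v, rfl⟩ := Submodule.Quotient.mk_surjective _ v
      change (Submodule.Quotient.mk v : 𝕆 ⧸ A) = 0 ↔ _
      rw [Submodule.Quotient.mk_eq_zero]
      constructor
      · rintro ⟨g, rfl⟩; exact ⟨g, rfl⟩
      · rintro ⟨g, e⟩
        have h1 : γ.ev g - v ∈ hA := (Submodule.Quotient.eq _).mp e
        have h2 := A.sub_mem (⟨g, rfl⟩ : γ.ev g ∈ A) (hle h1)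
        simpa using h2)
  -- `dim 𝕆 / A + dim 𝕆 / h𝕆 = dim 𝕆 / hA`
  have e2 := finrank_of_exact (hA.mkQ ∘ₗ LinearMap.mulLeft ℂ η) A.mkQ (Submodule.factor hle')
    (Submodule.mkQ_surjective _) (Submodule.factor_surjective hle') (by
      intro u
      change (Submodule.Quotient.mk (η * u) : 𝕆 ⧸ hA) = 0 ↔ (Submodule.Quotient.mk u : 𝕆 ⧸ A) = 0
      rw [Submodule.Quotient.mk_eq_zero, Submodule.Quotient.mk_eq_zero, hmem]) (by
      intro v
      obtain ⟨v, rfl⟩ := Submodule.Quotient.mk_surjective _ v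
      change (Submodule.Quotient.mk v : 𝕆 ⧸ LinearMap.range _) = 0 ↔ _
      rw [Submodule.Quotient.mk_eq_zero]
      constructor
      · rintro ⟨g, rfl⟩; exact ⟨g, rfl⟩
      · rintro ⟨g, e⟩
        have h1 : η * g - v ∈ hA := (Submodule.Quotient.eq _).mp e
        have h2 := Submodule.sub_mem _ (⟨g, rfl⟩ : η * g ∈ LinearMap.range (LinearMap.mulLeft ℂ η))
          (hle' h1)
        simpa using h2)
  refine ⟨(e1.1.mp hfin).1, ?_⟩
  have e3 := e1.2 hfin
  have e4 := e2.2 hfin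
  rw [finrank_quotient_range_mul hη0] at e4
  change _ = Module.finrank ℂ (𝕆 ⧸ A) + _ at e4
  change _ = _ + Module.finrank ℂ (𝕆 ⧸ A) at e3
  omega

/-- Additivity of the intersection number: the multiplication by `f₂` gives an exact sequence from
`R / (f₁, g)` to `R / (f₁ f₂, g)` to `R / (f₂, g)`. -/
theorem intersection_mul {f₁ f₂ g : 𝕣} (h0 : f₂ ≠ 0) (h : IsRelPrime f₂ g)
    (h₁ : Module.Finite ℂ (𝕣 ⧸ Ideal.span ({f₁, g} : Set 𝕣)))
    (h₂ : Module.Finite ℂ (𝕣 ⧸ Ideal.span ({f₂, g} : Set 𝕣))) :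
    Module.Finite ℂ (𝕣 ⧸ Ideal.span ({f₁ * f₂, g} : Set 𝕣)) ∧
      Module.finrank ℂ (𝕣 ⧸ Ideal.span ({f₁ * f₂, g} : Set 𝕣)) =
        Module.finrank ℂ (𝕣 ⧸ Ideal.span ({f₁, g} : Set 𝕣)) +
        Module.finrank ℂ (𝕣 ⧸ Ideal.span ({f₂, g} : Set 𝕣)) := by
  have hle : Ideal.span ({f₁ * f₂, g} : Set 𝕣) ≤ Ideal.span ({f₂, g} : Set 𝕣) := by
    intro u hu
    rw [mem_span_pair_iff] at hu ⊢
    obtain ⟨a, b, rfl⟩ := hu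
    exact ⟨a * f₁, b, by ring⟩
  have e := finrank_of_exact
    ((Ideal.Quotient.mkₐ ℂ (Ideal.span ({f₁ * f₂, g} : Set 𝕣))).toLinearMap ∘ₗ
      LinearMap.mulLeft ℂ f₂)
    (Ideal.Quotient.mkₐ ℂ (Ideal.span ({f₁, g} : Set 𝕣))).toLinearMap
    (Ideal.Quotient.factorₐ ℂ hle).toLinearMap
    Ideal.Quotient.mk_surjective (Ideal.Quotient.factor_surjective hle) (by
      intro u
      change Ideal.Quotient.mk _ (f₂ * u) = 0 ↔ Ideal.Quotient.mk _ u = 0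
      rw [Ideal.Quotient.eq_zero_iff_mem, Ideal.Quotient.eq_zero_iff_mem, mem_span_pair_iff,
        mem_span_pair_iff]
      constructor
      · rintro ⟨a, b, hab⟩
        have h1 : f₂ ∣ b * g := ⟨u - a * f₁, by linear_combination -hab⟩
        obtain ⟨c, rfl⟩ := h.dvd_of_dvd_mul_right h1
        exact ⟨a, c, mul_left_cancel₀ h0 (by linear_combination hab)⟩
      · rintro ⟨a, b, rfl⟩
        exact ⟨a, f₂ * b, by ring⟩) (by
      intro v
      obtain ⟨v, rfl⟩ := Ideal.Quotient.mk_surjective v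
      change Ideal.Quotient.mk _ v = 0 ↔ ∃ m, Ideal.Quotient.mk _ (f₂ * m) = _
      rw [Ideal.Quotient.eq_zero_iff_mem, mem_span_pair_iff]
      constructor
      · rintro ⟨a, b, rfl⟩
        refine ⟨a, ?_⟩
        rw [Ideal.Quotient.eq, mem_span_pair_iff]
        exact ⟨0, -b, by ring⟩
      · rintro ⟨m, hm⟩
        rw [Ideal.Quotient.eq, mem_span_pair_iff] at hm
        obtain ⟨a, b, hab⟩ := hm
        exact ⟨m - a * f₁, -b, by linear_combination -hab⟩)
  have hf := e.1.mpr ⟨h₁, h₂⟩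
  exact ⟨hf, e.2 hf⟩

/-! ### Polar intersection numbers and indices along one branch -/

/-- The order of a pair of series along an arc: the smaller of the two orders. -/
noncomputable def FormalArc.minOrd (γ : FormalArc) (P Q : 𝕣) : ℕ :=
  (min (γ.ev P).order (γ.ev Q).order).toNat

theorem FormalArc.coe_minOrd {γ : FormalArc} {P Q : 𝕣} (h : γ.ev P ≠ 0 ∨ γ.ev Q ≠ 0) :
    (γ.minOrd P Q : ℕ∞) = min (γ.ev P).order (γ.ev Q).order := by
  apply ENat.natCast_toNat
  rcases h with h | h
  · exact ne_top_of_le_ne_top (by rwa [Ne, PowerSeries.order_eq_top]) (min_le_left _ _)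
  · exact ne_top_of_le_ne_top (by rwa [Ne, PowerSeries.order_eq_top]) (min_le_right _ _)

/-- Two proportional pairs of series along an arc. -/
theorem FormalArc.minOrd_add_eq {γ : FormalArc} {A B C D : 𝕣} {g k : 𝕆} (hg : g ≠ 0)
    (hAB : γ.ev A ≠ 0 ∨ γ.ev B ≠ 0)
    (h1 : g * γ.ev A = k * γ.ev C) (h2 : g * γ.ev B = k * γ.ev D) :
    γ.minOrd A B + ordN g = γ.minOrd C D + ordN k ∧ k ≠ 0 := by
  have hk : k ≠ 0 := by
    intro h0
    rw [h0, zero_mul] at h1 h2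
    rcases hAB with h | h
    · exact (mul_ne_zero hg h) h1
    · exact (mul_ne_zero hg h) h2
  have hCD : γ.ev C ≠ 0 ∨ γ.ev D ≠ 0 := by
    by_contra hc
    push Not at hc
    rw [hc.1, mul_zero] at h1
    rw [hc.2, mul_zero] at h2
    rcases hAB with h | h
    · exact (mul_ne_zero hg h) h1
    · exact (mul_ne_zero hg h) h2
  refine ⟨?_, hk⟩
  have h3 := congrArg PowerSeries.order h1
  have h4 := congrArg PowerSeries.order h2
  rw [PowerSeries.order_mul, PowerSeries.order_mul] at h3 h4
  have : ((γ.minOrd A B + ordN g : ℕ) : ℕ∞) = (γ.minOrd C D + ordN k : ℕ) := by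
    push_cast
    rw [γ.coe_minOrd hAB, γ.coe_minOrd hCD, coe_ordN hg, coe_ordN hk, ← min_add_add_right,
      ← min_add_add_right, add_comm _ g.order, h3, add_comm _ g.order, h4,
      add_comm k.order, add_comm k.order]
  exact_mod_cast this

section
open LinearAlgebra.Projectivization

instance : Infinite (ℙ ℂ (Fin 2 → ℂ)) := by
  have h0 : ∀ c : ℂ, (![1, c] : Fin 2 → ℂ) ≠ 0 := fun c h => by
    have := congrFun h 0
    simp at this
  refine Infinite.of_injective (fun c : ℂ => Projectivization.mk ℂ ![1, c] (h0 c)) ?_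
  intro c d h
  obtain ⟨a, ha⟩ := (Projectivization.mk_eq_mk_iff' ℂ _ _ _ _).mp h
  have h1 := congrFun ha 0
  have h2 := congrFun ha 1
  simp at h1 h2
  rw [← h2, h1, one_mul]

theorem polarIntersection_eq_of_finite {η : FormalMeroForm} {f : 𝕣} {n : ℤ}
    (h : {v | polarOrd η f v ≠ n}.Finite) : polarIntersection η f = n := by
  have h1 : {v | polarOrd η f v ≠ polarIntersection η f}.Finite :=
    Classical.epsilon_spec (p := fun n : ℤ => {v | polarOrd η f v ≠ n}.Finite) ⟨n, h⟩
  by_contra hc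
  refine Set.infinite_univ ((h.union h1).subset fun v _ => ?_)
  by_contra hv
  simp only [Set.mem_union, Set.mem_ofPred_eq, not_or, not_not] at hv
  exact hc (hv.2.symm.trans hv.1)

/-- For all but at most one point `(v 0 : v 1)` of the projective line, the order of
`v 0 * A + v 1 * B` is the smaller one of the orders of `A` and `B`. -/
theorem finite_ordN_ne {A B : 𝕆} (h : A ≠ 0 ∨ B ≠ 0) :
    {v : ℙ ℂ (Fin 2 → ℂ) | ordN (v.rep 0 • A + v.rep 1 • B) ≠
      (min A.order B.order).toNat}.Finite := by
  set n := (min A.order B.order).toNat with hn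
  have hn' : (n : ℕ∞) = min A.order B.order := by
    apply ENat.natCast_toNat
    rcases h with h | h
    · exact ne_top_of_le_ne_top (by rwa [Ne, PowerSeries.order_eq_top]) (min_le_left _ _)
    · exact ne_top_of_le_ne_top (by rwa [Ne, PowerSeries.order_eq_top]) (min_le_right _ _)
  have hA : ∀ i < n, PowerSeries.coeff i A = 0 := fun i hi =>
    PowerSeries.coeff_of_lt_order i (lt_of_lt_of_le (by exact_mod_cast hi)
      (hn'.le.trans (min_le_left _ _)))
  have hB : ∀ i < n, PowerSeries.coeff i B = 0 := fun i hi =>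
    PowerSeries.coeff_of_lt_order i (lt_of_lt_of_le (by exact_mod_cast hi)
      (hn'.le.trans (min_le_right _ _)))
  set α := PowerSeries.coeff n A
  set β := PowerSeries.coeff n B
  have hαβ : α ≠ 0 ∨ β ≠ 0 := by
    rcases min_choice A.order B.order with hm | hm
    · left
      rw [hm] at hn'
      exact (PowerSeries.order_eq_nat.mp hn'.symm).1
    · right
      rw [hm] at hn'
      exact (PowerSeries.order_eq_nat.mp hn'.symm).1
  -- the exceptional points are solutions of one non-trivial linear equation
  have hne : ∀ v : ℙ ℂ (Fin 2 → ℂ), ordN (v.rep 0 • A + v.rep 1 • B) ≠ n →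
      v.rep 0 * α + v.rep 1 * β = 0 := by
    intro v hv
    by_contra hc
    apply hv
    have h1 : (v.rep 0 • A + v.rep 1 • B).order = n := by
      rw [PowerSeries.order_eq_nat]
      constructor
      · simpa using hc
      · intro i hi
        simp [hA i hi, hB i hi]
    rw [ordN, h1, ENat.toNat_natCast]
  apply Set.Subsingleton.finite
  intro v hv w hw
  have h1 := hne v hv
  have h2 := hne w hw
  have hdet : v.rep 0 * w.rep 1 = v.rep 1 * w.rep 0 := by
    rcases hαβ with h | h
    · refine mul_left_cancel₀ h ?_
      linear_combination w.rep 1 * h1 - v.rep 1 * h2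
    · refine mul_left_cancel₀ h ?_
      linear_combination v.rep 0 * h2 - w.rep 0 * h1
  rw [← v.mk_rep, ← w.mk_rep, Projectivization.mk_eq_mk_iff']
  by_cases h0 : w.rep 0 = 0
  · have h3 : w.rep 1 ≠ 0 := by
      intro h3
      apply w.rep_nonzero
      funext i
      fin_cases i
      · exact h0
      · exact h3
    refine ⟨v.rep 1 / w.rep 1, ?_⟩
    funext i
    fin_cases i
    · change v.rep 1 / w.rep 1 * w.rep 0 = v.rep 0
      field_simp
      linear_combination -hdet
    · change v.rep 1 / w.rep 1 * w.rep 1 = v.rep 1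
      field_simp
  · refine ⟨v.rep 0 / w.rep 0, ?_⟩
    funext i
    fin_cases i
    · change v.rep 0 / w.rep 0 * w.rep 0 = v.rep 0
      field_simp
    · change v.rep 0 / w.rep 0 * w.rep 1 = v.rep 1
      field_simp
      linear_combination hdet

theorem polarIntersection_eq {η : FormalMeroForm} {f : 𝕣} (hf : Irreducible f)
    (h : ¬ f ∣ η.P ∨ ¬ f ∣ η.Q) :
    polarIntersection η f =
      (branchArc f).minOrd η.P η.Q - ordN ((branchArc f).ev η.H) := by
  have hγ := branchArc_parametrizes hf
  rw [← hγ.ker, ← hγ.ker] at h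
  apply polarIntersection_eq_of_finite
  refine (finite_ordN_ne h).subset fun v hv => ?_
  simp only [Set.mem_ofPred_eq, polarOrd, ordAlong_eq hf] at hv ⊢
  intro hc
  apply hv
  rw [map_add, map_smul, map_smul, hc]
  rfl

end

/-- The order of one of the two derivatives is smaller than that of `f`. -/
theorem not_dvd_dx_or_not_dvd_dy {f : 𝕣} (hf : Irreducible f) : ¬ f ∣ f.dx ∨ ¬ f ∣ f.dy := by
  by_contra hc
  push Not at hc
  have key : ∀ i : Fin 2, f ∣ MvPowerSeries.pderiv ℂ i f := by
    intro i
    fin_cases i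
    · exact hc.1
    · exact hc.2
  obtain ⟨m, hm, hdeg⟩ := MvPowerSeries.exists_coeff_ne_zero_and_order (f := f) (by
    exact ENat.natCast_toNat (MvPowerSeries.order_eq_top_iff.not.mpr hf.ne_zero))
  have hm0 : m ≠ 0 := by
    rintro rfl
    exact hf.not_isUnit (series_isUnit_iff.mpr hm)
  obtain ⟨i, hi⟩ : ∃ i, m i ≠ 0 := by
    by_contra h
    push Not at h
    exact hm0 (Finsupp.ext h)
  have hmi : m - Finsupp.single i 1 + Finsupp.single i 1 = m :=
    tsub_add_cancel_of_le (Finsupp.single_le_iff.mpr (Nat.pos_of_ne_zero hi))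
  have h1 : MvPowerSeries.coeff (m - Finsupp.single i 1) (MvPowerSeries.pderiv ℂ i f) ≠ 0 := by
    rw [MvPowerSeries.coeff_pderiv, hmi]
    refine mul_ne_zero hm ?_
    exact Nat.cast_add_one_ne_zero _
  obtain ⟨c, hcf⟩ := key i
  have h2 : f.order ≤ (MvPowerSeries.pderiv ℂ i f).order := by
    rw [hcf, MvPowerSeries.order_mul]; exact le_self_add
  have h3 := h2.trans (MvPowerSeries.order_le h1)
  rw [← hdeg, Nat.cast_le] at h3
  have h4 := congrArg Finsupp.degree hmi
  rw [map_add, Finsupp.degree_single] at h4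
  omega

theorem FormalOneForm.not_dvd_or {ω : FormalOneForm} (hω : IsRelPrime ω.a ω.b) {f : 𝕣}
    (hf : Irreducible f) : ¬ f ∣ ω.a ∨ ¬ f ∣ ω.b := by
  by_contra hc
  push Not at hc
  exact hf.not_isUnit (hω hc.1 hc.2)

theorem polarIntersection_toMero {ω : FormalOneForm} (hω : IsRelPrime ω.a ω.b) {f : 𝕣}
    (hf : Irreducible f) : polarIntersection ω.toMero f = (branchArc f).minOrd ω.a ω.b := by
  rw [polarIntersection_eq hf (FormalOneForm.not_dvd_or hω hf)]
  have : ordN ((branchArc f).ev ω.toMero.H) = 0 := by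
    change ordN ((branchArc f).ev 1) = 0
    rw [map_one]
    exact ordN_of_isUnit isUnit_one
  rw [this]
  simp [FormalOneForm.toMero]

/-- Along a simple zero `f` of `F = f u / w`, the polar intersection number of `dF` is that of
`df`, shifted by the order of `u / w`. -/
theorem polarIntersection_differential {F : FormalMeroFunction} {f u : 𝕣} (hf : Irreducible f)
    (hu : F.num = f * u) (hfu : ¬ f ∣ u) (hden : ¬ f ∣ F.den) :
    polarIntersection F.differential f = (branchArc f).minOrd f.dx f.dy +
      ordN ((branchArc f).ev u) - ordN ((branchArc f).ev F.den) := by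
  have hγ := branchArc_parametrizes hf
  have hf0 : (branchArc f).ev f = 0 := (hγ.ker f).mpr dvd_rfl
  have hu0 : (branchArc f).ev u ≠ 0 := fun h => hfu ((hγ.ker u).mp h)
  have hd0 : (branchArc f).ev F.den ≠ 0 := fun h => hden ((hγ.ker _).mp h)
  have hP : (branchArc f).ev F.differential.P =
      (branchArc f).ev (F.den * u) * (branchArc f).ev f.dx := by
    simp only [FormalMeroFunction.differential, hu, FormalSeries.dx_mul, map_sub, map_mul, map_add,
      hf0]
    ring
  have hQ : (branchArc f).ev F.differential.Q =
      (branchArc f).ev (F.den * u) * (branchArc f).ev f.dy := by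
    simp only [FormalMeroFunction.differential, hu, FormalSeries.dy_mul, map_sub, map_mul, map_add,
      hf0]
    ring
  have h0 : (branchArc f).ev (F.den * u) ≠ 0 := by rw [map_mul]; exact mul_ne_zero hd0 hu0
  have hnz : ¬ f ∣ F.differential.P ∨ ¬ f ∣ F.differential.Q := by
    rw [← hγ.ker, ← hγ.ker, hP, hQ]
    rcases not_dvd_dx_or_not_dvd_dy hf with h | h
    · exact Or.inl (mul_ne_zero h0 fun h1 => h ((hγ.ker _).mp h1))
    · exact Or.inr (mul_ne_zero h0 fun h1 => h ((hγ.ker _).mp h1))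
  rw [polarIntersection_eq hf hnz]
  rw [← hγ.ker, ← hγ.ker] at hnz
  have h1 := ((branchArc f).minOrd_add_eq (g := 1) (C := f.dx) (D := f.dy)
    (k := (branchArc f).ev (F.den * u)) one_ne_zero hnz (by rw [one_mul, hP])
    (by rw [one_mul, hQ])).1
  have h2 : ordN (1 : 𝕆) = 0 := ordN_of_isUnit isUnit_one
  have h3 : ordN ((branchArc f).ev F.differential.H) = 2 * ordN ((branchArc f).ev F.den) := by
    change ordN ((branchArc f).ev (F.den ^ 2)) = _
    rw [map_pow, ordN_pow hd0]
  have h4 : ordN ((branchArc f).ev (F.den * u)) =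
      ordN ((branchArc f).ev F.den) + ordN ((branchArc f).ev u) := by
    rw [map_mul, ordN_mul hd0 hu0]
  rw [h3]
  rw [h2, h4] at h1
  push_cast
  omega

/-- From `g ω = k df` along the branch. -/
theorem gsvBranch_eq {ω : FormalOneForm} (hω : IsRelPrime ω.a ω.b) {f : 𝕣}
    (hf : ω.IsSeparatrix f) :
    gsvBranch ω f = (branchArc f).minOrd ω.a ω.b - (branchArc f).minOrd f.dx f.dy := by
  obtain ⟨hirr, hinv⟩ := hf
  have hγ := branchArc_parametrizes hirr
  have hf0 : (branchArc f).ev f = 0 := (hγ.ker f).mpr dvd_rfl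
  have hω0 := FormalOneForm.not_dvd_or hω hirr
  rw [← hγ.ker, ← hγ.ker] at hω0
  have hex : ∃ n : ℤ, ∃ (g k : 𝕣) (η : FormalOneForm), IsRelPrime g f ∧
      g * ω.a = k * f.dx + f * η.a ∧ g * ω.b = k * f.dy + f * η.b ∧
      n = ordAlong f k - ordAlong f g := by
    obtain ⟨h, hh⟩ := hinv
    rcases not_dvd_dx_or_not_dvd_dy hirr with hx | hy
    · refine ⟨_, f.dx, ω.a, ⟨0, -h⟩, (hirr.isRelPrime_iff_not_dvd.mpr hx).symm, ?_, ?_, rfl⟩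
      · change _ = _ + f * 0; ring
      · change _ = _ + f * -h; linear_combination -hh
    · refine ⟨_, f.dy, ω.b, ⟨h, 0⟩, (hirr.isRelPrime_iff_not_dvd.mpr hy).symm, ?_, ?_, rfl⟩
      · change _ = _ + f * h; linear_combination hh
      · change _ = _ + f * 0; ring
  obtain ⟨g, k, η, hrel, h1, h2, h3⟩ := Classical.epsilon_spec hex
  change gsvBranch ω f = _ at h3
  rw [h3, ordAlong_eq hirr, ordAlong_eq hirr]
  have hg : (branchArc f).ev g ≠ 0 := fun h =>
    (hirr.isRelPrime_iff_not_dvd.mp hrel.symm) ((hγ.ker _).mp h)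
  have h4 := ((branchArc f).minOrd_add_eq (A := ω.a) (B := ω.b) (C := f.dx) (D := f.dy)
    (k := (branchArc f).ev k) hg hω0
    (by rw [← map_mul, h1, map_add, map_mul, map_mul _ f, hf0, zero_mul, add_zero])
    (by rw [← map_mul, h2, map_add, map_mul, map_mul _ f, hf0, zero_mul, add_zero])).1
  omega

theorem intersectionNumber_comm (f g : 𝕣) : intersectionNumber f g = intersectionNumber g f := by
  rw [intersectionNumber, intersectionNumber, Set.pair_comm]

theorem not_dvd_list_prod {f : 𝕣} (hf : Irreducible f) {C : List 𝕣}
    (h : ∀ f' ∈ C, ¬ f ∣ f') : ¬ f ∣ C.prod := by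
  intro hd
  obtain ⟨f', h1, h2⟩ := (hf.prime.dvd_prod_iff).mp hd
  exact h f' h1 h2

theorem list_prod_finite_and_finrank (C : List 𝕣) (h : 𝕣) (hirr : ∀ f ∈ C, Irreducible f)
    (hndvd : ∀ f ∈ C, ¬ f ∣ h) :
    Module.Finite ℂ (𝕣 ⧸ Ideal.span ({C.prod, h} : Set 𝕣)) ∧
      intersectionNumber C.prod h = (C.map fun f => (ordN ((branchArc f).ev h) : ℤ)).sum := by
  induction C with
  | nil =>
    have : Subsingleton (𝕣 ⧸ Ideal.span ({([] : List 𝕣).prod, h} : Set 𝕣)) := by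
      rw [Ideal.Quotient.subsingleton_iff, List.prod_nil]
      exact (Ideal.eq_top_iff_one _).mpr (Ideal.subset_span (by simp))
    exact ⟨inferInstance, by
      rw [intersectionNumber, Module.finrank_zero_of_subsingleton]; simp⟩
  | cons f C ih =>
    have hf := hirr f (by simp)
    obtain ⟨h1, h2⟩ := ih (fun f' hf' => hirr f' (by simp [hf']))
      (fun f' hf' => hndvd f' (by simp [hf']))
    obtain ⟨h3, h4⟩ := intersection_branch (branchArc_parametrizes hf) (hndvd f (by simp))
    obtain ⟨h5, h6⟩ := intersection_mul hf.ne_zero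
      (hf.isRelPrime_iff_not_dvd.mpr (hndvd f (by simp))) h1 h3
    rw [List.prod_cons, mul_comm f]
    refine ⟨h5, ?_⟩
    rw [List.map_cons, List.sum_cons, ← h2, intersectionNumber, h6, h4, intersectionNumber]
    push_cast
    ring

theorem intersectionNumber_list_prod {C : List 𝕣} {h : 𝕣} (hirr : ∀ f ∈ C, Irreducible f)
    (hndvd : ∀ f ∈ C, ¬ f ∣ h) :
    intersectionNumber C.prod h = (C.map fun f => (ordN ((branchArc f).ev h) : ℤ)).sum :=
  (list_prod_finite_and_finrank C h hirr hndvd).2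

theorem intersectionNumber_irreducible {f h : 𝕣} (hf : Irreducible f) (hh : ¬ f ∣ h) :
    intersectionNumber f h = ordN ((branchArc f).ev h) := by
  have := intersectionNumber_list_prod (C := [f]) (h := h) (by simpa) (by simpa)
  simpa using this

/-- The order along `f` of the cofactor of `f` in a multiple of `f`. -/
noncomputable def cofactorOrd (f N : 𝕣) : ℤ :=
  open Classical in ordN ((branchArc f).ev (if h : f ∣ N then h.choose else 0))

theorem cofactorOrd_mul {f : 𝕣} (hf : f ≠ 0) (u : 𝕣) :
    cofactorOrd f (f * u) = ordN ((branchArc f).ev u) := by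
  have h : f ∣ f * u := dvd_mul_right _ _
  rw [cofactorOrd, dif_pos h, ← mul_left_cancel₀ hf h.choose_spec]

/-- Each pair of branches contributes twice its intersection number to the sum of the orders of
the cofactors: by induction on `C`, where a branch moves from `C` to the factor `g`. -/
theorem sum_cofactorOrd (C : List 𝕣) (g : 𝕣) (hirr : ∀ f ∈ C, Irreducible f)
    (hdist : C.Pairwise fun f f' => ¬ Associated f f') (hg : ∀ f ∈ C, ¬ f ∣ g)
    (ω : FormalOneForm) :
    (C.map fun f => cofactorOrd f (C.prod * g)).sum =
      (C.map fun f => gsvBranch ω f).sum - gsvIndex ω C + intersectionNumber C.prod g := by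
  induction C generalizing g with
  | nil =>
    rw [intersectionNumber_list_prod (by simp) (by simp)]
    simp [gsvIndex]
  | cons f C ih =>
    rw [List.pairwise_cons] at hdist
    have hf := hirr f (by simp)
    have hC : ∀ f' ∈ C, Irreducible f' := fun f' hf' => hirr f' (by simp [hf'])
    have hfC : ∀ f' ∈ C, ¬ f' ∣ f := fun f' hf' h =>
      hdist.1 f' hf' (((hC f' hf').associated_of_dvd hf h).symm)
    have hfC' : ∀ f' ∈ C, ¬ f ∣ f' := fun f' hf' h =>
      hdist.1 f' hf' (hf.associated_of_dvd (hC f' hf') h)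
    have hgC : ∀ f' ∈ C, ¬ f' ∣ g := fun f' hf' => hg f' (by simp [hf'])
    have hfg : ∀ f' ∈ C, ¬ f' ∣ f * g := fun f' hf' h =>
      ((hC f' hf').prime.dvd_or_dvd h).elim (hfC f' hf') (hgC f' hf')
    have hγ := branchArc_parametrizes hf
    have hfp := not_dvd_list_prod hf hfC'
    have e1 := ih (f * g) hC hdist.2 hfg
    have e2 : (f :: C).prod * g = C.prod * (f * g) := by rw [List.prod_cons]; ring
    have e3 : cofactorOrd f (C.prod * (f * g)) =
        ordN ((branchArc f).ev C.prod) + ordN ((branchArc f).ev g) := by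
      have : C.prod * (f * g) = f * (C.prod * g) := by ring
      rw [this, cofactorOrd_mul hf.ne_zero, map_mul, ordN_mul]
      · push_cast; rfl
      · exact fun h => hfp ((hγ.ker _).mp h)
      · exact fun h => hg f (by simp) ((hγ.ker _).mp h)
    have e4 : intersectionNumber C.prod (f * g) =
        intersectionNumber C.prod f + intersectionNumber C.prod g := by
      rw [intersectionNumber_list_prod hC hfg, intersectionNumber_list_prod hC hfC,
        intersectionNumber_list_prod hC hgC, ← List.sum_map_add]
      congr 1
      refine List.map_congr_left fun f' hf' => ?_
      have hγ' := branchArc_parametrizes (hC f' hf')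
      rw [map_mul, ordN_mul]
      · push_cast; rfl
      · exact fun h => hfC f' hf' ((hγ'.ker _).mp h)
      · exact fun h => hgC f' hf' ((hγ'.ker _).mp h)
    have e5 : intersectionNumber (f :: C).prod g =
        ordN ((branchArc f).ev g) + intersectionNumber C.prod g := by
      rw [intersectionNumber_list_prod hirr hg, intersectionNumber_list_prod hC hgC]
      simp
    rw [intersectionNumber_comm C.prod f, intersectionNumber_irreducible hf hfp] at e4
    rw [e2, List.map_cons, List.sum_cons, e3, e1, e4, e5, List.map_cons, List.sum_cons, gsvIndex,
      intersectionNumber_irreducible hf hfp]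
    ring

theorem ordAt_of_simple {F : FormalMeroFunction} {f u : 𝕣} (hf : Irreducible f)
    (hu : F.num = f * u) (hfu : ¬ f ∣ u) : ¬ f ∣ F.den ∧ F.ordAt f = 1 := by
  have h1 : ¬ f ∣ F.den := fun h => hf.not_isUnit (F.coprime (hu ▸ dvd_mul_right f u) h)
  refine ⟨h1, ?_⟩
  have h2 : multiplicity f F.num = 1 := by
    apply multiplicity_eq_of_dvd_of_not_dvd
    · rw [hu, pow_one]; exact dvd_mul_right _ _
    · rw [hu, pow_succ, pow_one, mul_dvd_mul_iff_left hf.ne_zero]; exact hfu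
  rw [FormalMeroFunction.ordAt, h2, multiplicity_eq_zero.mpr h1]
  rfl

theorem exists_cofactor {F : FormalMeroFunction} {C : List 𝕣} {g : 𝕣}
    (hirr : ∀ f ∈ C, Irreducible f) (hdist : C.Pairwise fun f f' => ¬ Associated f f')
    (hnum : F.num = C.prod * g) (hsimple : ∀ f ∈ C, ¬ f ∣ g) {f : 𝕣} (hf : f ∈ C) :
    ∃ u, F.num = f * u ∧ ¬ f ∣ u := by
  obtain ⟨C₁, C₂, rfl⟩ := List.append_of_mem hf
  refine ⟨C₁.prod * C₂.prod * g, ?_, ?_⟩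
  · rw [hnum, List.prod_append, List.prod_cons]; ring
  · have h := hirr f hf
    rw [List.pairwise_append, List.pairwise_cons] at hdist
    intro hd
    rcases h.prime.dvd_or_dvd hd with hd | hd
    · rcases h.prime.dvd_or_dvd hd with hd | hd
      · refine not_dvd_list_prod h (fun f' hf' hd' => ?_) hd
        exact hdist.2.2 f' hf' f (by simp)
          ((h.associated_of_dvd (hirr f' (by simp [hf'])) hd').symm)
      · refine not_dvd_list_prod h (fun f' hf' hd' => ?_) hd
        exact hdist.2.1.1 f' hf' (h.associated_of_dvd (hirr f' (by simp [hf'])) hd')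
    · exact hsimple f hf hd

/-- The formula for the `GSV`-index, which holds for every `F` with simple zeros along the
separatrices of `C`. -/
theorem gsvIndex_eq {ω : FormalOneForm} (hω : IsRelPrime ω.a ω.b) {F : FormalMeroFunction}
    {C : List 𝕣} (hirr : ∀ f ∈ C, Irreducible f)
    (hdist : C.Pairwise fun f f' => ¬ Associated f f')
    {g : 𝕣} (hnum : F.num = C.prod * g) (hsimple : ∀ f ∈ C, ¬ f ∣ g)
    (hsep : ∀ f ∈ C, ω.IsSeparatrix f) :
    gsvIndex ω C =
      polarExcess ω F C + intersectionNumber C.prod g - intersectionNumber C.prod F.den := by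
  have hden : ∀ f ∈ C, ¬ f ∣ F.den := fun f hf => by
    obtain ⟨u, hu, hfu⟩ := exists_cofactor hirr hdist hnum hsimple hf
    exact (ordAt_of_simple (hirr f hf) hu hfu).1
  have e1 : polarExcess ω F C = (C.map fun f => gsvBranch ω f).sum -
      (C.map fun f => cofactorOrd f (C.prod * g)).sum +
      (C.map fun f => (ordN ((branchArc f).ev F.den) : ℤ)).sum := by
    have hsub : ∀ p q : 𝕣 → ℤ, (C.map p).sum - (C.map q).sum = (C.map fun f => p f - q f).sum := by
      intro p q
      rw [sub_eq_iff_eq_add, ← List.sum_map_add]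
      simp
    rw [polarExcess, hsub, ← List.sum_map_add]
    congr 1
    refine List.map_congr_left fun f hf => ?_
    obtain ⟨u, hu, hfu⟩ := exists_cofactor hirr hdist hnum hsimple hf
    rw [polarIntersection_toMero hω (hirr f hf),
      polarIntersection_differential (hirr f hf) hu hfu (hden f hf),
      gsvBranch_eq hω (hsep f hf), ← hnum, hu, cofactorOrd_mul (hirr f hf).ne_zero]
    ring
  rw [e1, sum_cofactorOrd C g hirr hdist hsimple ω, intersectionNumber_list_prod hirr hden]
  ring

/-! ### Blow-ups of curves -/

theorem constantCoeff_blowUpChart (d : BlowUpDirection) (i : Fin 2) :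
    MvPowerSeries.constantCoeff (blowUpChart d i) = 0 := by
  cases d <;> fin_cases i <;> simp [blowUpChart]

/-- The total transform, as a homomorphism of algebras. -/
noncomputable def blow (d : BlowUpDirection) : 𝕣 →ₐ[ℂ] 𝕣 :=
  substPair (blowUpChart d 0) (blowUpChart d 1) (constantCoeff_blowUpChart d 0)
    (constantCoeff_blowUpChart d 1)

theorem totalTransform_eq (d : BlowUpDirection) (f : 𝕣) : totalTransform d f = blow d f := by
  rw [totalTransform, blow, substPair_apply]
  congr 1
  funext i
  fin_cases i <;> rfl

@[simp] theorem blow_slope_X0 (c : ℂ) : blow (.slope c) 𝕩 = 𝕩 := substPair_X0 _ _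

@[simp] theorem blow_slope_X1 (c : ℂ) : blow (.slope c) 𝕪 = 𝕩 * (𝕪 + MvPowerSeries.C c) :=
  substPair_X1 _ _

@[simp] theorem blow_vertical_X0 : blow .vertical 𝕩 = 𝕩 * 𝕪 := substPair_X0 _ _

@[simp] theorem blow_vertical_X1 : blow .vertical 𝕪 = 𝕩 := substPair_X1 _ _

/-- The image of an arc under the blow-up map. -/
noncomputable def FormalArc.blowDown (γ : FormalArc) (d : BlowUpDirection) : FormalArc :=
  γ.map (blowUpChart d 0) (blowUpChart d 1) (constantCoeff_blowUpChart d 0)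
    (constantCoeff_blowUpChart d 1)

theorem FormalArc.ev_blow (γ : FormalArc) (d : BlowUpDirection) (f : 𝕣) :
    γ.ev (blow d f) = (γ.blowDown d).ev f := γ.ev_substPair _ _ f

theorem FormalArc.blowDown_slope_x (γ : FormalArc) (c : ℂ) : (γ.blowDown (.slope c)).x = γ.x := by
  rw [← ev_X0, ← ev_blow, blow_slope_X0, ev_X0]

theorem FormalArc.blowDown_slope_y (γ : FormalArc) (c : ℂ) :
    (γ.blowDown (.slope c)).y = γ.x * (γ.y + PowerSeries.C c) := by
  rw [← ev_X1, ← ev_blow, blow_slope_X1]; simp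

theorem FormalArc.blowDown_vertical_x (γ : FormalArc) : (γ.blowDown .vertical).x = γ.x * γ.y := by
  rw [← ev_X0, ← ev_blow, blow_vertical_X0]; simp

theorem FormalArc.blowDown_vertical_y (γ : FormalArc) : (γ.blowDown .vertical).y = γ.x := by
  rw [← ev_X1, ← ev_blow, blow_vertical_X1]; simp

theorem FormalArc.nonConst_blowDown {γ : FormalArc} (h : γ.x ≠ 0) (d : BlowUpDirection) :
    (γ.blowDown d).NonConst := by
  cases d with
  | slope c => exact Or.inl (by rwa [blowDown_slope_x])
  | vertical => exact Or.inr (by rwa [blowDown_vertical_y])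

theorem FormalArc.reparam_x (γ : FormalArc) (θ : 𝕆) (hθ) :
    (γ.reparam θ hθ).x = substOne θ hθ γ.x := rfl

theorem FormalArc.reparam_y (γ : FormalArc) (θ : 𝕆) (hθ) :
    (γ.reparam θ hθ).y = substOne θ hθ γ.y := rfl

theorem FormalArc.ext_ev {γ δ : FormalArc} (h : ∀ f, γ.ev f = δ.ev f) : γ = δ := by
  apply FormalArc.ext
  · rw [← ev_X0, h, ev_X0]
  · rw [← ev_X1, h, ev_X1]

theorem FormalArc.blowDown_reparam (γ : FormalArc) (d : BlowUpDirection) (θ : 𝕆) (hθ) :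
    (γ.reparam θ hθ).blowDown d = (γ.blowDown d).reparam θ hθ := by
  apply FormalArc.ext_ev
  intro f
  rw [← ev_blow, ev_reparam, ev_reparam, ev_blow]

/-- Every non-constant arc lifts to the blow-up. -/
theorem FormalArc.NonConst.exists_lift {γ : FormalArc} (h : γ.NonConst) :
    ∃ d, ∃ γ' : FormalArc, γ'.x ≠ 0 ∧ γ = γ'.blowDown d := by
  by_cases hxy : γ.x ≠ 0 ∧ γ.x ∣ γ.y
  · obtain ⟨hx, w, hw⟩ := hxy
    refine ⟨.slope (PowerSeries.constantCoeff w),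
      ⟨γ.x, w - PowerSeries.C (PowerSeries.constantCoeff w), γ.x_zero, by simp⟩, hx, ?_⟩
    apply FormalArc.ext
    · rw [blowDown_slope_x]
    · rw [blowDown_slope_y, sub_add_cancel, hw]
  · have hy : γ.y ≠ 0 := by
      intro hy
      rcases h with h | h
      · exact hxy ⟨h, hy ▸ dvd_zero _⟩
      · exact h hy
    have hlt : γ.y.order < γ.x.order := by
      by_contra hc
      push Not at hc
      apply hxy
      refine ⟨?_, dvd_of_order_le hc⟩
      intro h0
      rw [h0, PowerSeries.order_zero, top_le_iff, PowerSeries.order_eq_top] at hc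
      exact hy hc
    obtain ⟨w, hw⟩ := dvd_of_order_le hlt.le
    have hw0 : PowerSeries.constantCoeff w = 0 := by
      rw [← PowerSeries.order_ne_zero_iff_constCoeff_eq_zero]
      intro h0
      rw [hw, PowerSeries.order_mul, h0, add_zero] at hlt
      exact lt_irrefl _ hlt
    refine ⟨.vertical, ⟨γ.y, w, γ.y_zero, hw0⟩, hy, ?_⟩
    apply FormalArc.ext
    · rw [blowDown_vertical_x, hw]
    · rw [blowDown_vertical_y]

/-- The blow-up map is injective on arcs that are not contained in the exceptional line. -/
theorem FormalArc.blowDown_injective {γ δ : FormalArc} {d e : BlowUpDirection} (hγ : γ.x ≠ 0)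
    (hδ : δ.x ≠ 0) (h : γ.blowDown d = δ.blowDown e) : d = e ∧ γ = δ := by
  have mixed : ∀ {γ δ : FormalArc} {c : ℂ}, γ.x ≠ 0 → δ.x ≠ 0 →
      γ.blowDown (.slope c) ≠ δ.blowDown .vertical := by
    intro γ δ c hγ hδ h
    have hx := congrArg FormalArc.x h
    have hy := congrArg FormalArc.y h
    rw [blowDown_slope_x, blowDown_vertical_x] at hx
    rw [blowDown_slope_y, blowDown_vertical_y, hx, mul_assoc] at hy
    have h1 : δ.y * (γ.y + PowerSeries.C c) = 1 := mul_left_cancel₀ hδ (by rw [hy, mul_one])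
    have h2 := congrArg PowerSeries.constantCoeff h1
    rw [map_mul, δ.y_zero, zero_mul, map_one] at h2
    exact zero_ne_one h2
  cases d with
  | slope c =>
    cases e with
    | slope c' =>
      have hx := congrArg FormalArc.x h
      have hy := congrArg FormalArc.y h
      rw [blowDown_slope_x, blowDown_slope_x] at hx
      rw [blowDown_slope_y, blowDown_slope_y, ← hx] at hy
      have h1 := mul_left_cancel₀ hγ hy
      have h2 := congrArg PowerSeries.constantCoeff h1
      simp only [map_add, γ.y_zero, δ.y_zero, zero_add, PowerSeries.constantCoeff_C] at h2
      subst h2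
      exact ⟨rfl, FormalArc.ext hx (add_right_cancel h1)⟩
    | vertical => exact absurd h (mixed hγ hδ)
  | vertical =>
    cases e with
    | slope c' => exact absurd h.symm (mixed hδ hγ)
    | vertical =>
      have hx := congrArg FormalArc.x h
      have hy := congrArg FormalArc.y h
      rw [blowDown_vertical_x, blowDown_vertical_x] at hx
      rw [blowDown_vertical_y, blowDown_vertical_y] at hy
      rw [hy] at hx
      exact ⟨rfl, FormalArc.ext hy (mul_left_cancel₀ hδ hx)⟩

/-! ### Multiplicities and leading forms -/

/-- A polynomial of degree at most `n`, seen as a form of degree `n` in two variables, near the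
given direction. -/
noncomputable def dirPoly (n : ℕ) (P : Polynomial ℂ) : BlowUpDirection → Polynomial ℂ
  | .slope c => P.comp (Polynomial.X + Polynomial.C c)
  | .vertical => P.reflect n

theorem dirPoly_ne_zero {n : ℕ} {P : Polynomial ℂ} (hP : P ≠ 0) (d : BlowUpDirection) :
    dirPoly n P d ≠ 0 := by
  cases d with
  | slope c => rwa [dirPoly, Ne, Polynomial.comp_X_add_C_eq_zero_iff]
  | vertical => rwa [dirPoly, Ne, Polynomial.reflect_eq_zero_iff]

theorem dirPoly_zero (n : ℕ) (d : BlowUpDirection) : dirPoly n 0 d = 0 := by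
  cases d <;> simp [dirPoly]

theorem ordN_dirPoly_slope {n : ℕ} {P : Polynomial ℂ} (hP : P ≠ 0) (c : ℂ) :
    ordN (dirPoly n P (.slope c) : 𝕆) = P.rootMultiplicity c := by
  rw [ordN, order_coe_polynomial (dirPoly_ne_zero hP _), ENat.toNat_natCast,
    Polynomial.rootMultiplicity_eq_natTrailingDegree]
  rfl

theorem ordN_dirPoly_vertical {n : ℕ} {P : Polynomial ℂ} (hP : P ≠ 0) (hn : P.natDegree ≤ n) :
    ordN (dirPoly n P .vertical : 𝕆) + P.natDegree = n := by
  have : (dirPoly n P .vertical : 𝕆).order = (n - P.natDegree : ℕ) := by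
    rw [PowerSeries.order_eq_nat]
    constructor
    · rw [Polynomial.coeff_coe, dirPoly, Polynomial.coeff_reflect,
        Polynomial.revAt_le (Nat.sub_le _ _), Nat.sub_sub_self hn]
      exact Polynomial.leadingCoeff_ne_zero.mpr hP
    · intro i hi
      rw [Polynomial.coeff_coe, dirPoly, Polynomial.coeff_reflect,
        Polynomial.revAt_le (by omega)]
      exact Polynomial.coeff_eq_zero_of_natDegree_lt (by omega)
  rw [ordN, this, ENat.toNat_natCast]
  omega

/-- A form of degree `n` has `n` zeros on the exceptional line. -/
theorem finsum_ordN_dirPoly {n : ℕ} {P : Polynomial ℂ} (hP : P ≠ 0) (hn : P.natDegree ≤ n) :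
    (Function.support fun d => (ordN (dirPoly n P d : 𝕆) : ℤ)).Finite ∧
      ∑ᶠ d, (ordN (dirPoly n P d : 𝕆) : ℤ) = n := by
  classical
  have hinj : Function.Injective BlowUpDirection.slope := fun a b h => by injection h
  let S : Finset BlowUpDirection := insert .vertical (P.roots.toFinset.map ⟨_, hinj⟩)
  have hS : (Function.support fun d => (ordN (dirPoly n P d : 𝕆) : ℤ)) ⊆ S := by
    intro d hd
    cases d with
    | slope c =>
      rw [Function.mem_support, ordN_dirPoly_slope hP, Nat.cast_ne_zero,
        ← Nat.pos_iff_ne_zero, Polynomial.rootMultiplicity_pos hP] at hd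
      simpa [S, hP] using hd
    | vertical => simp [S]
  refine ⟨S.finite_toSet.subset hS, ?_⟩
  rw [finsum_eq_sum_of_support_subset _ hS, Finset.sum_insert (by simp), Finset.sum_map]
  have h1 : ∑ c ∈ P.roots.toFinset, (ordN (dirPoly n P (.slope c) : 𝕆) : ℤ) = P.natDegree := by
    rw [← (IsAlgClosed.splits P).natDegree_eq_card_roots.symm, ← Multiset.toFinset_sum_count_eq]
    push_cast
    exact Finset.sum_congr rfl fun c _ => by
      rw [ordN_dirPoly_slope hP, Polynomial.count_roots]
  have h2 := ordN_dirPoly_vertical hP hn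
  change (ordN (dirPoly n P .vertical : 𝕆) : ℤ) +
    ∑ c ∈ P.roots.toFinset, (ordN (dirPoly n P (.slope c) : 𝕆) : ℤ) = n
  rw [h1]
  exact_mod_cast h2

theorem resX_blow (d : BlowUpDirection) (f : 𝕣) :
    resX (blow d f) = PowerSeries.C (MvPowerSeries.constantCoeff f) := by
  rw [resX, FormalArc.ev_blow, FormalArc.ev_map_zero]
  · cases d with
    | slope c => rw [FormalArc.blowDown_slope_x]
    | vertical => rw [FormalArc.blowDown_vertical_x, zero_mul]
  · cases d with
    | slope c => rw [FormalArc.blowDown_slope_y, zero_mul]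
    | vertical => rw [FormalArc.blowDown_vertical_y]

theorem reflect_sum {ι : Type*} (s : Finset ι) (N : ℕ) (P : ι → Polynomial ℂ) :
    (∑ i ∈ s, P i).reflect N = ∑ i ∈ s, (P i).reflect N := by
  ext k
  simp [Polynomial.coeff_reflect, Polynomial.finsetSum_coeff]

/-- The total transforms of a series of order at least `n` in terms of its homogeneous part `P`
of degree `n`. -/
theorem exists_leadPoly {n : ℕ} {f : 𝕣} (hn : (n : ℕ∞) ≤ MvPowerSeries.order f) :
    ∃ P : Polynomial ℂ, P.natDegree ≤ n ∧
      (P = 0 → ((n + 1 : ℕ) : ℕ∞) ≤ MvPowerSeries.order f) ∧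
      ∀ d, ∃ h, blow d f = 𝕩 ^ n * h ∧ resX h = (dirPoly n P d : 𝕆) := by
  obtain ⟨g, hg⟩ := exists_eq_sum_of_le_order n f hn
  let c : ℕ → ℂ := fun j => MvPowerSeries.constantCoeff (g j)
  let P : Polynomial ℂ := ∑ j ∈ Finset.range (n + 1), Polynomial.C (c j) * Polynomial.X ^ j
  have hcoe : ∀ Q : Polynomial ℂ, (Q : 𝕆) = Polynomial.coeToPowerSeries.ringHom Q := fun _ => rfl
  refine ⟨P, ?_, ?_, ?_⟩
  · refine Polynomial.natDegree_sum_le_of_forall_le _ _ fun j hj => ?_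
    exact (Polynomial.natDegree_C_mul_X_pow_le _ _).trans
      (Nat.lt_succ_iff.mp (Finset.mem_range.mp hj))
  · intro hP
    have hc : ∀ j ∈ Finset.range (n + 1), c j = 0 := by
      intro j hj
      have h1 : P.coeff j = c j := by
        simp only [P, Polynomial.finsetSum_coeff, Polynomial.coeff_C_mul, Polynomial.coeff_X_pow]
        rw [Finset.sum_eq_single j]
        · simp
        · intro i _ hi; rw [if_neg hi.symm, mul_zero]
        · intro h; exact absurd hj h
      rw [← h1, hP, Polynomial.coeff_zero]
    rw [hg]
    refine Finset.sum_induction _ (fun f : 𝕣 => ((n + 1 : ℕ) : ℕ∞) ≤ MvPowerSeries.order f)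
      (fun a b ha hb => (le_min ha hb).trans MvPowerSeries.min_order_le_add) (by simp) ?_
    intro j hj
    have hj' := Nat.lt_succ_iff.mp (Finset.mem_range.mp hj)
    rw [MvPowerSeries.order_mul, MvPowerSeries.order_mul]
    have h3 : ((n - j : ℕ) : ℕ∞) ≤ MvPowerSeries.order (𝕩 ^ (n - j)) :=
      MvPowerSeries.le_order_pow_of_constantCoeff_eq_zero _ (by simp)
    have h4 : (j : ℕ∞) ≤ MvPowerSeries.order (𝕪 ^ j) :=
      MvPowerSeries.le_order_pow_of_constantCoeff_eq_zero _ (by simp)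
    have h2 : (1 : ℕ∞) ≤ MvPowerSeries.order (g j) := one_le_order_iff.mpr (hc j hj)
    calc ((n + 1 : ℕ) : ℕ∞) = ((n - j : ℕ) : ℕ∞) + (j : ℕ∞) + 1 := by
          rw [← Nat.cast_add, Nat.sub_add_cancel hj']; push_cast; rfl
      _ ≤ _ := by gcongr
  · intro d
    cases d with
    | slope e =>
      refine ⟨∑ j ∈ Finset.range (n + 1), (𝕪 + MvPowerSeries.C e) ^ j * blow (.slope e) (g j),
        ?_, ?_⟩
      · conv_lhs => rw [hg]
        rw [map_sum, Finset.mul_sum]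
        refine Finset.sum_congr rfl fun j hj => ?_
        have hj' := Nat.lt_succ_iff.mp (Finset.mem_range.mp hj)
        rw [map_mul, map_mul, map_pow, map_pow, blow_slope_X0, blow_slope_X1, mul_pow]
        conv_rhs => rw [← Nat.sub_add_cancel hj', pow_add]
        ring
      · simp only [dirPoly, P, Polynomial.sum_comp, map_sum, map_mul, map_pow, map_add, resX_X1,
          resX_C, resX_blow, hcoe, Polynomial.mul_comp, Polynomial.C_comp, Polynomial.X_pow_comp]
        simp only [Polynomial.coeToPowerSeries.ringHom_apply, Polynomial.coe_C, Polynomial.coe_X]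
        exact Finset.sum_congr rfl fun j _ => mul_comm _ _
    | vertical =>
      refine ⟨∑ j ∈ Finset.range (n + 1), 𝕪 ^ (n - j) * blow .vertical (g j), ?_, ?_⟩
      · conv_lhs => rw [hg]
        rw [map_sum, Finset.mul_sum]
        refine Finset.sum_congr rfl fun j hj => ?_
        have hj' := Nat.lt_succ_iff.mp (Finset.mem_range.mp hj)
        rw [map_mul, map_mul, map_pow, map_pow, blow_vertical_X0, blow_vertical_X1, mul_pow]
        conv_rhs => rw [← Nat.sub_add_cancel hj', pow_add]
        rw [Nat.sub_add_cancel hj']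
        ring
      · simp only [dirPoly, P, reflect_sum, map_sum, map_mul, map_pow, resX_X1,
          resX_blow, hcoe]
        refine Finset.sum_congr rfl fun j hj => ?_
        have hj' := Nat.lt_succ_iff.mp (Finset.mem_range.mp hj)
        rw [Polynomial.reflect_C_mul_X_pow, Polynomial.revAt_le hj', map_mul, map_pow]
        simp only [Polynomial.coeToPowerSeries.ringHom_apply, Polynomial.coe_C, Polynomial.coe_X]
        exact mul_comm _ _

/-! ### Strict transforms -/

theorem divX_X_pow_mul (m : ℕ) (g : 𝕣) : FormalSeries.divX m (𝕩 ^ m * g) = g := by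
  ext n
  change MvPowerSeries.coeff (n + Finsupp.single 0 m) (𝕩 ^ m * g) = _
  rw [MvPowerSeries.X_pow_eq, add_comm, MvPowerSeries.coeff_add_monomial_mul, one_mul]

theorem emultiplicity_X0_pow_mul {m : ℕ} {g : 𝕣} (hg : ¬ 𝕩 ∣ g) :
    emultiplicity 𝕩 (𝕩 ^ m * g) = m := by
  apply emultiplicity_eq_of_dvd_of_not_dvd
  · exact dvd_mul_right _ _
  · rw [pow_succ, mul_dvd_mul_iff_left (pow_ne_zero _ prime_X0.ne_zero)]
    exact hg

theorem strictTransform_eq {d : BlowUpDirection} {f h : 𝕣} {m : ℕ} (h1 : blow d f = 𝕩 ^ m * h)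
    (h2 : ¬ 𝕩 ∣ h) : strictTransform d f = h := by
  rw [strictTransform, totalTransform_eq, h1, emultiplicity_X0_pow_mul h2, ENat.toNat_natCast,
    divX_X_pow_mul]

/-- The multiplicity of a curve at the origin. -/
noncomputable def mult (f : 𝕣) : ℕ := (MvPowerSeries.order f).toNat

theorem coe_mult {f : 𝕣} (hf : f ≠ 0) : (mult f : ℕ∞) = MvPowerSeries.order f :=
  ENat.natCast_toNat (MvPowerSeries.order_eq_top_iff.not.mpr hf)

/-- The strict transforms of a curve have as many intersections with the exceptional line as its
multiplicity. -/
theorem exists_strictTransform {f : 𝕣} (hf : f ≠ 0) :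
    ∃ P : Polynomial ℂ, P ≠ 0 ∧ P.natDegree ≤ mult f ∧
      ∀ d, blow d f = 𝕩 ^ mult f * strictTransform d f ∧
        resX (strictTransform d f) = (dirPoly (mult f) P d : 𝕆) := by
  obtain ⟨P, h1, h2, h3⟩ := exists_leadPoly (coe_mult hf).le
  have hP : P ≠ 0 := by
    intro h0
    have := h2 h0
    rw [← coe_mult hf, Nat.cast_le] at this
    omega
  refine ⟨P, hP, h1, fun d => ?_⟩
  obtain ⟨h, h4, h5⟩ := h3 d
  have h6 : ¬ 𝕩 ∣ h := by
    rw [X0_dvd_iff, h5]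
    exact fun h0 => dirPoly_ne_zero hP d (Polynomial.coe_eq_zero_iff.mp h0)
  rw [strictTransform_eq h4 h6]
  exact ⟨h4, h5⟩

theorem blow_eq {f : 𝕣} (hf : f ≠ 0) (d : BlowUpDirection) :
    blow d f = 𝕩 ^ mult f * strictTransform d f := by
  obtain ⟨P, _, _, h⟩ := exists_strictTransform hf
  exact (h d).1

theorem not_X0_dvd_strictTransform {f : 𝕣} (hf : f ≠ 0) (d : BlowUpDirection) :
    ¬ 𝕩 ∣ strictTransform d f := by
  obtain ⟨P, hP, _, h⟩ := exists_strictTransform hf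
  rw [X0_dvd_iff, (h d).2]
  exact fun h0 => dirPoly_ne_zero hP d (Polynomial.coe_eq_zero_iff.mp h0)

theorem strictTransform_ne_zero {f : 𝕣} (hf : f ≠ 0) (d : BlowUpDirection) :
    strictTransform d f ≠ 0 := fun h =>
  not_X0_dvd_strictTransform hf d (h ▸ dvd_zero _)

/-- The intersection number of a curve with the axis `x = 0`. -/
noncomputable def ordX (f : 𝕣) : ℕ := ordN (resX f)

/-- The intersection number of a curve with the axis `y = 0`. -/
noncomputable def ordY (f : 𝕣) : ℕ := ordN (resY f)

theorem finsum_ordX_strictTransform {f : 𝕣} (hf : f ≠ 0) :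
    (Function.support fun d => (ordX (strictTransform d f) : ℤ)).Finite ∧
      ∑ᶠ d, (ordX (strictTransform d f) : ℤ) = mult f := by
  obtain ⟨P, hP, h1, h⟩ := exists_strictTransform hf
  have : (fun d => (ordX (strictTransform d f) : ℤ)) =
      fun d => (ordN (dirPoly (mult f) P d : 𝕆) : ℤ) := by
    funext d; rw [ordX, (h d).2]
  rw [this]
  exact finsum_ordN_dirPoly hP h1

theorem strictTransform_mul {f g : 𝕣} (hf : f ≠ 0) (hg : g ≠ 0) (d : BlowUpDirection) :
    strictTransform d (f * g) = strictTransform d f * strictTransform d g := by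
  refine strictTransform_eq (m := mult f + mult g) ?_ ?_
  · rw [map_mul, blow_eq hf, blow_eq hg]; ring
  · rw [prime_X0.dvd_mul, not_or]
    exact ⟨not_X0_dvd_strictTransform hf d, not_X0_dvd_strictTransform hg d⟩

theorem isUnit_strictTransform {f : 𝕣} (hf : IsUnit f) (d : BlowUpDirection) :
    IsUnit (strictTransform d f) := by
  have h : strictTransform d f = blow d f := by
    refine strictTransform_eq (m := 0) (by simp) fun h => ?_
    exact prime_X0.not_isUnit (isUnit_of_dvd_unit h (hf.map (blow d)))
  rw [h]
  exact hf.map (blow d)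

theorem strictTransform_associated {f g : 𝕣} (hf : f ≠ 0) (h : Associated f g)
    (d : BlowUpDirection) : Associated (strictTransform d f) (strictTransform d g) := by
  obtain ⟨u, rfl⟩ := h
  rw [strictTransform_mul hf u.ne_zero]
  exact (associated_mul_unit_right _ _ (isUnit_strictTransform u.isUnit d))

theorem FormalArc.ev_blowDown {f : 𝕣} (hf : f ≠ 0) (γ : FormalArc) (d : BlowUpDirection) :
    (γ.blowDown d).ev f = γ.x ^ mult f * γ.ev (strictTransform d f) := by
  rw [← ev_blow, blow_eq hf, map_mul, map_pow, ev_X0]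

theorem FormalArc.Parametrizes.x_ne_zero {γ : FormalArc} {g : 𝕣} (h : γ.Parametrizes g)
    (hg : ¬ Associated g 𝕩) : γ.x ≠ 0 := by
  intro h0
  rw [← γ.ev_X0, h.ker] at h0
  exact hg (h.irreducible.associated_of_dvd prime_X0.irreducible h0)

/-- The derivatives of a total transform along an arc: the blow-up map is a local isomorphism
outside the exceptional line. -/
theorem FormalArc.ev_dx_dy_blow {γ : FormalArc} (hx : γ.x ≠ 0) {d : BlowUpDirection} {f : 𝕣}
    (h1 : γ.ev (blow d f).dx = 0) (h2 : γ.ev (blow d f).dy = 0) :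
    (γ.blowDown d).ev f.dx = 0 ∧ (γ.blowDown d).ev f.dy = 0 := by
  have e1 := derivation_substPair (MvPowerSeries.pderiv ℂ 0) (constantCoeff_blowUpChart d 0)
    (constantCoeff_blowUpChart d 1) f
  have e2 := derivation_substPair (MvPowerSeries.pderiv ℂ 1) (constantCoeff_blowUpChart d 0)
    (constantCoeff_blowUpChart d 1) f
  change (blow d f).dx = blow d f.dx * (blowUpChart d 0).dx +
    blow d f.dy * (blowUpChart d 1).dx at e1
  change (blow d f).dy = blow d f.dx * (blowUpChart d 0).dy +
    blow d f.dy * (blowUpChart d 1).dy at e2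
  rw [e1, map_add, map_mul, map_mul, ev_blow, ev_blow] at h1
  rw [e2, map_add, map_mul, map_mul, ev_blow, ev_blow] at h2
  cases d with
  | slope c =>
    simp [blowUpChart] at h1 h2
    have h3 := h2.resolve_right hx
    rw [h3] at h1
    simp at h1
    exact ⟨h1, h3⟩
  | vertical =>
    simp [blowUpChart] at h1 h2
    have h3 := h2.resolve_right hx
    rw [h3] at h1
    simp at h1
    exact ⟨h3, h1⟩

/-- The strict transform of an irreducible curve passes through exactly one point of the
exceptional line, where it is irreducible. -/
theorem FormalArc.Parametrizes.exists_lift {γ : FormalArc} {f : 𝕣} (h : γ.Parametrizes f) :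
    ∃ d, ∃ γ' : FormalArc, γ'.x ≠ 0 ∧ γ = γ'.blowDown d ∧
      γ'.Parametrizes (strictTransform d f) ∧
      ∀ e ≠ d, IsUnit (strictTransform e f) := by
  have hf0 := h.irreducible.ne_zero
  obtain ⟨d, γ', hx, rfl⟩ := h.nonConst.exists_lift
  have hnc : γ'.NonConst := Or.inl hx
  have hev : γ'.ev (strictTransform d f) = 0 := by
    have h1 := (h.ker f).mpr dvd_rfl
    rw [FormalArc.ev_blowDown hf0] at h1
    exact (mul_eq_zero.mp h1).resolve_left (pow_ne_zero _ hx)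
  obtain ⟨f', hf', hf'0⟩ := γ'.exists_irreducible
  have hpar : γ'.Parametrizes f' := by
    refine ⟨hnc.ev_eq_zero_iff hf' hf'0, ?_⟩
    obtain ⟨N, hN⟩ := h.primitive
    refine ⟨N, fun u hu => ?_⟩
    obtain ⟨g, hg⟩ := hN u hu
    exact ⟨blow d g, by rw [FormalArc.ev_blow, hg]⟩
  -- irreducible factors of strict transforms lie under the lifted arc
  have key : ∀ e g, Irreducible g → g ∣ strictTransform e f → e = d ∧ Associated g f' := by
    intro e g hg hdvd
    have hgx : ¬ Associated g 𝕩 := fun ha =>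
      not_X0_dvd_strictTransform hf0 e (ha.symm.dvd.trans hdvd)
    have hδ := branchArc_parametrizes hg
    have hδx := hδ.x_ne_zero hgx
    have h1 : ((branchArc g).blowDown e).ev f = 0 := by
      rw [FormalArc.ev_blowDown hf0, (hδ.ker _).mpr hdvd, mul_zero]
    obtain ⟨θ, hθ, e1⟩ := h.exists_reparam (FormalArc.nonConst_blowDown hδx e) h1
    rw [← FormalArc.blowDown_reparam] at e1
    have hnc' := FormalArc.nonConst_blowDown hδx e
    have hθ0 : θ ≠ 0 := by
      rw [e1, FormalArc.blowDown_reparam] at hnc'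
      exact hnc'.param_ne_zero
    have hx' : (γ'.reparam θ hθ).x ≠ 0 := by
      rw [FormalArc.reparam_x, Ne, substOne_eq_zero_iff hθ hθ0]
      exact hx
    obtain ⟨e2, e3⟩ := FormalArc.blowDown_injective hδx hx' e1
    refine ⟨e2, ?_⟩
    have h2 : (branchArc g).ev f' = 0 := by rw [e3, FormalArc.ev_reparam, hf'0, map_zero]
    exact hg.associated_of_dvd hf' ((hδ.ker _).mp h2)
  have hassoc : Associated f' (strictTransform d f) := by
    obtain ⟨r, hr⟩ := (hpar.ker _).mp hev
    have hr0 : r ≠ 0 := by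
      rintro rfl
      exact strictTransform_ne_zero hf0 d (by rw [hr, mul_zero])
    -- a further factor vanishes on the lifted arc, too, so that the total transform has a double zero
    -- there; then `f` is singular along its own curve
    have hru : IsUnit r := by
      by_contra hru
      obtain ⟨g, hg, s, rfl⟩ := WfDvdMonoid.exists_irreducible_factor hru hr0
      have hgf := (key d g hg (hr ▸ ⟨f' * s, by ring⟩)).2
      have hg0 : γ'.ev g = 0 := (hpar.ker g).mpr hgf.symm.dvd
      have hb : blow d f = 𝕩 ^ mult f * (f' * (g * s)) := by rw [← hr, blow_eq hf0]
      have h1 : γ'.ev (blow d f).dx = 0 := by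
        rw [hb]; simp only [FormalSeries.dx_mul, map_add, map_mul, hf'0, hg0]; ring
      have h2 : γ'.ev (blow d f).dy = 0 := by
        rw [hb]; simp only [FormalSeries.dy_mul, map_add, map_mul, hf'0, hg0]; ring
      obtain ⟨h3, h4⟩ := FormalArc.ev_dx_dy_blow hx h1 h2
      rcases not_dvd_dx_or_not_dvd_dy h.irreducible with h5 | h5
      · exact h5 ((h.ker _).mp h3)
      · exact h5 ((h.ker _).mp h4)
    rw [hr]
    exact associated_mul_unit_right _ _ hru
  refine ⟨d, γ', hx, rfl, hpar.of_associated hassoc, fun e he => ?_⟩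
  by_contra hu
  obtain ⟨g, hg, hdvd⟩ := WfDvdMonoid.exists_irreducible_factor hu (strictTransform_ne_zero hf0 e)
  exact he (key e g hg hdvd).1

/-- The lift of the parametrization to a given direction, when the strict transform passes
through it. -/
theorem FormalArc.Parametrizes.exists_lift_at {γ : FormalArc} {f : 𝕣} (h : γ.Parametrizes f)
    {d : BlowUpDirection} (hd : ¬ IsUnit (strictTransform d f)) :
    ∃ γ' : FormalArc, γ'.x ≠ 0 ∧ γ = γ'.blowDown d ∧ γ'.Parametrizes (strictTransform d f) := by
  obtain ⟨e, γ', h1, h2, h3, h4⟩ := h.exists_lift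
  by_cases hde : d = e
  · subst hde; exact ⟨γ', h1, h2, h3⟩
  · exact absurd (h4 d hde) hd

theorem strictTransform_irreducible {f : 𝕣} (hf : Irreducible f) {d : BlowUpDirection}
    (hd : ¬ IsUnit (strictTransform d f)) : Irreducible (strictTransform d f) := by
  obtain ⟨γ', _, _, h⟩ := (branchArc_parametrizes hf).exists_lift_at hd
  exact h.irreducible

/-- Every branch on the blow-up other than the exceptional line is a strict transform. -/
theorem exists_strictTransform_associated {g : 𝕣} (hg : Irreducible g) (hgx : ¬ Associated g 𝕩)
    (d : BlowUpDirection) : ∃ f, Irreducible f ∧ Associated (strictTransform d f) g := by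
  have hγ := branchArc_parametrizes hg
  have hx := hγ.x_ne_zero hgx
  obtain ⟨f, hf, h0⟩ := ((branchArc g).blowDown d).exists_irreducible
  refine ⟨f, hf, ?_⟩
  rw [FormalArc.ev_blowDown hf.ne_zero] at h0
  have h1 := (hγ.ker _).mp ((mul_eq_zero.mp h0).resolve_left (pow_ne_zero _ hx))
  have h2 : ¬ IsUnit (strictTransform d f) := fun hu => hg.not_isUnit (isUnit_of_dvd_unit h1 hu)
  exact (hg.associated_of_dvd (strictTransform_irreducible hf h2) h1).symm

theorem associated_of_strictTransform {f g : 𝕣} (hf : Irreducible f) (hg : Irreducible g)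
    {d : BlowUpDirection} (hd : ¬ IsUnit (strictTransform d f))
    (h : Associated (strictTransform d f) (strictTransform d g)) : Associated f g := by
  have hγ := branchArc_parametrizes hf
  obtain ⟨γ', hx, e, hγ'⟩ := hγ.exists_lift_at hd
  apply hf.associated_of_dvd hg
  rw [← hγ.ker, e, FormalArc.ev_blowDown hg.ne_zero, (hγ'.ker _).mpr h.dvd, mul_zero]

/-! ### Blow-ups of foliations -/

namespace FormalOneForm

/-- The multiplicity of the foliation at the origin. -/
noncomputable def nu (ω : FormalOneForm) : ℕ :=
  (min (MvPowerSeries.order ω.a) (MvPowerSeries.order ω.b)).toNat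

theorem coe_nu {ω : FormalOneForm} (h : ω.a ≠ 0 ∨ ω.b ≠ 0) :
    (ω.nu : ℕ∞) = min (MvPowerSeries.order ω.a) (MvPowerSeries.order ω.b) := by
  apply ENat.natCast_toNat
  rcases h with h | h
  · exact ne_top_of_le_ne_top (MvPowerSeries.order_eq_top_iff.not.mpr h) (min_le_left _ _)
  · exact ne_top_of_le_ne_top (MvPowerSeries.order_eq_top_iff.not.mpr h) (min_le_right _ _)

/-- The blow-up of the origin creates a dicritical component. -/
def Dicritical (ω : FormalOneForm) : Prop := ¬ ∀ d, (blowUp d ω).Invariant 𝕩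

theorem invariant_X0_iff {ω : FormalOneForm} : ω.Invariant 𝕩 ↔ 𝕩 ∣ ω.b := by
  simp [Invariant]

theorem invariant_X1_iff {ω : FormalOneForm} : ω.Invariant 𝕪 ↔ 𝕪 ∣ ω.a := by
  simp [Invariant]

theorem blowUp_eq {ω η : FormalOneForm} {d : BlowUpDirection} {m : ℕ}
    (ha : (pullBack d ω).a = 𝕩 ^ m * η.a) (hb : (pullBack d ω).b = 𝕩 ^ m * η.b)
    (h : ¬ (𝕩 ∣ η.a ∧ 𝕩 ∣ η.b)) : blowUp d ω = η := by
  have hm : min (emultiplicity 𝕩 (pullBack d ω).a) (emultiplicity 𝕩 (pullBack d ω).b) = m := by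
    rw [ha, hb]
    have h1 : ∀ g : 𝕣, (m : ℕ∞) ≤ emultiplicity 𝕩 (𝕩 ^ m * g) := fun g =>
      le_emultiplicity_of_pow_dvd (dvd_mul_right _ _)
    by_cases h2 : 𝕩 ∣ η.a
    · rw [emultiplicity_X0_pow_mul fun h3 => h ⟨h2, h3⟩]
      exact min_eq_right (h1 _)
    · rw [emultiplicity_X0_pow_mul h2]
      exact min_eq_left (h1 _)
  change FormalOneForm.mk (FormalSeries.divX (min (emultiplicity 𝕩 (pullBack d ω).a)
    (emultiplicity 𝕩 (pullBack d ω).b)).toNat (pullBack d ω).a) (FormalSeries.divX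
    (min (emultiplicity 𝕩 (pullBack d ω).a) (emultiplicity 𝕩 (pullBack d ω).b)).toNat
    (pullBack d ω).b) = η
  rw [hm, ENat.toNat_natCast, ha, hb, divX_X_pow_mul, divX_X_pow_mul]

theorem pullBack_slope_a (ω : FormalOneForm) (c : ℂ) : (pullBack (.slope c) ω).a =
    blow (.slope c) ω.a + (𝕪 + MvPowerSeries.C c) * blow (.slope c) ω.b := by
  simp only [pullBack, totalTransform_eq]

theorem pullBack_slope_b (ω : FormalOneForm) (c : ℂ) :
    (pullBack (.slope c) ω).b = 𝕩 * blow (.slope c) ω.b := by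
  simp only [pullBack, totalTransform_eq]

theorem pullBack_vertical_a (ω : FormalOneForm) :
    (pullBack .vertical ω).a = 𝕪 * blow .vertical ω.a + blow .vertical ω.b := by
  simp only [pullBack, totalTransform_eq]

theorem pullBack_vertical_b (ω : FormalOneForm) :
    (pullBack .vertical ω).b = 𝕩 * blow .vertical ω.a := by
  simp only [pullBack, totalTransform_eq]

/-- The blow-up of a foliation of multiplicity `ν`, in terms of the form `Q` of degree `ν + 1` that
is the homogeneous part of `x a + y b`. If `Q ≠ 0`, the exceptional line is invariant and the
foliation is tangent to it or singular at the zeros of `Q`. If `Q = 0`, then `(a, b)` starts with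
`(- y Q', x Q')` and the foliation is tangent to the exceptional line at the zeros of `Q'`. -/
theorem blowUp_structure {ω : FormalOneForm} (hω : ω.a ≠ 0 ∨ ω.b ≠ 0) :
    (∃ Q : Polynomial ℂ, Q ≠ 0 ∧ Q.natDegree ≤ ω.nu + 1 ∧ ∀ d,
      (pullBack d ω).a = 𝕩 ^ ω.nu * (blowUp d ω).a ∧
      (pullBack d ω).b = 𝕩 ^ ω.nu * (blowUp d ω).b ∧
      𝕩 ∣ (blowUp d ω).b ∧ resX (blowUp d ω).a = (dirPoly (ω.nu + 1) Q d : 𝕆)) ∨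
    (1 ≤ ω.nu ∧ ∃ Q : Polynomial ℂ, Q ≠ 0 ∧ Q.natDegree ≤ ω.nu - 1 ∧ ∀ d,
      (pullBack d ω).a = 𝕩 ^ (ω.nu + 1) * (blowUp d ω).a ∧
      (pullBack d ω).b = 𝕩 ^ (ω.nu + 1) * (blowUp d ω).b ∧
      ∃ Q', (Q' = Q ∨ Q' = - Q) ∧ resX (blowUp d ω).b = (dirPoly (ω.nu - 1) Q' d : 𝕆)) := by
  have hν := coe_nu hω
  set ν := ω.nu
  obtain ⟨A, hA1, hA2, hA3⟩ := exists_leadPoly (hν.le.trans (min_le_left _ _))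
  obtain ⟨B, hB1, hB2, hB3⟩ := exists_leadPoly (hν.le.trans (min_le_right _ _))
  have hAB : ¬ (A = 0 ∧ B = 0) := by
    rintro ⟨h1, h2⟩
    have := le_min (hA2 h1) (hB2 h2)
    rw [← hν, Nat.cast_le] at this
    omega
  choose α hα hα' using hA3
  choose β hβ hβ' using hB3
  have hXB : (Polynomial.X * B).natDegree ≤ ν + 1 :=
    Polynomial.natDegree_mul_le.trans (by rw [Polynomial.natDegree_X]; omega)
  -- the quotients of the first components of the pull-backs by `x ^ ν`
  let q : BlowUpDirection → 𝕣 := fun d => match d with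
    | .slope c => α (.slope c) + (𝕪 + MvPowerSeries.C c) * β (.slope c)
    | .vertical => 𝕪 * α .vertical + β .vertical
  let r : BlowUpDirection → 𝕣 := fun d => match d with
    | .slope c => β (.slope c)
    | .vertical => α .vertical
  have hqa : ∀ d, (pullBack d ω).a = 𝕩 ^ ν * q d := by
    intro d
    cases d with
    | slope c => rw [pullBack_slope_a, hα, hβ]; simp only [q]; ring
    | vertical => rw [pullBack_vertical_a, hα, hβ]; simp only [q]; ring
  have hrb : ∀ d, (pullBack d ω).b = 𝕩 ^ ν * (𝕩 * r d) := by
    intro d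
    cases d with
    | slope c => rw [pullBack_slope_b, hβ]; simp only [r]; ring
    | vertical => rw [pullBack_vertical_b, hα]; simp only [r]; ring
  have hresq : ∀ d, resX (q d) = (dirPoly (ν + 1) (A + Polynomial.X * B) d : 𝕆) := by
    intro d
    cases d with
    | slope c =>
      simp only [q, map_add, map_mul, hα', hβ', resX_X1, resX_C, dirPoly, Polynomial.add_comp,
        Polynomial.mul_comp, Polynomial.X_comp, Polynomial.coe_add, Polynomial.coe_mul,
        Polynomial.coe_X, Polynomial.coe_C]
    | vertical =>
      simp only [q, map_add, map_mul, hα', hβ', resX_X1, dirPoly, Polynomial.reflect_add,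
        Polynomial.coe_add]
      have h1 : (Polynomial.X * B).reflect (ν + 1) = B.reflect ν := by
        rw [add_comm ν 1, Polynomial.reflect_mul _ _ Polynomial.natDegree_X_le hB1,
          Polynomial.reflect_one_X, one_mul]
      have h2 : A.reflect (ν + 1) = Polynomial.X * A.reflect ν := by
        rw [← one_mul A, add_comm ν 1, Polynomial.reflect_mul _ _ (by simp) hA1,
          one_mul, Polynomial.reflect_one, pow_one]
      rw [h1, h2, Polynomial.coe_mul, Polynomial.coe_X]
  -- `Q = A + X B`; if it vanishes, then `B` takes its place and one more factor `x` splits off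
  by_cases hQ : A + Polynomial.X * B = 0
  · right
    have hA : A = - (Polynomial.X * B) := by linear_combination hQ
    have hB0 : B ≠ 0 := by
      rintro rfl
      exact hAB ⟨by rw [hA]; simp, rfl⟩
    have hdeg : B.natDegree + 1 ≤ ν := by
      rw [hA, Polynomial.natDegree_neg, Polynomial.natDegree_X_mul hB0] at hA1
      exact hA1
    obtain ⟨μ, hμ⟩ : ∃ μ, ν = μ + 1 := ⟨ν - 1, by omega⟩
    refine ⟨by omega, B, hB0, by omega, fun d => ?_⟩
    obtain ⟨p, hp⟩ := (X0_dvd_iff _).mpr ((hresq d).trans (by rw [hQ, dirPoly_zero]; simp))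
    have hr : ∃ Q', (Q' = B ∨ Q' = - B) ∧ resX (r d) = (dirPoly (ν - 1) Q' d : 𝕆) := by
      cases d with
      | slope c => exact ⟨B, Or.inl rfl, hβ' _⟩
      | vertical =>
        refine ⟨-B, Or.inr rfl, ?_⟩
        simp only [r, hα', dirPoly]
        rw [hA, ← mul_neg, hμ, add_comm μ 1, Polynomial.reflect_mul _ _ Polynomial.natDegree_X_le
          (by rw [Polynomial.natDegree_neg]; omega), Polynomial.reflect_one_X, one_mul]
        simp
    obtain ⟨Q', hQ', hr'⟩ := hr
    have hr0 : ¬ 𝕩 ∣ r d := by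
      rw [X0_dvd_iff, hr']
      refine fun h0 => dirPoly_ne_zero ?_ d (Polynomial.coe_eq_zero_iff.mp h0)
      rcases hQ' with rfl | rfl
      · exact hB0
      · exact neg_ne_zero.mpr hB0
    have h1 : (pullBack d ω).a = 𝕩 ^ (ν + 1) * p := by rw [hqa, hp]; ring
    have h2 : (pullBack d ω).b = 𝕩 ^ (ν + 1) * r d := by rw [hrb]; ring
    have h3 : blowUp d ω = ⟨p, r d⟩ := blowUp_eq h1 h2 fun h => hr0 h.2
    rw [h3]
    exact ⟨h1, h2, Q', hQ', hr'⟩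
  · left
    refine ⟨_, hQ, Polynomial.natDegree_add_le_of_degree_le (by omega) hXB, fun d => ?_⟩
    have hq0 : ¬ 𝕩 ∣ q d := by
      rw [X0_dvd_iff, hresq]
      exact fun h0 => dirPoly_ne_zero hQ d (Polynomial.coe_eq_zero_iff.mp h0)
    have h3 : blowUp d ω = ⟨q d, 𝕩 * r d⟩ := blowUp_eq (hqa d) (hrb d) fun h => hq0 h.1
    rw [h3]
    exact ⟨hqa d, hrb d, dvd_mul_right _ _, hresq d⟩

/-- The blow-up when the exceptional line is invariant: it carries `ν + 1` zeros. -/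
theorem blowUp_of_not_dicritical {ω : FormalOneForm} (hω : ω.a ≠ 0 ∨ ω.b ≠ 0)
    (h : ¬ ω.Dicritical) :
    (∀ d, (pullBack d ω).a = 𝕩 ^ ω.nu * (blowUp d ω).a ∧
      (pullBack d ω).b = 𝕩 ^ ω.nu * (blowUp d ω).b ∧
      𝕩 ∣ (blowUp d ω).b ∧ ¬ 𝕩 ∣ (blowUp d ω).a) ∧
    (Function.support fun d => (ordX (blowUp d ω).a : ℤ)).Finite ∧
      ∑ᶠ d, (ordX (blowUp d ω).a : ℤ) = ω.nu + 1 := by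
  rcases blowUp_structure hω with ⟨Q, hQ, hdeg, h1⟩ | ⟨hν, Q, hQ, hdeg, h1⟩
  · refine ⟨fun d => ⟨(h1 d).1, (h1 d).2.1, (h1 d).2.2.1, ?_⟩, ?_⟩
    · rw [X0_dvd_iff, (h1 d).2.2.2]
      exact fun h0 => dirPoly_ne_zero hQ d (Polynomial.coe_eq_zero_iff.mp h0)
    · have : (fun d => (ordX (blowUp d ω).a : ℤ)) =
          fun d => (ordN (dirPoly (ω.nu + 1) Q d : 𝕆) : ℤ) := by
        funext d; rw [ordX, (h1 d).2.2.2]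
      rw [this]
      have h2 := finsum_ordN_dirPoly hQ hdeg
      exact ⟨h2.1, by rw [h2.2]; push_cast; rfl⟩
  · exfalso
    refine h fun h2 => ?_
    have h3 := h2 .vertical
    obtain ⟨_, _, Q', hQ', h4⟩ := h1 .vertical
    rw [invariant_X0_iff, X0_dvd_iff, h4] at h3
    refine dirPoly_ne_zero ?_ _ (Polynomial.coe_eq_zero_iff.mp h3)
    rcases hQ' with rfl | rfl
    · exact hQ
    · exact neg_ne_zero.mpr hQ

/-- The blow-up when the exceptional line is not invariant: it carries `ν - 1` tangencies. -/
theorem blowUp_of_dicritical {ω : FormalOneForm} (hω : ω.a ≠ 0 ∨ ω.b ≠ 0)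
    (h : ω.Dicritical) :
    (∀ d, (pullBack d ω).a = 𝕩 ^ (ω.nu + 1) * (blowUp d ω).a ∧
      (pullBack d ω).b = 𝕩 ^ (ω.nu + 1) * (blowUp d ω).b ∧
      ¬ 𝕩 ∣ (blowUp d ω).b) ∧
    (Function.support fun d => (ordX (blowUp d ω).b : ℤ)).Finite ∧
      ∑ᶠ d, (ordX (blowUp d ω).b : ℤ) = ω.nu - 1 := by
  rcases blowUp_structure hω with ⟨Q, hQ, hdeg, h1⟩ | ⟨hν, Q, hQ, hdeg, h1⟩
  · exact absurd (fun d => invariant_X0_iff.mpr (h1 d).2.2.1) h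
  · have hneg : ∀ (P : Polynomial ℂ) d, ((dirPoly (ω.nu - 1) (-P) d : Polynomial ℂ) : 𝕆) =
        - (dirPoly (ω.nu - 1) P d : 𝕆) := by
      intro P d
      rw [eq_neg_iff_add_eq_zero, ← Polynomial.coe_add, Polynomial.coe_eq_zero_iff]
      cases d <;> simp [dirPoly]
    have hres : ∀ d, resX (blowUp d ω).b = (dirPoly (ω.nu - 1) Q d : 𝕆) ∨
        resX (blowUp d ω).b = - (dirPoly (ω.nu - 1) Q d : 𝕆) := by
      intro d
      obtain ⟨_, _, Q', hQ', h4⟩ := h1 d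
      rcases hQ' with rfl | rfl
      · exact Or.inl h4
      · exact Or.inr (by rw [h4, hneg])
    refine ⟨fun d => ⟨(h1 d).1, (h1 d).2.1, ?_⟩, ?_⟩
    · rw [X0_dvd_iff]
      intro h0
      refine dirPoly_ne_zero (n := ω.nu - 1) hQ d (Polynomial.coe_eq_zero_iff.mp ?_)
      · rcases hres d with h2 | h2
        · rw [← h2, h0]
        · rw [h0] at h2; exact neg_eq_zero.mp h2.symm
    · have : (fun d => (ordX (blowUp d ω).b : ℤ)) =
          fun d => (ordN (dirPoly (ω.nu - 1) Q d : 𝕆) : ℤ) := by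
        funext d
        rw [ordX]
        rcases hres d with h2 | h2
        · rw [h2]
        · rw [h2, ordN, ordN, PowerSeries.order_neg]
      rw [this]
      have h2 := finsum_ordN_dirPoly hQ hdeg
      exact ⟨h2.1, by rw [h2.2]; push_cast [hν]; rfl⟩

open Classical in
/-- The power of `x` by which the pull-back is divided. -/
noncomputable def expo (ω : FormalOneForm) : ℕ := if ω.Dicritical then ω.nu + 1 else ω.nu

theorem pullBack_eq {ω : FormalOneForm} (hω : ω.a ≠ 0 ∨ ω.b ≠ 0) (d : BlowUpDirection) :
    (pullBack d ω).a = 𝕩 ^ ω.expo * (blowUp d ω).a ∧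
    (pullBack d ω).b = 𝕩 ^ ω.expo * (blowUp d ω).b ∧
      ¬ (𝕩 ∣ (blowUp d ω).a ∧ 𝕩 ∣ (blowUp d ω).b) := by
  by_cases h : ω.Dicritical
  · rw [expo, if_pos h]
    obtain ⟨h1, h2, h3⟩ := (blowUp_of_dicritical hω h).1 d
    exact ⟨h1, h2, fun h4 => h3 h4.2⟩
  · rw [expo, if_neg h]
    obtain ⟨h1, h2, _, h3⟩ := (blowUp_of_not_dicritical hω h).1 d
    exact ⟨h1, h2, fun h4 => h3 h4.1⟩

theorem ne_zero_or {ω : FormalOneForm} (hω : IsRelPrime ω.a ω.b) : ω.a ≠ 0 ∨ ω.b ≠ 0 := by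
  by_contra hc
  push Not at hc
  exact prime_X0.not_isUnit (hω (hc.1 ▸ dvd_zero _) (hc.2 ▸ dvd_zero _))

/-- The transform of a foliation has again coprime coefficients: a curve of common zeros would be
mapped to such a curve, as it is not the exceptional line. -/
theorem isRelPrime_blowUp {ω : FormalOneForm} (hω : IsRelPrime ω.a ω.b) (d : BlowUpDirection) :
    IsRelPrime (blowUp d ω).a (blowUp d ω).b := by
  obtain ⟨h1, h2, h3⟩ := pullBack_eq (ne_zero_or hω) d
  intro g ha hb
  by_contra hu
  have hg0 : g ≠ 0 := by
    rintro rfl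
    rw [zero_dvd_iff] at ha hb
    exact h3 ⟨ha ▸ dvd_zero _, hb ▸ dvd_zero _⟩
  obtain ⟨p, hp, hpg⟩ := WfDvdMonoid.exists_irreducible_factor hu hg0
  have hpx : ¬ Associated p 𝕩 := fun h =>
    h3 ⟨h.symm.dvd.trans (hpg.trans ha), h.symm.dvd.trans (hpg.trans hb)⟩
  have hγ := branchArc_parametrizes hp
  have hx := hγ.x_ne_zero hpx
  have e1 : (branchArc p).ev (pullBack d ω).a = 0 := by
    rw [h1, map_mul, (hγ.ker _).mpr (hpg.trans ha), mul_zero]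
  have e2 : (branchArc p).ev (pullBack d ω).b = 0 := by
    rw [h2, map_mul, (hγ.ker _).mpr (hpg.trans hb), mul_zero]
  have key : ((branchArc p).blowDown d).ev ω.a = 0 ∧ ((branchArc p).blowDown d).ev ω.b = 0 := by
    rw [← FormalArc.ev_blow, ← FormalArc.ev_blow]
    cases d with
    | slope c =>
      rw [pullBack_slope_b, map_mul, FormalArc.ev_X0] at e2
      have e3 := (mul_eq_zero.mp e2).resolve_left hx
      rw [pullBack_slope_a, map_add, map_mul, e3, mul_zero, add_zero] at e1
      exact ⟨e1, e3⟩
    | vertical =>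
      rw [pullBack_vertical_b, map_mul, FormalArc.ev_X0] at e2
      have e3 := (mul_eq_zero.mp e2).resolve_left hx
      rw [pullBack_vertical_a, map_add, map_mul, e3, mul_zero, zero_add] at e1
      exact ⟨e3, e1⟩
  obtain ⟨f, hf, hf0⟩ := ((branchArc p).blowDown d).exists_irreducible
  have hk := (FormalArc.nonConst_blowDown hx d).ev_eq_zero_iff hf hf0
  exact hf.not_isUnit (hω ((hk _).mp key.1) ((hk _).mp key.2))

theorem isRelPrime_transformAt {ω : FormalOneForm} (hω : IsRelPrime ω.a ω.b) (q : InfNearPoint) :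
    IsRelPrime (ω.transformAt q).a (ω.transformAt q).b := by
  induction q with
  | nil => exact hω
  | cons d p ih => exact isRelPrime_blowUp ih d

/-! ### Invariant curves and tangent arcs -/

/-- The restriction of a form to an arc: `ω = (onArc ω γ) dt` on `γ`. -/
noncomputable def onArc (ω : FormalOneForm) (γ : FormalArc) : 𝕆 :=
  γ.ev ω.a * PowerSeries.derivative ℂ γ.x + γ.ev ω.b * PowerSeries.derivative ℂ γ.y

theorem derivative_eq_zero_iff {a : 𝕆} (h : PowerSeries.constantCoeff a = 0) :
    PowerSeries.derivative ℂ a = 0 ↔ a = 0 := by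
  constructor
  · intro h1
    exact PowerSeries.derivative.ext (by rw [h1, map_zero]) (by rw [h, map_zero])
  · rintro rfl; exact map_zero _

/-- A curve is invariant exactly when the form vanishes on the arcs of the curve. -/
theorem invariant_iff_onArc {ω : FormalOneForm} {γ : FormalArc} (hγ : γ.NonConst) {f : 𝕣}
    (hf : Irreducible f) (h0 : γ.ev f = 0) : ω.Invariant f ↔ ω.onArc γ = 0 := by
  have hker := hγ.ev_eq_zero_iff hf h0
  have htan := γ.derivative_ev f
  rw [h0, map_zero] at htan
  rw [Invariant, ← hker, map_sub, map_mul, map_mul, onArc]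
  have hd : ¬ γ.ev f.dx = 0 ∨ ¬ γ.ev f.dy = 0 := by
    rw [hker, hker]; exact not_dvd_dx_or_not_dvd_dy hf
  have hxy : PowerSeries.derivative ℂ γ.x ≠ 0 ∨ PowerSeries.derivative ℂ γ.y ≠ 0 := by
    rw [Ne, Ne, derivative_eq_zero_iff γ.x_zero, derivative_eq_zero_iff γ.y_zero]
    exact hγ
  constructor
  · intro h
    rcases hd with hd | hd
    · refine mul_left_cancel₀ hd ?_
      linear_combination -γ.ev ω.a * htan + PowerSeries.derivative ℂ γ.y * (-h)
    · refine mul_left_cancel₀ hd ?_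
      linear_combination -γ.ev ω.b * htan + PowerSeries.derivative ℂ γ.x * h
  · intro h
    rcases hxy with hd | hd
    · refine mul_left_cancel₀ hd ?_
      linear_combination γ.ev f.dy * h - γ.ev ω.b * (-htan)
    · refine mul_left_cancel₀ hd ?_
      linear_combination γ.ev ω.a * (-htan) - γ.ev f.dx * h

theorem onArc_blowDown {ω : FormalOneForm} (hω : ω.a ≠ 0 ∨ ω.b ≠ 0) (γ : FormalArc)
    (d : BlowUpDirection) :
    ω.onArc (γ.blowDown d) = γ.x ^ ω.expo * (blowUp d ω).onArc γ := by
  obtain ⟨h1, h2, _⟩ := pullBack_eq hω d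
  have e1 := congrArg γ.ev h1
  have e2 := congrArg γ.ev h2
  rw [map_mul, map_pow, FormalArc.ev_X0] at e1 e2
  rw [onArc, onArc, mul_add, ← mul_assoc, ← mul_assoc, ← e1, ← e2, ← FormalArc.ev_blow,
    ← FormalArc.ev_blow]
  cases d with
  | slope c =>
    rw [FormalArc.blowDown_slope_x, FormalArc.blowDown_slope_y, pullBack_slope_a,
      pullBack_slope_b, Derivation.leibniz, map_add]
    simp [smul_eq_mul]
    ring
  | vertical =>
    rw [FormalArc.blowDown_vertical_x, FormalArc.blowDown_vertical_y, pullBack_vertical_a,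
      pullBack_vertical_b, Derivation.leibniz]
    simp [smul_eq_mul]
    ring

theorem invariant_strictTransform_iff {ω : FormalOneForm} (hω : ω.a ≠ 0 ∨ ω.b ≠ 0) {f : 𝕣}
    (hf : Irreducible f) {d : BlowUpDirection} (hd : ¬ IsUnit (strictTransform d f)) :
    (blowUp d ω).Invariant (strictTransform d f) ↔ ω.Invariant f := by
  have hγ := branchArc_parametrizes hf
  obtain ⟨γ', hx, e, hγ'⟩ := hγ.exists_lift_at hd
  rw [invariant_iff_onArc hγ'.nonConst hγ'.irreducible ((hγ'.ker _).mpr dvd_rfl),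
    invariant_iff_onArc hγ.nonConst hf ((hγ.ker _).mpr dvd_rfl), e, onArc_blowDown hω, mul_eq_zero,
    or_iff_right (pow_ne_zero _ hx)]

/-! ### Restrictions to the axes -/

theorem resY_blow_vertical (f : 𝕣) : resY (blow .vertical f) = resX f := by
  rw [resX, resY, FormalArc.ev_blow]
  congr 2
  apply FormalArc.ext
  · rw [FormalArc.blowDown_vertical_x, mul_zero]
  · rw [FormalArc.blowDown_vertical_y]

theorem resY_blow_slope_zero (f : 𝕣) : resY (blow (.slope 0) f) = resY f := by
  rw [resY, FormalArc.ev_blow]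
  congr 2
  apply FormalArc.ext
  · rw [FormalArc.blowDown_slope_x]
  · rw [FormalArc.blowDown_slope_y, map_zero, add_zero, mul_zero]

theorem resX_eq_vertical {f : 𝕣} (hf : f ≠ 0) :
    resX f = 𝕥 ^ mult f * resY (strictTransform .vertical f) := by
  rw [← resY_blow_vertical, blow_eq hf, map_mul, map_pow, resY_X0]

theorem resY_eq_slope_zero {f : 𝕣} (hf : f ≠ 0) :
    resY f = 𝕥 ^ mult f * resY (strictTransform (.slope 0) f) := by
  rw [← resY_blow_slope_zero, blow_eq hf, map_mul, map_pow, resY_X0]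

theorem resY_blowUp_vertical {ω : FormalOneForm} (hω : ω.a ≠ 0 ∨ ω.b ≠ 0) :
    resX ω.b = 𝕥 ^ ω.expo * resY (blowUp .vertical ω).a ∧
      𝕥 * resX ω.a = 𝕥 ^ ω.expo * resY (blowUp .vertical ω).b := by
  obtain ⟨h1, h2, _⟩ := pullBack_eq hω .vertical
  have e1 := congrArg resY h1
  have e2 := congrArg resY h2
  rw [pullBack_vertical_a] at e1
  rw [pullBack_vertical_b] at e2
  simp only [map_add, map_mul, map_pow, resY_X0, resY_X1, resY_blow_vertical, zero_mul,
    zero_add] at e1 e2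
  exact ⟨e1, e2⟩

theorem resY_blowUp_slope_zero {ω : FormalOneForm} (hω : ω.a ≠ 0 ∨ ω.b ≠ 0) :
    resY ω.a = 𝕥 ^ ω.expo * resY (blowUp (.slope 0) ω).a ∧
      𝕥 * resY ω.b = 𝕥 ^ ω.expo * resY (blowUp (.slope 0) ω).b := by
  obtain ⟨h1, h2, _⟩ := pullBack_eq hω (.slope 0)
  have e1 := congrArg resY h1
  have e2 := congrArg resY h2
  rw [pullBack_slope_a] at e1
  rw [pullBack_slope_b] at e2
  simp only [map_add, map_mul, map_pow, resY_X0, resY_X1, map_zero, resY_blow_slope_zero,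
    zero_mul, add_zero] at e1 e2
  exact ⟨e1, e2⟩

end FormalOneForm

/-! ### Separatrices of regular and reduced points -/

theorem lin_zero_eq (f : 𝕣) : f.lin 0 = MvPowerSeries.constantCoeff f.dx := by
  rw [FormalSeries.dx, ← MvPowerSeries.coeff_zero_eq_constantCoeff_apply,
    MvPowerSeries.coeff_pderiv, zero_add, FormalSeries.lin]
  simp

theorem lin_one_eq (f : 𝕣) : f.lin 1 = MvPowerSeries.constantCoeff f.dy := by
  rw [FormalSeries.dy, ← MvPowerSeries.coeff_zero_eq_constantCoeff_apply,
    MvPowerSeries.coeff_pderiv, zero_add, FormalSeries.lin]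
  simp

theorem X_pow_succ_dvd_mul {n : ℕ} {p q : 𝕆} (hp : 𝕥 ^ n ∣ p) (hq : 𝕥 ∣ q) :
    𝕥 ^ (n + 1) ∣ p * q := by
  rw [pow_succ]; exact mul_dvd_mul hp hq

namespace FormalOneForm

/-- A smooth tangent arc `y = t σ`, `x = t`: the coefficients of `σ` are determined one after the
other, as the eigenvalues of the linear part satisfy no resonance that could obstruct this. -/
theorem exists_tangent_arc {ω : FormalOneForm} (ha : MvPowerSeries.constantCoeff ω.a = 0)
    (hb : MvPowerSeries.constantCoeff ω.b = 0) (hb1 : ω.b.lin 1 = 0)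
    (hres : ∀ k : ℕ, ω.a.lin 1 + ω.b.lin 0 * (k + 1) ≠ 0) :
    ∃ (s : 𝕆) (hs : PowerSeries.constantCoeff s = 0), ω.onArc ⟨𝕥, s, by simp, hs⟩ = 0 := by
  obtain ⟨a₁, a₂, ea⟩ := exists_eq_C_add ω.a
  obtain ⟨b₁, b₂, eb⟩ := exists_eq_C_add ω.b
  rw [ha, map_zero, zero_add] at ea
  rw [hb, map_zero, zero_add] at eb
  set α := ω.a.lin 1 with hα
  set β := ω.b.lin 0 with hβ
  have hα' : MvPowerSeries.constantCoeff a₂ = α := by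
    rw [hα, lin_one_eq, ea]; simp
  have hβ' : MvPowerSeries.constantCoeff b₁ = β := by
    rw [hβ, lin_zero_eq, eb]; simp
  have hb₂ : MvPowerSeries.constantCoeff b₂ = 0 := by
    rw [← hb1, lin_one_eq, eb]; simp
  -- tangency to the arc reads `α σ + β (σ + t σ') + R σ = 0`, where `R` is contracting; the
  -- coefficient of `σ` of degree `j` enters the linear part with the factor `α + β (j + 1)`
  let A : 𝕆 → FormalArc := fun σ => ⟨𝕥, 𝕥 * σ, by simp, by simp⟩
  let D : 𝕆 → 𝕆 := fun σ => σ + 𝕥 * PowerSeries.derivative ℂ σ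
  let R : 𝕆 → 𝕆 := fun σ => (A σ).ev a₁ + σ * ((A σ).ev a₂ - PowerSeries.C α) +
    ((A σ).ev b₁ - PowerSeries.C β) * D σ + σ * (A σ).ev b₂ * D σ
  have hev : ∀ (n : ℕ) (σ τ : 𝕆), 𝕥 ^ n ∣ σ - τ → ∀ f, 𝕥 ^ (n + 1) ∣ (A σ).ev f - (A τ).ev f := by
    intro n σ τ h f
    refine (A σ).X_pow_dvd_ev_sub (A τ) (n + 1) (by simp [A]) ?_ f
    change 𝕥 ^ (n + 1) ∣ 𝕥 * σ - 𝕥 * τ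
    rw [← mul_sub, pow_succ']
    exact mul_dvd_mul_left _ h
  have hD : ∀ (n : ℕ) (σ τ : 𝕆), 𝕥 ^ n ∣ σ - τ → 𝕥 ^ n ∣ D σ - D τ := by
    intro n σ τ h
    have h1 : 𝕥 ^ n ∣ 𝕥 * PowerSeries.derivative ℂ (σ - τ) := by
      rw [PowerSeries.X_pow_dvd_iff] at h ⊢
      intro m hm
      cases m with
      | zero => simp
      | succ m => rw [PowerSeries.coeff_succ_X_mul, PowerSeries.coeff_derivative, h _ hm, zero_mul]
    have : D σ - D τ = (σ - τ) + 𝕥 * PowerSeries.derivative ℂ (σ - τ) := by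
      simp only [D, map_sub]; ring
    rw [this]
    exact dvd_add h h1
  have hX : ∀ (f : 𝕣) (σ : 𝕆) (c : ℂ), MvPowerSeries.constantCoeff f = c →
      𝕥 ∣ (A σ).ev f - PowerSeries.C c := by
    intro f σ c hc
    rw [← constantCoeff_eq_zero_iff_X_dvd]
    simp [hc]
  obtain ⟨σ, hσ⟩ := exists_fixedPoint
    (fun σ => PowerSeries.mk fun j => - (α + β * (j + 1))⁻¹ * PowerSeries.coeff j (R σ)) (by
    intro n σ τ h
    have h1 : 𝕥 ^ (n + 1) ∣ R σ - R τ := by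
      have e : R σ - R τ = ((A σ).ev a₁ - (A τ).ev a₁) +
          ((σ - τ) * ((A σ).ev a₂ - PowerSeries.C α) + ((A σ).ev a₂ - (A τ).ev a₂) * τ) +
          (((A σ).ev b₁ - (A τ).ev b₁) * D σ + (D σ - D τ) * ((A τ).ev b₁ - PowerSeries.C β)) +
          ((σ - τ) * ((A σ).ev b₂ - PowerSeries.C 0) * D σ +
            ((A σ).ev b₂ - (A τ).ev b₂) * (τ * D σ) +
            (D σ - D τ) * ((A τ).ev b₂ - PowerSeries.C 0) * τ) := by
        simp only [R, map_zero, sub_zero]; ring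
      rw [e]
      have h2 := hev n σ τ h
      have h3 := hD n σ τ h
      refine dvd_add (dvd_add (dvd_add (h2 _) (dvd_add ?_ ?_)) (dvd_add ?_ ?_))
        (dvd_add (dvd_add ?_ ?_) ?_)
      · exact X_pow_succ_dvd_mul h (hX _ _ _ hα')
      · exact dvd_mul_of_dvd_left (h2 _) _
      · exact dvd_mul_of_dvd_left (h2 _) _
      · exact X_pow_succ_dvd_mul h3 (hX _ _ _ hβ')
      · exact dvd_mul_of_dvd_left (X_pow_succ_dvd_mul h (hX _ _ _ hb₂)) _
      · exact dvd_mul_of_dvd_left (h2 _) _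
      · exact dvd_mul_of_dvd_left (X_pow_succ_dvd_mul h3 (hX _ _ _ hb₂)) _
    rw [PowerSeries.X_pow_dvd_iff] at h1 ⊢
    intro m hm
    have h4 := h1 m hm
    rw [map_sub, sub_eq_zero] at h4
    rw [map_sub, PowerSeries.coeff_mk, PowerSeries.coeff_mk, h4, sub_self])
  have hlin : PowerSeries.C α * σ + PowerSeries.C β * D σ + R σ = 0 := by
    ext j
    have h1 := congrArg (PowerSeries.coeff j) hσ
    rw [PowerSeries.coeff_mk] at h1
    have h2 : PowerSeries.coeff j (D σ) = (j + 1) * PowerSeries.coeff j σ := by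
      simp only [D, map_add]
      cases j with
      | zero => simp
      | succ j =>
        rw [PowerSeries.coeff_succ_X_mul, PowerSeries.coeff_derivative]
        push_cast
        ring
    rw [map_add, map_add, PowerSeries.coeff_C_mul, PowerSeries.coeff_C_mul, h2, map_zero]
    have h3 := mul_inv_cancel₀ (hres j)
    linear_combination (-(α + β * (j + 1))) * h1 - PowerSeries.coeff j (R σ) * h3
  refine ⟨𝕥 * σ, by simp, ?_⟩
  change (A σ).ev ω.a * PowerSeries.derivative ℂ 𝕥 +
    (A σ).ev ω.b * PowerSeries.derivative ℂ (𝕥 * σ) = 0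
  have h5 : PowerSeries.derivative ℂ (𝕥 * σ) = D σ := by
    rw [Derivation.leibniz]; simp [D, smul_eq_mul]; ring
  rw [h5, ea, eb]
  simp only [map_add, map_mul, FormalArc.ev_X0, FormalArc.ev_X1, PowerSeries.derivative_X]
  change (𝕥 * (A σ).ev a₁ + 𝕥 * σ * (A σ).ev a₂) * 1 +
    (𝕥 * (A σ).ev b₁ + 𝕥 * σ * (A σ).ev b₂) * D σ = 0
  simp only [R] at hlin
  linear_combination 𝕥 * hlin

theorem linSubst_center (M : Matrix (Fin 2) (Fin 2) ℂ) (i : Fin 2) :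
    MvPowerSeries.constantCoeff
      (MvPowerSeries.C (M i 0) * 𝕩 + MvPowerSeries.C (M i 1) * 𝕪) = 0 := by simp

/-- Substitution of the linear map with matrix `M`. -/
noncomputable def linSubst (M : Matrix (Fin 2) (Fin 2) ℂ) : 𝕣 →ₐ[ℂ] 𝕣 :=
  substPair _ _ (linSubst_center M 0) (linSubst_center M 1)

/-- The pull-back of a form by a linear map. -/
noncomputable def linPull (M : Matrix (Fin 2) (Fin 2) ℂ) (ω : FormalOneForm) : FormalOneForm :=
  ⟨MvPowerSeries.C (M 0 0) * linSubst M ω.a + MvPowerSeries.C (M 1 0) * linSubst M ω.b,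
    MvPowerSeries.C (M 0 1) * linSubst M ω.a + MvPowerSeries.C (M 1 1) * linSubst M ω.b⟩

/-- The image of an arc under the linear map with matrix `M`. -/
noncomputable def _root_.FormalArc.linMap (γ : FormalArc) (M : Matrix (Fin 2) (Fin 2) ℂ) :
    FormalArc :=
  γ.map _ _ (linSubst_center M 0) (linSubst_center M 1)

theorem linMap_x (γ : FormalArc) (M : Matrix (Fin 2) (Fin 2) ℂ) :
    (γ.linMap M).x = PowerSeries.C (M 0 0) * γ.x + PowerSeries.C (M 0 1) * γ.y := by
  change γ.ev _ = _; simp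

theorem linMap_y (γ : FormalArc) (M : Matrix (Fin 2) (Fin 2) ℂ) :
    (γ.linMap M).y = PowerSeries.C (M 1 0) * γ.x + PowerSeries.C (M 1 1) * γ.y := by
  change γ.ev _ = _; simp

theorem onArc_linMap (ω : FormalOneForm) (γ : FormalArc) (M : Matrix (Fin 2) (Fin 2) ℂ) :
    ω.onArc (γ.linMap M) = (ω.linPull M).onArc γ := by
  have h : ∀ f, γ.ev (linSubst M f) = (γ.linMap M).ev f := fun f => γ.ev_substPair _ _ f
  have hd : ∀ c : ℂ, PowerSeries.derivative ℂ (PowerSeries.C c) = 0 := fun c => by simp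
  rw [onArc, onArc, linMap_x, linMap_y, map_add, map_add]
  simp only [linPull, map_add, map_mul, h, FormalArc.ev_C, Derivation.leibniz, hd, smul_eq_mul]
  ring

theorem lin_linSubst (M : Matrix (Fin 2) (Fin 2) ℂ) (f : 𝕣) (i : Fin 2) :
    (linSubst M f).lin i = f.lin 0 * M 0 i + f.lin 1 * M 1 i := by
  have e0 := derivation_substPair (MvPowerSeries.pderiv ℂ 0) (linSubst_center M 0)
    (linSubst_center M 1) f
  have e1 := derivation_substPair (MvPowerSeries.pderiv ℂ 1) (linSubst_center M 0)
    (linSubst_center M 1) f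
  change (linSubst M f).dx = linSubst M f.dx * FormalSeries.dx _ +
    linSubst M f.dy * FormalSeries.dx _ at e0
  change (linSubst M f).dy = linSubst M f.dx * FormalSeries.dy _ +
    linSubst M f.dy * FormalSeries.dy _ at e1
  have hc : ∀ g, MvPowerSeries.constantCoeff (linSubst M g) = MvPowerSeries.constantCoeff g :=
    fun g => constantCoeff_substPair _ _ g
  fin_cases i
  · change (linSubst M f).lin 0 = _
    rw [lin_zero_eq, e0, lin_zero_eq, lin_one_eq]
    simp [hc]
  · change (linSubst M f).lin 1 = _
    rw [lin_one_eq, e1, lin_zero_eq, lin_one_eq]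
    simp [hc]

theorem lin_linPull (ω : FormalOneForm) (M : Matrix (Fin 2) (Fin 2) ℂ) :
    (ω.linPull M).linearPart = M.transpose * ω.linearPart * M := by
  have hadd : ∀ (c d : ℂ) (f g : 𝕣) (i : Fin 2),
      FormalSeries.lin (MvPowerSeries.C c * f + MvPowerSeries.C d * g) i = c * f.lin i + d * g.lin i := by
    intro c d f g i
    simp [FormalSeries.lin]
  ext i j
  fin_cases i <;> fin_cases j <;>
    simp [linearPart, linPull, hadd, lin_linSubst, Matrix.mul_apply, Fin.sum_univ_two] <;> ring

theorem constantCoeff_linPull_a (ω : FormalOneForm) (M : Matrix (Fin 2) (Fin 2) ℂ) :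
    MvPowerSeries.constantCoeff (ω.linPull M).a =
      M 0 0 * MvPowerSeries.constantCoeff ω.a + M 1 0 * MvPowerSeries.constantCoeff ω.b := by
  have hc : ∀ g, MvPowerSeries.constantCoeff (linSubst M g) = MvPowerSeries.constantCoeff g :=
    fun g => constantCoeff_substPair _ _ g
  simp [linPull, hc]

theorem constantCoeff_linPull_b (ω : FormalOneForm) (M : Matrix (Fin 2) (Fin 2) ℂ) :
    MvPowerSeries.constantCoeff (ω.linPull M).b =
      M 0 1 * MvPowerSeries.constantCoeff ω.a + M 1 1 * MvPowerSeries.constantCoeff ω.b := by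
  have hc : ∀ g, MvPowerSeries.constantCoeff (linSubst M g) = MvPowerSeries.constantCoeff g :=
    fun g => constantCoeff_substPair _ _ g
  simp [linPull, hc]

/-- The first coefficients of an arc tangent to a form with antidiagonal linear part. -/
theorem coeff_one_of_onArc {ω : FormalOneForm} (ha : MvPowerSeries.constantCoeff ω.a = 0)
    (hb : MvPowerSeries.constantCoeff ω.b = 0) (ha0 : ω.a.lin 0 = 0) (hb1 : ω.b.lin 1 = 0)
    (hres : ω.a.lin 1 + ω.b.lin 0 ≠ 0) {s : 𝕆} {hs : PowerSeries.constantCoeff s = 0}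
    (h : ω.onArc ⟨𝕥, s, by simp, hs⟩ = 0) : PowerSeries.coeff 1 s = 0 := by
  obtain ⟨a₁, a₂, ea⟩ := exists_eq_C_add ω.a
  obtain ⟨b₁, b₂, eb⟩ := exists_eq_C_add ω.b
  rw [ha, map_zero, zero_add] at ea
  rw [hb, map_zero, zero_add] at eb
  have ha₁ : MvPowerSeries.constantCoeff a₁ = 0 := by rw [← ha0, lin_zero_eq, ea]; simp
  have hb₂ : MvPowerSeries.constantCoeff b₂ = 0 := by rw [← hb1, lin_one_eq, eb]; simp
  have ha₂ : MvPowerSeries.constantCoeff a₂ = ω.a.lin 1 := by rw [lin_one_eq, ea]; simp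
  have hb₁ : MvPowerSeries.constantCoeff b₁ = ω.b.lin 0 := by rw [lin_zero_eq, eb]; simp
  obtain ⟨σ, hσ⟩ := constantCoeff_eq_zero_iff_X_dvd.mp hs
  subst hσ
  have hd : PowerSeries.derivative ℂ (𝕥 * σ) = σ + 𝕥 * PowerSeries.derivative ℂ σ := by
    rw [Derivation.leibniz]; simp [smul_eq_mul]; ring
  rw [onArc, hd, ea, eb] at h
  simp only [map_add, map_mul, FormalArc.ev_X0, FormalArc.ev_X1, PowerSeries.derivative_X] at h
  set γ : FormalArc := ⟨𝕥, 𝕥 * σ, by simp, hs⟩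
  have h1 : γ.ev a₁ + σ * γ.ev a₂ +
      (γ.ev b₁ + σ * γ.ev b₂) * (σ + 𝕥 * PowerSeries.derivative ℂ σ) = 0 := by
    refine mul_left_cancel₀ PowerSeries.X_ne_zero (b := (_ : 𝕆)) ?_
    linear_combination h
  have h2 := congrArg PowerSeries.constantCoeff h1
  simp [ha₁, hb₂, ha₂, hb₁] at h2
  have h3 : PowerSeries.constantCoeff σ * (ω.a.lin 1 + ω.b.lin 0) = 0 := by
    linear_combination h2
  have h4 := (mul_eq_zero.mp h3).resolve_right hres
  rw [show (1 : ℕ) = 0 + 1 from rfl, PowerSeries.coeff_succ_X_mul]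
  simpa using h4

theorem invariant_of_associated {ω : FormalOneForm} {f g : 𝕣} (hf : Irreducible f)
    (h : Associated f g) (hinv : ω.Invariant f) : ω.Invariant g := by
  have hγ := branchArc_parametrizes hf
  rw [invariant_iff_onArc hγ.nonConst hf ((hγ.ker _).mpr dvd_rfl)] at hinv
  rwa [invariant_iff_onArc hγ.nonConst (h.irreducible hf) ((hγ.ker _).mpr h.dvd)]

/-- A regular point with a non-vertical tangent. -/
theorem exists_tangent_arc_of_regular {ω : FormalOneForm}
    (hb : MvPowerSeries.constantCoeff ω.b ≠ 0) :
    ∃ (s : 𝕆) (hs : PowerSeries.constantCoeff s = 0), ω.onArc ⟨𝕥, s, by simp, hs⟩ = 0 := by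
  obtain ⟨s, hs, h⟩ := exists_tangent_arc (ω := ⟨𝕩 * ω.a, 𝕩 * ω.b⟩) (by simp) (by simp)
    (by rw [lin_one_eq]; simp) (by
      intro k
      rw [lin_one_eq, lin_zero_eq]
      simp only [FormalSeries.dx_mul, FormalSeries.dy_mul, FormalSeries.dx_X0, FormalSeries.dy_X0]
      simp [hb]
      exact_mod_cast Nat.succ_ne_zero k)
  refine ⟨s, hs, ?_⟩
  rw [onArc] at h ⊢
  refine mul_left_cancel₀ PowerSeries.X_ne_zero (b := (_ : 𝕆)) ?_
  simp only [map_mul, FormalArc.ev_X0] at h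
  linear_combination h

theorem onArc_swap (ω : FormalOneForm) (s : 𝕆) (hs : PowerSeries.constantCoeff s = 0) :
    (ω.linPull !![0, 1; 1, 0]).onArc ⟨𝕥, s, by simp, hs⟩ =
      ω.onArc ⟨s, 𝕥, hs, by simp⟩ := by
  rw [← onArc_linMap]
  congr 1
  apply FormalArc.ext
  · rw [linMap_x]; simp
  · rw [linMap_y]; simp

theorem exists_vertical_arc_of_regular {ω : FormalOneForm}
    (ha : MvPowerSeries.constantCoeff ω.a ≠ 0) :
    ∃ (s : 𝕆) (hs : PowerSeries.constantCoeff s = 0), ω.onArc ⟨s, 𝕥, hs, by simp⟩ = 0 := by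
  obtain ⟨s, hs, h⟩ := exists_tangent_arc_of_regular
    (ω := ω.linPull !![0, 1; 1, 0])
    (by rw [constantCoeff_linPull_b]; simpa using ha)
  rw [onArc_swap] at h
  exact ⟨s, hs, h⟩

theorem exists_separatrix_of_onArc {ω : FormalOneForm} {γ : FormalArc} (hγ : γ.NonConst)
    (h : ω.onArc γ = 0) : ∃ f, ω.IsSeparatrix f ∧ γ.ev f = 0 := by
  obtain ⟨f, hf, h0⟩ := γ.exists_irreducible
  exact ⟨f, ⟨hf, (invariant_iff_onArc hγ hf h0).mpr h⟩, h0⟩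

/-- There is a separatrix through every regular point. -/
theorem exists_separatrix_of_regular {ω : FormalOneForm} (h : ¬ ω.IsSingular) :
    ∃ f, ω.IsSeparatrix f := by
  rw [IsSingular, not_and_or] at h
  rcases h with h | h
  · obtain ⟨s, hs, h1⟩ := exists_vertical_arc_of_regular h
    obtain ⟨f, hf, _⟩ := exists_separatrix_of_onArc (Or.inr PowerSeries.X_ne_zero) h1
    exact ⟨f, hf⟩
  · obtain ⟨s, hs, h1⟩ := exists_tangent_arc_of_regular h
    obtain ⟨f, hf, _⟩ := exists_separatrix_of_onArc (Or.inl PowerSeries.X_ne_zero) h1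
    exact ⟨f, hf⟩

theorem exists_tangent_separatrix {ω : FormalOneForm}
    (ha : MvPowerSeries.constantCoeff ω.a ≠ 0) (hb : MvPowerSeries.constantCoeff ω.b = 0) :
    ∃ f, ω.IsSeparatrix f ∧ f.lin 1 = 0 := by
  obtain ⟨s, hs, h1⟩ := exists_vertical_arc_of_regular ha
  have hnc : FormalArc.NonConst ⟨s, 𝕥, hs, by simp⟩ := Or.inr PowerSeries.X_ne_zero
  obtain ⟨f, hf, h2⟩ := exists_separatrix_of_onArc hnc h1
  refine ⟨f, hf, ?_⟩
  have h3 := FormalArc.derivative_ev ⟨s, 𝕥, hs, by simp⟩ f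
  rw [h2, map_zero] at h3
  have h4 := congrArg PowerSeries.constantCoeff h1
  have h5 := congrArg PowerSeries.constantCoeff h3
  simp [onArc, hb, ha] at h4 h5
  rw [h4] at h5
  rw [lin_one_eq]
  simpa using h5.symm

theorem coeff_one_substOne {θ : 𝕆} (hθ : PowerSeries.constantCoeff θ = 0) {a : 𝕆}
    (ha : PowerSeries.constantCoeff a = 0) :
    PowerSeries.coeff 1 (substOne θ hθ a) = PowerSeries.coeff 1 a * PowerSeries.coeff 1 θ := by
  obtain ⟨b, rfl⟩ := constantCoeff_eq_zero_iff_X_dvd.mp ha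
  obtain ⟨c, rfl⟩ := constantCoeff_eq_zero_iff_X_dvd.mp hθ
  rw [map_mul, substOne_X, mul_assoc]
  have key : ∀ b : 𝕆, PowerSeries.coeff 1 (𝕥 * b) = PowerSeries.constantCoeff b := by
    intro b
    rw [show (1 : ℕ) = 0 + 1 from rfl, PowerSeries.coeff_succ_X_mul]
    simp
  rw [key, key, key, map_mul, constantCoeff_substOne, mul_comm]

theorem exists_linearNormalForm {ω : FormalOneForm} (h : ω.IsReducedSingularity)
    (hs : ¬ ω.IsSaddleNode) : ∃ (lam : ℂ) (M : Matrix (Fin 2) (Fin 2) ℂ), lam ≠ 0 ∧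
      (¬ ∃ r : ℚ, 0 < r ∧ lam = (r : ℂ)) ∧ M.det ≠ 0 ∧
      M.transpose * ω.linearPart * M = !![0, 1; -lam, 0] := by
  obtain ⟨hsing, h⟩ := h
  rcases h with ⟨lam, h1, M, hM, e⟩ | h
  · refine ⟨lam, M, ?_, h1, hM.ne_zero, e⟩
    rintro rfl
    refine hs ⟨hsing, M * !![0, 1; 1, 0], ?_, ?_⟩
    · rw [Matrix.det_mul]
      refine hM.mul ?_
      simp [Matrix.det_fin_two_of]
    · rw [Matrix.transpose_mul]
      have : (!![0, 1; 1, 0] : Matrix (Fin 2) (Fin 2) ℂ).transpose * M.transpose *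
          ω.linearPart * (M * !![0, 1; 1, 0]) =
          (!![0, 1; 1, 0] : Matrix (Fin 2) (Fin 2) ℂ).transpose *
            (M.transpose * ω.linearPart * M) * !![0, 1; 1, 0] := by
        simp only [Matrix.mul_assoc]
      rw [this, e]
      ext i j
      fin_cases i <;> fin_cases j <;> simp [Matrix.mul_apply, Fin.sum_univ_two]
  · exact absurd ⟨hsing, h⟩ hs

theorem det_linearPart_ne_zero {ω : FormalOneForm} (h : ω.IsReducedSingularity)
    (hs : ¬ ω.IsSaddleNode) : ω.a.lin 0 * ω.b.lin 1 - ω.a.lin 1 * ω.b.lin 0 ≠ 0 := by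
  obtain ⟨lam, M, h1, _, _, e⟩ := exists_linearNormalForm h hs
  intro h0
  have h2 := congrArg Matrix.det e
  rw [Matrix.det_mul, Matrix.det_mul, linearPart, Matrix.det_fin_two_of, h0,
    Matrix.det_fin_two_of] at h2
  simp at h2
  exact h1 h2.symm

/-- There are two separatrices through a reduced singularity that is not a saddle-node. -/
theorem exists_two_separatrices {ω : FormalOneForm} (h : ω.IsReducedSingularity)
    (hs : ¬ ω.IsSaddleNode) :
    ∃ f g, ω.IsSeparatrix f ∧ ω.IsSeparatrix g ∧ ¬ Associated f g := by
  obtain ⟨lam, M, hlam, hQ, hM, e⟩ := exists_linearNormalForm h hs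
  set ω₁ := ω.linPull M with hω₁
  have hlin : ω₁.linearPart = !![0, 1; -lam, 0] := by rw [hω₁, lin_linPull, e]
  have hlin' : (ω₁.linPull !![0, 1; 1, 0]).linearPart =
      !![0, -lam; 1, 0] := by
    rw [lin_linPull, hlin]
    ext i j
    fin_cases i <;> fin_cases j <;> simp [Matrix.mul_apply, Fin.sum_univ_two]
  have hc1 : MvPowerSeries.constantCoeff ω₁.a = 0 := by
    rw [hω₁, constantCoeff_linPull_a, h.1.1, h.1.2]; simp
  have hc2 : MvPowerSeries.constantCoeff ω₁.b = 0 := by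
    rw [hω₁, constantCoeff_linPull_b, h.1.1, h.1.2]; simp
  -- the second separatrix comes from the first one by exchanging the coordinates
  set ω₂ := ω₁.linPull !![0, 1; 1, 0] with hω₂
  have hc3 : MvPowerSeries.constantCoeff ω₂.a = 0 := by
    rw [hω₂, constantCoeff_linPull_a, hc1, hc2]; simp
  have hc4 : MvPowerSeries.constantCoeff ω₂.b = 0 := by
    rw [hω₂, constantCoeff_linPull_b, hc1, hc2]; simp
  have key : ∀ (ω : FormalOneForm) (p r : ℂ), ω.linearPart = !![0, p; r, 0] →
      ω.a.lin 0 = 0 ∧ ω.a.lin 1 = p ∧ ω.b.lin 0 = r ∧ ω.b.lin 1 = 0 := by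
    intro ω p r hl
    refine ⟨?_, ?_, ?_, ?_⟩
    · simpa [linearPart] using congrFun (congrFun hl 0) 0
    · simpa [linearPart] using congrFun (congrFun hl 0) 1
    · simpa [linearPart] using congrFun (congrFun hl 1) 0
    · simpa [linearPart] using congrFun (congrFun hl 1) 1
  obtain ⟨k1, k2, k3, k4⟩ := key _ _ _ hlin
  obtain ⟨l1, l2, l3, l4⟩ := key _ _ _ hlin'
  have hres1 : ∀ k : ℕ, ω₁.a.lin 1 + ω₁.b.lin 0 * (k + 1) ≠ 0 := by
    intro k h0
    rw [k2, k3] at h0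
    apply hQ
    have hk : (k : ℂ) + 1 ≠ 0 := by exact_mod_cast Nat.succ_ne_zero k
    refine ⟨1 / (k + 1), by positivity, ?_⟩
    push_cast
    field_simp
    linear_combination -h0
  have hres2 : ∀ k : ℕ, ω₂.a.lin 1 + ω₂.b.lin 0 * (k + 1) ≠ 0 := by
    intro k h0
    rw [l2, l3] at h0
    apply hQ
    refine ⟨k + 1, by positivity, ?_⟩
    push_cast
    linear_combination -h0
  obtain ⟨s₁, hs₁, e₁⟩ := exists_tangent_arc hc1 hc2 k4 hres1
  obtain ⟨s₂, hs₂, e₂⟩ := exists_tangent_arc hc3 hc4 l4 hres2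
  have c₁ := coeff_one_of_onArc hc1 hc2 k1 k4 (by simpa using hres1 0) e₁
  have c₂ := coeff_one_of_onArc hc3 hc4 l1 l4 (by simpa using hres2 0) e₂
  rw [hω₂, onArc_swap] at e₂
  set δ₁ : FormalArc := ⟨𝕥, s₁, by simp, hs₁⟩ with hδ₁
  set δ₂ : FormalArc := ⟨s₂, 𝕥, hs₂, by simp⟩ with hδ₂
  rw [hω₁, ← onArc_linMap] at e₁ e₂
  -- the tangents of the two arcs are the columns of `M`
  have x1 : PowerSeries.coeff 1 (δ₁.linMap M).x = M 0 0 := by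
    rw [linMap_x, map_add, PowerSeries.coeff_C_mul, PowerSeries.coeff_C_mul]; simp [hδ₁, c₁]
  have y1 : PowerSeries.coeff 1 (δ₁.linMap M).y = M 1 0 := by
    rw [linMap_y, map_add, PowerSeries.coeff_C_mul, PowerSeries.coeff_C_mul]; simp [hδ₁, c₁]
  have x2 : PowerSeries.coeff 1 (δ₂.linMap M).x = M 0 1 := by
    rw [linMap_x, map_add, PowerSeries.coeff_C_mul, PowerSeries.coeff_C_mul]; simp [hδ₂, c₂]
  have y2 : PowerSeries.coeff 1 (δ₂.linMap M).y = M 1 1 := by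
    rw [linMap_y, map_add, PowerSeries.coeff_C_mul, PowerSeries.coeff_C_mul]; simp [hδ₂, c₂]
  rw [Matrix.det_fin_two] at hM
  have n1 : (δ₁.linMap M).NonConst := by
    by_contra hc
    rw [FormalArc.NonConst, not_or, not_not, not_not] at hc
    rw [hc.1, map_zero] at x1
    rw [hc.2, map_zero] at y1
    exact hM (by rw [← x1, ← y1]; ring)
  have n2 : (δ₂.linMap M).NonConst := by
    by_contra hc
    rw [FormalArc.NonConst, not_or, not_not, not_not] at hc
    rw [hc.1, map_zero] at x2
    rw [hc.2, map_zero] at y2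
    exact hM (by rw [← x2, ← y2]; ring)
  obtain ⟨f, hf, f0⟩ := exists_separatrix_of_onArc n1 e₁
  obtain ⟨g, hg, g0⟩ := exists_separatrix_of_onArc n2 e₂
  refine ⟨f, g, hf, hg, fun hfg => ?_⟩
  -- otherwise both arcs would be reparametrizations of the same arc, with parallel tangents
  have hγ := branchArc_parametrizes hf.1
  obtain ⟨θ₁, hθ₁, r₁⟩ := hγ.exists_reparam n1 f0
  obtain ⟨θ₂, hθ₂, r₂⟩ := hγ.exists_reparam n2
    ((n2.ev_eq_zero_iff hg.1 g0 f).mpr hfg.symm.dvd)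
  rw [r₁, FormalArc.reparam_x, coeff_one_substOne _ (branchArc f).x_zero] at x1
  rw [r₁, FormalArc.reparam_y, coeff_one_substOne _ (branchArc f).y_zero] at y1
  rw [r₂, FormalArc.reparam_x, coeff_one_substOne _ (branchArc f).x_zero] at x2
  rw [r₂, FormalArc.reparam_y, coeff_one_substOne _ (branchArc f).y_zero] at y2
  exact hM (by rw [← x1, ← x2, ← y1, ← y2]; ring)

end FormalOneForm

/-! ### Strict transforms at infinitely near points -/

theorem strictTransformAt_ne_zero {f : 𝕣} (hf : f ≠ 0) (q : InfNearPoint) :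
    strictTransformAt f q ≠ 0 := by
  induction q with
  | nil => exact hf
  | cons d p ih => exact strictTransform_ne_zero ih d

theorem strictTransformAt_mul {f g : 𝕣} (hf : f ≠ 0) (hg : g ≠ 0) (q : InfNearPoint) :
    strictTransformAt (f * g) q = strictTransformAt f q * strictTransformAt g q := by
  induction q with
  | nil => rfl
  | cons d p ih =>
    rw [strictTransformAt, ih, strictTransform_mul (strictTransformAt_ne_zero hf p)
      (strictTransformAt_ne_zero hg p)]
    rfl

theorem isUnit_strictTransformAt {f : 𝕣} (hf : IsUnit f) (q : InfNearPoint) :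
    IsUnit (strictTransformAt f q) := by
  induction q with
  | nil => exact hf
  | cons d p ih => exact isUnit_strictTransform ih d

theorem strictTransformAt_associated {f g : 𝕣} (hf : f ≠ 0) (h : Associated f g)
    (q : InfNearPoint) : Associated (strictTransformAt f q) (strictTransformAt g q) := by
  induction q with
  | nil => exact h
  | cons d p ih => exact strictTransform_associated (strictTransformAt_ne_zero hf p) ih d

theorem not_isUnit_of_cons {f : 𝕣} {d : BlowUpDirection} {p : InfNearPoint}
    (h : ¬ IsUnit (strictTransformAt f (d :: p))) : ¬ IsUnit (strictTransformAt f p) :=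
  fun hu => h (isUnit_strictTransform hu d)

theorem strictTransformAt_irreducible {f : 𝕣} (hf : Irreducible f) {q : InfNearPoint}
    (h : ¬ IsUnit (strictTransformAt f q)) : Irreducible (strictTransformAt f q) := by
  induction q with
  | nil => exact hf
  | cons d p ih => exact strictTransform_irreducible (ih (not_isUnit_of_cons h)) h

theorem invariant_strictTransformAt_iff {ω : FormalOneForm} (hω : IsRelPrime ω.a ω.b) {f : 𝕣}
    (hf : Irreducible f) {q : InfNearPoint} (h : ¬ IsUnit (strictTransformAt f q)) :
    (ω.transformAt q).Invariant (strictTransformAt f q) ↔ ω.Invariant f := by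
  induction q with
  | nil => exact Iff.rfl
  | cons d p ih =>
    have h1 := not_isUnit_of_cons h
    rw [← ih h1]
    exact FormalOneForm.invariant_strictTransform_iff
      (FormalOneForm.ne_zero_or (FormalOneForm.isRelPrime_transformAt hω p))
      (strictTransformAt_irreducible hf h1) h

theorem resX_strictTransformAt_ne_zero {f : 𝕣} (hf : f ≠ 0) {q : InfNearPoint} (hq : q ≠ []) :
    resX (strictTransformAt f q) ≠ 0 := by
  cases q with
  | nil => exact absurd rfl hq
  | cons d p =>
    rw [Ne, ← X0_dvd_iff]
    exact not_X0_dvd_strictTransform (strictTransformAt_ne_zero hf p) d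

theorem resY_strictTransformAt_ne_zero {f : 𝕣} (hf : f ≠ 0) {q : InfNearPoint}
    (hq : axisY q ≠ none) : resY (strictTransformAt f q) ≠ 0 := by
  induction q with
  | nil => exact absurd rfl hq
  | cons d p ih =>
    have h0 := strictTransformAt_ne_zero hf p
    cases d with
    | slope c =>
      by_cases hc : c = 0
      · subst hc
        have h1 := ih (by simpa [axisY] using hq)
        rw [FormalOneForm.resY_eq_slope_zero h0] at h1
        exact right_ne_zero_of_mul h1
      · simp [axisY, hc] at hq
    | vertical =>
      have hp : p ≠ [] := by rintro rfl; simp [axisY, axisX] at hq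
      have h1 := resX_strictTransformAt_ne_zero hf hp
      rw [FormalOneForm.resX_eq_vertical h0] at h1
      exact right_ne_zero_of_mul h1

theorem not_associated_X0 {f : 𝕣} (hf : f ≠ 0) {q : InfNearPoint} (hq : q ≠ []) :
    ¬ Associated (strictTransformAt f q) 𝕩 := fun h =>
  resX_strictTransformAt_ne_zero hf hq ((X0_dvd_iff _).mp h.symm.dvd)

theorem not_associated_X1 {f : 𝕣} (hf : f ≠ 0) {q : InfNearPoint} (hq : axisY q ≠ none) :
    ¬ Associated (strictTransformAt f q) 𝕪 := fun h =>
  resY_strictTransformAt_ne_zero hf hq ((X1_dvd_iff _).mp h.symm.dvd)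

theorem strictTransform_slope_X0 (c : ℂ) : strictTransform (.slope c) 𝕩 = 1 :=
  strictTransform_eq (m := 1) (by simp) fun h => prime_X0.not_isUnit (isUnit_of_dvd_one h)

theorem strictTransform_vertical_X0 : strictTransform .vertical 𝕩 = 𝕪 :=
  strictTransform_eq (m := 1) (by simp) fun h => by
    rw [X0_dvd_iff, resX_X1] at h; exact PowerSeries.X_ne_zero h

theorem strictTransform_slope_X1 (c : ℂ) :
    strictTransform (.slope c) 𝕪 = 𝕪 + MvPowerSeries.C c :=
  strictTransform_eq (m := 1) (by simp) fun h => by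
    rw [X0_dvd_iff, map_add, resX_X1, resX_C] at h
    have := congrArg (PowerSeries.coeff 1) h
    simp at this

theorem strictTransform_vertical_X1 : strictTransform .vertical 𝕪 = 1 :=
  strictTransform_eq (m := 1) (by simp) fun h => prime_X0.not_isUnit (isUnit_of_dvd_one h)

/-- Every branch at an infinitely near point that is not contained in the exceptional divisor is
the strict transform of a branch at the origin. -/
theorem exists_strictTransformAt_associated {g : 𝕣} (hg : Irreducible g) (q : InfNearPoint)
    (hX : q ≠ [] → ¬ Associated g 𝕩) (hY : axisY q ≠ none → ¬ Associated g 𝕪) :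
    ∃ f, Irreducible f ∧ Associated (strictTransformAt f q) g := by
  induction q generalizing g with
  | nil => exact ⟨g, hg, Associated.refl _⟩
  | cons d p ih =>
    obtain ⟨f', hf', ha⟩ := exists_strictTransform_associated hg (hX (by simp)) d
    obtain ⟨f, hf, hf2⟩ := ih hf' (by
      intro hp h
      have h1 := (strictTransform_associated hf'.ne_zero h d).symm.trans ha
      cases d with
      | slope c =>
        rw [strictTransform_slope_X0] at h1
        exact hg.not_isUnit (h1.isUnit isUnit_one)
      | vertical =>
        rw [strictTransform_vertical_X0] at h1
        refine hY ?_ h1.symm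
        cases p with
        | nil => exact absurd rfl hp
        | cons e r => simp [axisY, axisX]) (by
      intro hp h
      have h1 := (strictTransform_associated hf'.ne_zero h d).symm.trans ha
      cases d with
      | slope c =>
        rw [strictTransform_slope_X1] at h1
        by_cases hc : c = 0
        · subst hc
          rw [map_zero, add_zero] at h1
          exact hY (by simpa [axisY] using hp) h1.symm
        · refine hg.not_isUnit (h1.isUnit ?_)
          rw [series_isUnit_iff]
          simpa using hc
      | vertical =>
        rw [strictTransform_vertical_X1] at h1
        exact hg.not_isUnit (h1.isUnit isUnit_one))
    exact ⟨f, hf, (strictTransform_associated (strictTransformAt_ne_zero hf.ne_zero p) hf2 d).trans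
      ha⟩

theorem associated_of_strictTransformAt {f g : 𝕣} (hf : Irreducible f) (hg : Irreducible g)
    {q : InfNearPoint} (hu : ¬ IsUnit (strictTransformAt f q))
    (h : Associated (strictTransformAt f q) (strictTransformAt g q)) : Associated f g := by
  induction q with
  | nil => exact h
  | cons d p ih =>
    have h1 := not_isUnit_of_cons hu
    have h2 : ¬ IsUnit (strictTransformAt g (d :: p)) := fun hc => hu (h.symm.isUnit hc)
    exact ih h1 (associated_of_strictTransform (strictTransformAt_irreducible hf h1)
      (strictTransformAt_irreducible hg (not_isUnit_of_cons h2)) hu h)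

/-- A branch passes through one infinitely near point of each level. -/
theorem eq_of_length_eq {f : 𝕣} (hf : Irreducible f) {q r : InfNearPoint}
    (hq : ¬ IsUnit (strictTransformAt f q)) (hr : ¬ IsUnit (strictTransformAt f r))
    (h : q.length = r.length) : q = r := by
  induction q generalizing r with
  | nil => exact (List.length_eq_zero_iff.mp h.symm).symm
  | cons d p ih =>
    cases r with
    | nil => simp at h
    | cons e r =>
      have hp := not_isUnit_of_cons hq
      obtain rfl := ih hp (not_isUnit_of_cons hr) (by simpa using h)
      obtain ⟨d', _, _, _, _, h1⟩ :=
        (branchArc_parametrizes (strictTransformAt_irreducible hf hp)).exists_lift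
      have e1 : d = d' := by by_contra hc; exact hq (h1 d hc)
      have e2 : e = d' := by by_contra hc; exact hr (h1 e hc)
      rw [e1, e2]

theorem not_isUnit_of_suffix {f : 𝕣} {q r : InfNearPoint} (h : r <:+ q)
    (hq : ¬ IsUnit (strictTransformAt f q)) : ¬ IsUnit (strictTransformAt f r) := by
  induction q with
  | nil => rw [List.suffix_nil] at h; exact h ▸ hq
  | cons d p ih =>
    rw [List.suffix_cons_iff] at h
    rcases h with rfl | h
    · exact hq
    · exact ih h (not_isUnit_of_cons hq)

theorem IsBlowUpSequence.mem_of_suffix {T : Finset InfNearPoint} (hT : IsBlowUpSequence T)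
    {q r : InfNearPoint} (h : r <:+ q) (hq : q ∈ T) : r ∈ T := by
  induction q with
  | nil => rw [List.suffix_nil] at h; exact h ▸ hq
  | cons d p ih =>
    rw [List.suffix_cons_iff] at h
    rcases h with rfl | h
    · exact hq
    · exact ih h (hT d p hq)

/-- A branch passes through at most one point of the final surface. -/
theorem eq_of_terminal {T : Finset InfNearPoint} (hT : IsBlowUpSequence T) {f : 𝕣}
    (hf : Irreducible f) {q r : InfNearPoint} (tq : IsTerminalPoint T q) (tr : IsTerminalPoint T r)
    (hq : ¬ IsUnit (strictTransformAt f q)) (hr : ¬ IsUnit (strictTransformAt f r)) : q = r := by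
  have key : ∀ {q r : InfNearPoint}, IsTerminalPoint T q → IsTerminalPoint T r →
      ¬ IsUnit (strictTransformAt f q) → ¬ IsUnit (strictTransformAt f r) →
      ¬ q.length < r.length := by
    intro q r tq tr hq hr hlt
    cases r with
    | nil => simp at hlt
    | cons d p =>
      -- the ancestor of `r` on the level of `q` is a center, and the branch passes through it
      have hs : p.drop (p.length - q.length) <:+ p := List.drop_suffix _ _
      have h1 := not_isUnit_of_suffix hs (not_isUnit_of_cons hr)
      have h2 : q = p.drop (p.length - q.length) := by
        refine eq_of_length_eq hf hq h1 ?_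
        rw [List.length_drop]
        rw [List.length_cons] at hlt
        omega
      exact tq.1 (h2 ▸ hT.mem_of_suffix hs (tr.2 d p rfl))
  refine eq_of_length_eq hf hq hr ?_
  have h1 := key tq tr hq hr
  have h2 := key tr tq hr hq
  omega

theorem IsSeparatrixOffDivisor.of_separatrix {ω : FormalOneForm} (hω : IsRelPrime ω.a ω.b)
    {f : 𝕣} (hf : ω.IsSeparatrix f) {q : InfNearPoint} (hq : ¬ IsUnit (strictTransformAt f q)) :
    IsSeparatrixOffDivisor ω q (strictTransformAt f q) :=
  ⟨⟨strictTransformAt_irreducible hf.1 hq, (invariant_strictTransformAt_iff hω hf.1 hq).mpr hf.2⟩,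
    not_associated_X0 hf.1.ne_zero, not_associated_X1 hf.1.ne_zero⟩

theorem IsSeparatrixOffDivisor.exists_separatrix {ω : FormalOneForm} (hω : IsRelPrime ω.a ω.b)
    {g : 𝕣} {q : InfNearPoint} (hg : IsSeparatrixOffDivisor ω q g) :
    ∃ f, ω.IsSeparatrix f ∧ ¬ IsUnit (strictTransformAt f q) ∧
      Associated (strictTransformAt f q) g := by
  obtain ⟨f, hf, h⟩ := exists_strictTransformAt_associated hg.1.1 q hg.2.1 hg.2.2
  have hu : ¬ IsUnit (strictTransformAt f q) := fun hu => hg.1.1.not_isUnit (h.isUnit hu)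
  refine ⟨f, ⟨hf, ?_⟩, hu, h⟩
  rw [← invariant_strictTransformAt_iff hω hf hu]
  exact FormalOneForm.invariant_of_associated hg.1.1 h.symm hg.1.2

theorem isUnit_strictTransformAt_of_factors {u : 𝕣} (hu : u ≠ 0) {q : InfNearPoint}
    (h : ∀ f, Irreducible f → f ∣ u → IsUnit (strictTransformAt f q)) :
    IsUnit (strictTransformAt u q) := by
  induction u using WfDvdMonoid.induction_on_irreducible with
  | zero => exact absurd rfl hu
  | unit u hu' => exact isUnit_strictTransformAt hu' q
  | mul u f hu0 hf ih =>
    rw [strictTransformAt_mul hf.ne_zero hu0]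
    exact (h f hf (dvd_mul_right _ _)).mul
      (ih hu0 fun f' hf' hd => h f' hf' (hd.mul_left f))

/-! ### The components of the exceptional divisor -/

theorem exists_axisX_of_axisY {q r : InfNearPoint} (h : axisY q = some r) :
    ∃ d p, q = d :: p ∧ r <:+ p ∧ r.length < p.length := by
  induction q with
  | nil => simp [axisY] at h
  | cons d p ih =>
    refine ⟨d, p, rfl, ?_⟩
    cases d with
    | slope c =>
      by_cases hc : c = 0
      · obtain ⟨e, p', rfl, h1, h2⟩ := ih (by simpa [axisY, hc] using h)
        exact ⟨h1.trans (List.suffix_cons _ _), by simp; omega⟩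
      · simp [axisY, hc] at h
    | vertical =>
      cases p with
      | nil => simp [axisY, axisX] at h
      | cons e p' =>
        simp [axisY, axisX] at h
        subst h
        exact ⟨List.suffix_cons _ _, by simp⟩

theorem eq_of_axes {d e : BlowUpDirection} {p r : InfNearPoint} (h : axisY (d :: p) = some r)
    (h' : axisY (e :: p) = some r) : d = e := by
  have mixed : ∀ {p r : InfNearPoint}, axisY p = some r → axisX p = some r → False := by
    intro p r h h'
    obtain ⟨d, p', rfl, _, h1⟩ := exists_axisX_of_axisY h
    simp [axisX] at h'
    subst h'
    omega
  cases d with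
  | slope c =>
    have hc : c = 0 := by by_contra hc; simp [axisY, hc] at h
    cases e with
    | slope c' =>
      have hc' : c' = 0 := by by_contra hc; simp [axisY, hc] at h'
      rw [hc, hc']
    | vertical => exact (mixed (by simpa [axisY, hc] using h) (by simpa [axisY] using h')).elim
  | vertical =>
    cases e with
    | slope c' =>
      have hc' : c' = 0 := by by_contra hc; simp [axisY, hc] at h'
      exact (mixed (by simpa [axisY, hc'] using h') (by simpa [axisY] using h)).elim
    | vertical => rfl

/-- The points of the component created by the blow-up of `p` that are infinitely near to its
point of direction `d`. -/
def chainPoint (d : BlowUpDirection) (p : InfNearPoint) : ℕ → InfNearPoint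
  | 0 => d :: p
  | 1 => .vertical :: d :: p
  | k + 2 => .slope 0 :: chainPoint d p (k + 1)

theorem axisY_chainPoint (d : BlowUpDirection) (p : InfNearPoint) (k : ℕ) :
    axisY (chainPoint d p (k + 1)) = some p := by
  induction k with
  | zero => rfl
  | succ k ih => simpa [chainPoint, axisY] using ih

theorem chainPoint_succ (d : BlowUpDirection) (p : InfNearPoint) (k : ℕ) :
    ∃ e, chainPoint d p (k + 1) = e :: chainPoint d p k := by
  cases k with
  | zero => exact ⟨_, rfl⟩
  | succ k => exact ⟨_, rfl⟩

theorem suffix_chainPoint (d : BlowUpDirection) (p : InfNearPoint) (k : ℕ) :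
    d :: p <:+ chainPoint d p k := by
  induction k with
  | zero => exact List.suffix_rfl
  | succ k ih =>
    obtain ⟨e, he⟩ := chainPoint_succ d p k
    rw [he]
    exact ih.trans (List.suffix_cons _ _)

theorem length_chainPoint (d : BlowUpDirection) (p : InfNearPoint) (k : ℕ) :
    (chainPoint d p k).length = p.length + 1 + k := by
  induction k with
  | zero => rfl
  | succ k ih =>
    obtain ⟨e, he⟩ := chainPoint_succ d p k
    rw [he, List.length_cons, ih]
    omega

theorem exists_eq_chainPoint {q p : InfNearPoint} (h : axisY q = some p) :
    ∃ d k, q = chainPoint d p (k + 1) := by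
  induction q with
  | nil => simp [axisY] at h
  | cons e r ih =>
    cases e with
    | slope c =>
      by_cases hc : c = 0
      · subst hc
        obtain ⟨d, k, rfl⟩ := ih (by simpa [axisY] using h)
        exact ⟨d, k + 1, rfl⟩
      · simp [axisY, hc] at h
    | vertical =>
      cases r with
      | nil => simp [axisY, axisX] at h
      | cons d p' =>
        simp [axisY, axisX] at h
        subst h
        exact ⟨d, 0, rfl⟩

theorem exists_chainPoint_not_mem (T : Finset InfNearPoint) (d : BlowUpDirection)
    (p : InfNearPoint) : ∃ k, chainPoint d p k ∉ T := by
  by_contra hc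
  push Not at hc
  refine Set.infinite_of_injective_forall_mem (f := chainPoint d p) ?_ hc T.finite_toSet
  intro k l hkl
  have := congrArg List.length hkl
  rw [length_chainPoint, length_chainPoint] at this
  omega

/-- The directions at which the component created by the blow-up of `p` meets another
component. -/
def cornerDirections (T : Finset InfNearPoint) (p : InfNearPoint) : Set BlowUpDirection :=
  {d | d :: p ∈ T ∨ axisY (d :: p) ≠ none}

theorem finite_cornerDirections (T : Finset InfNearPoint) (p : InfNearPoint) :
    (cornerDirections T p).Finite := by
  have h1 : {d | d :: p ∈ T}.Finite :=
    Set.Finite.preimage (f := fun d => d :: p) (fun a _ b _ h => (List.cons.inj h).1) T.finite_toSet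
  have h2 : {d | axisY (d :: p) ≠ none}.Finite := by
    refine Set.Finite.subset (Set.toFinite {.slope 0, .vertical}) ?_
    intro d hd
    cases d with
    | slope c =>
      by_cases hc : c = 0
      · simp [hc]
      · simp [axisY, hc] at hd
    | vertical => simp
  exact h1.union h2

/-- The valence counts the directions of the corners: two components meet at most once, and the
corners over one direction are resolved to a single corner. -/
theorem valence_eq {T : Finset InfNearPoint} (hT : IsBlowUpSequence T) {p : InfNearPoint}
    (hp : p ∈ T) : valence T p = (cornerDirections T p).ncard := by
  classical
  -- the corners on the component `p`, and the second component through such a corner; of the two,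
  -- the component with the longer name is `x = 0`
  let Q : Set InfNearPoint := {q | IsTerminalPoint T q ∧ OnComponent q p ∧ axisY q ≠ none}
  let other : InfNearPoint → InfNearPoint := fun q =>
    if axisX q = some p then (axisY q).getD [] else q.tail
  -- the point over the direction `d` at which the final surface meets the component `p`
  let r : BlowUpDirection → InfNearPoint := fun d =>
    chainPoint d p (Nat.find (exists_chainPoint_not_mem T d p))
  have hother : ∀ q ∈ Q, (axisX q = some p ∧ axisY q = some (other q) ∧
      (other q).length < p.length) ∨
      (axisX q = some (other q) ∧ axisY q = some p ∧ p.length < (other q).length) := by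
    rintro q ⟨tq, h | h, hY⟩
    · left
      obtain ⟨s, hs⟩ := Option.ne_none_iff_exists'.mp hY
      have : other q = s := by simp only [other, if_pos h, hs, Option.getD_some]
      rw [this]
      obtain ⟨d, p', rfl, _, h1⟩ := exists_axisX_of_axisY hs
      simp [axisX] at h
      subst h
      exact ⟨rfl, hs, h1⟩
    · right
      obtain ⟨d, p', rfl, _, h1⟩ := exists_axisX_of_axisY h
      have : axisX (d :: p') ≠ some p := by
        intro h2
        simp [axisX] at h2
        subst h2
        omega
      have : other (d :: p') = p' := by simp only [other, if_neg this, List.tail_cons]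
      rw [this]
      exact ⟨rfl, h, h1⟩
  have e1 : {p' : InfNearPoint | p' ∈ T ∧ p' ≠ p ∧
      ∃ q, IsTerminalPoint T q ∧ OnComponent q p ∧ OnComponent q p'} = other '' Q := by
    ext p'
    constructor
    · rintro ⟨hp', hne, q, tq, h1, h2⟩
      have hY : axisY q ≠ none := by
        intro h0
        rcases h1 with h1 | h1
        · rcases h2 with h2 | h2
          · rw [h1] at h2; exact hne (Option.some.inj h2).symm
          · rw [h0] at h2; cases h2
        · rw [h0] at h1; cases h1
      have hq : q ∈ Q := ⟨tq, h1, hY⟩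
      refine ⟨q, hq, ?_⟩
      rcases hother q hq with ⟨h3, h4, _⟩ | ⟨h3, h4, _⟩
      · rcases h2 with h2 | h2
        · rw [h3] at h2; exact absurd (Option.some.inj h2).symm hne
        · rw [h4] at h2; exact Option.some.inj h2
      · rcases h2 with h2 | h2
        · rw [h3] at h2; exact Option.some.inj h2
        · rw [h4] at h2; exact absurd (Option.some.inj h2).symm hne
    · rintro ⟨q, hq, rfl⟩
      have hq' := hq
      obtain ⟨tq, h1, hY⟩ := hq
      rcases hother q hq' with ⟨h3, h4, h5⟩ | ⟨h3, h4, h5⟩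
      · refine ⟨?_, ?_, q, tq, h1, Or.inr h4⟩
        · obtain ⟨d, p', rfl, h6, _⟩ := exists_axisX_of_axisY h4
          exact hT.mem_of_suffix h6 (tq.2 d p' rfl)
        · intro h; rw [h] at h5; omega
      · refine ⟨?_, ?_, q, tq, h1, Or.inl h3⟩
        · cases q with
          | nil => simp [axisX] at h3
          | cons d p' =>
            simp only [axisX, Option.some.injEq] at h3
            rw [← h3]
            exact tq.2 d p' rfl
        · intro h; rw [h] at h5; omega
  have inj1 : Set.InjOn other Q := by
    intro q hq q' hq' h
    have cons_eq : ∀ {q q' : InfNearPoint} {s t : InfNearPoint}, axisX q = some s →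
        axisX q' = some s → axisY q = some t → axisY q' = some t → q = q' := by
      intro q q' s t a1 a2 a3 a4
      cases q with
      | nil => simp [axisX] at a1
      | cons d p₁ =>
        cases q' with
        | nil => simp [axisX] at a2
        | cons e p₂ =>
          simp [axisX] at a1 a2
          subst a1; subst a2
          rw [eq_of_axes a3 a4]
    rcases hother q hq with ⟨h3, h4, h5⟩ | ⟨h3, h4, h5⟩ <;>
      rcases hother q' hq' with ⟨h6, h7, h8⟩ | ⟨h6, h7, h8⟩
    · exact cons_eq h3 h6 h4 (h ▸ h7)
    · rw [h] at h5; omega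
    · rw [h] at h5; omega
    · exact cons_eq h3 (h ▸ h6) h4 h7
  have hmemT : ∀ d k, (∀ j < k, chainPoint d p j ∈ T) → chainPoint d p k ∉ T →
      IsTerminalPoint T (chainPoint d p k) := by
    intro d k hj hk
    refine ⟨hk, ?_⟩
    cases k with
    | zero =>
      intro d' p' h
      obtain ⟨rfl, rfl⟩ := List.cons.inj h
      exact hp
    | succ k =>
      intro d' p' h
      obtain ⟨e, he⟩ := chainPoint_succ d p k
      rw [he] at h
      rw [← (List.cons.inj h).2]
      exact hj k (Nat.lt_succ_self k)
  have e2 : Q = r '' cornerDirections T p := by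
    ext q
    constructor
    · rintro ⟨tq, h | h, hY⟩
      · cases q with
        | nil => simp [axisX] at h
        | cons d p' =>
          simp [axisX] at h
          subst h
          refine ⟨d, Or.inr hY, ?_⟩
          have : Nat.find (exists_chainPoint_not_mem T d p') = 0 := by
            rw [Nat.find_eq_zero]; exact tq.1
          simp only [r, this]
          rfl
      · obtain ⟨d, k, rfl⟩ := exists_eq_chainPoint h
        obtain ⟨e, he⟩ := chainPoint_succ d p k
        have hk : chainPoint d p k ∈ T := tq.2 e _ he
        have hj : ∀ j ≤ k, chainPoint d p j ∈ T := by
          intro j hj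
          refine Nat.decreasingInduction' (P := fun j => chainPoint d p j ∈ T) ?_ hj hk
          intro j _ _ h1
          obtain ⟨e, he⟩ := chainPoint_succ d p j
          rw [he] at h1
          exact hT e _ h1
        refine ⟨d, Or.inl (hj 0 (Nat.zero_le _)), ?_⟩
        have : Nat.find (exists_chainPoint_not_mem T d p) = k + 1 := by
          rw [Nat.find_eq_iff]
          refine ⟨tq.1, fun j hjk => ?_⟩
          rw [not_not]
          exact hj j (by omega)
        simp only [r, this]
    · rintro ⟨d, hd, rfl⟩
      have hk := Nat.find_spec (exists_chainPoint_not_mem T d p)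
      have hj : ∀ j < Nat.find (exists_chainPoint_not_mem T d p), chainPoint d p j ∈ T := by
        intro j hj
        have := Nat.find_min (exists_chainPoint_not_mem T d p) hj
        rwa [not_not] at this
      refine ⟨hmemT d _ hj hk, ?_⟩
      simp only [r]
      cases hcase : Nat.find (exists_chainPoint_not_mem T d p) with
      | zero =>
        rw [hcase] at hk
        exact ⟨Or.inl rfl, hd.resolve_left hk⟩
      | succ k =>
        exact ⟨Or.inr (axisY_chainPoint d p k), by rw [axisY_chainPoint]; simp⟩
  have inj2 : Set.InjOn r (cornerDirections T p) := by
    intro d _ e _ h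
    have h1 : d :: p <:+ r d := suffix_chainPoint d p _
    have h2 : e :: p <:+ r d := by rw [h]; exact suffix_chainPoint e p _
    have h3 := (List.suffix_of_suffix_length_le h1 h2 (by simp)).eq_of_length (by simp)
    exact (List.cons.inj h3).1
  rw [valence, e1, Set.InjOn.ncard_image inj1, e2, Set.InjOn.ncard_image inj2]

/-! ### Balanced equations over a reduction without saddle-nodes -/

/-- A balanced equation, relative to a reduction of singularities without saddle-nodes. -/
structure IsBalancedReduction (ω : FormalOneForm) (T : Finset InfNearPoint)
    (F : FormalMeroFunction) : Prop where
  relPrime : IsRelPrime ω.a ω.b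
  sequence : IsBlowUpSequence T
  reduced : ∀ q, IsTerminalPoint T q → IsReducedAt ω q
  not_saddleNode : ∀ q, IsTerminalPoint T q → ¬ (ω.transformAt q).IsSaddleNode
  balanced : IsBalancedFor ω T F

/-- The weight of a component of the exceptional divisor: `1` if it is invariant, `0` if it is
dicritical (or absent). -/
noncomputable def invWeight (ω : FormalOneForm) : Option InfNearPoint → ℤ
  | none => 0
  | some p => open Classical in if (ω.transformAt p).Dicritical then 0 else 1

theorem invWeight_none (ω : FormalOneForm) : invWeight ω none = 0 := rfl

theorem invWeight_of_dicritical {ω : FormalOneForm} {p : InfNearPoint}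
    (h : (ω.transformAt p).Dicritical) : invWeight ω (some p) = 0 := by
  rw [invWeight, if_pos h]

theorem invWeight_of_not_dicritical {ω : FormalOneForm} {p : InfNearPoint}
    (h : ¬ (ω.transformAt p).Dicritical) : invWeight ω (some p) = 1 := by
  rw [invWeight, if_neg h]

theorem expo_eq (ω : FormalOneForm) (p : InfNearPoint) :
    ((ω.transformAt p).expo : ℤ) = (ω.transformAt p).nu + 1 - invWeight ω (some p) := by
  by_cases h : (ω.transformAt p).Dicritical
  · rw [invWeight_of_dicritical h, FormalOneForm.expo, if_pos h]; push_cast; ring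
  · rw [invWeight_of_not_dicritical h, FormalOneForm.expo, if_neg h]; ring

/-- The multiplicity of the divisor of `F` at an infinitely near point. -/
noncomputable def multAt (F : FormalMeroFunction) (q : InfNearPoint) : ℤ :=
  mult (strictTransformAt F.num q) - mult (strictTransformAt F.den q)

/-- The intersection number of the divisor of `F` with the axis `x = 0`. -/
noncomputable def ordXAt (F : FormalMeroFunction) (q : InfNearPoint) : ℤ :=
  ordX (strictTransformAt F.num q) - ordX (strictTransformAt F.den q)

/-- The intersection number of the divisor of `F` with the axis `y = 0`. -/
noncomputable def ordYAt (F : FormalMeroFunction) (q : InfNearPoint) : ℤ :=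
  ordY (strictTransformAt F.num q) - ordY (strictTransformAt F.den q)

/-- The order of the foliation `a dx + b dy` along the component `x = 0`: the order of vanishing of
`a` if the component is invariant, and the tangency order, that of `b`, if it is not. -/
noncomputable def indexX (ω : FormalOneForm) (q : InfNearPoint) : ℤ :=
  if invWeight ω (axisX q) = 0 then ordX (ω.transformAt q).b else ordX (ω.transformAt q).a

/-- The order of the foliation `a dx + b dy` along the component `y = 0`: the order of vanishing of
`b` if the component is invariant, and the tangency order, that of `a`, if it is not. It is used
only at corners. -/
noncomputable def indexY (ω : FormalOneForm) (q : InfNearPoint) : ℤ :=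
  if invWeight ω (axisY q) = 0 then ordY (ω.transformAt q).a else ordY (ω.transformAt q).b

theorem ordX_eq_vertical {f : 𝕣} (hf : resX f ≠ 0) :
    ordX f = mult f + ordY (strictTransform .vertical f) := by
  have h0 : f ≠ 0 := by rintro rfl; exact hf (map_zero _)
  have h1 := FormalOneForm.resX_eq_vertical h0
  rw [h1] at hf
  rw [ordX, h1, ordN_mul (left_ne_zero_of_mul hf) (right_ne_zero_of_mul hf),
    ordN_pow PowerSeries.X_ne_zero, ordN_X, mul_one]
  rfl

theorem ordY_eq_slope_zero {f : 𝕣} (hf : resY f ≠ 0) :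
    ordY f = mult f + ordY (strictTransform (.slope 0) f) := by
  have h0 : f ≠ 0 := by rintro rfl; exact hf (map_zero _)
  have h1 := FormalOneForm.resY_eq_slope_zero h0
  rw [h1] at hf
  rw [ordY, h1, ordN_mul (left_ne_zero_of_mul hf) (right_ne_zero_of_mul hf),
    ordN_pow PowerSeries.X_ne_zero, ordN_X, mul_one]
  rfl

theorem ordXAt_eq (F : FormalMeroFunction) {q : InfNearPoint} (hq : q ≠ []) :
    ordXAt F q = multAt F q + ordYAt F (.vertical :: q) := by
  rw [ordXAt, ordX_eq_vertical (resX_strictTransformAt_ne_zero F.num_ne_zero hq),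
    ordX_eq_vertical (resX_strictTransformAt_ne_zero F.den_ne_zero hq), multAt, ordYAt]
  simp only [strictTransformAt]
  push_cast
  ring

theorem ordYAt_eq (F : FormalMeroFunction) {q : InfNearPoint} (hq : axisY q ≠ none) :
    ordYAt F q = multAt F q + ordYAt F (.slope 0 :: q) := by
  rw [ordYAt, ordY_eq_slope_zero (resY_strictTransformAt_ne_zero F.num_ne_zero hq),
    ordY_eq_slope_zero (resY_strictTransformAt_ne_zero F.den_ne_zero hq), multAt, ordYAt]
  simp only [strictTransformAt]
  push_cast
  ring

section axes

variable {ω : FormalOneForm} (hω : IsRelPrime ω.a ω.b)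
include hω

theorem axisX_invariant {d : BlowUpDirection} {p : InfNearPoint} :
    (¬ (ω.transformAt p).Dicritical →
      resX (ω.transformAt (d :: p)).b = 0 ∧ resX (ω.transformAt (d :: p)).a ≠ 0) ∧
    ((ω.transformAt p).Dicritical → resX (ω.transformAt (d :: p)).b ≠ 0) := by
  have h0 := FormalOneForm.ne_zero_or (FormalOneForm.isRelPrime_transformAt hω p)
  constructor
  · intro h
    obtain ⟨_, _, h1, h2⟩ := (FormalOneForm.blowUp_of_not_dicritical h0 h).1 d
    exact ⟨(X0_dvd_iff _).mp h1, fun h3 => h2 ((X0_dvd_iff _).mpr h3)⟩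
  · intro h
    obtain ⟨_, _, h1⟩ := (FormalOneForm.blowUp_of_dicritical h0 h).1 d
    exact fun h3 => h1 ((X0_dvd_iff _).mpr h3)

/-- The equation `y = 0` of an older component is transported to the point `q` by the blow-ups along
that component, which keep it invariant or not invariant. -/
theorem axisY_invariant {q p : InfNearPoint} (hq : axisY q = some p) :
    (¬ (ω.transformAt p).Dicritical →
      resY (ω.transformAt q).a = 0 ∧ resY (ω.transformAt q).b ≠ 0) ∧
    ((ω.transformAt p).Dicritical → resY (ω.transformAt q).a ≠ 0) := by
  induction q with
  | nil => simp [axisY] at hq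
  | cons d r ih =>
    have h0 := FormalOneForm.ne_zero_or (FormalOneForm.isRelPrime_transformAt hω r)
    have ht : ∀ n : ℕ, (𝕥 ^ n) ≠ 0 := fun n => pow_ne_zero _ PowerSeries.X_ne_zero
    cases d with
    | slope c =>
      have hc : c = 0 := by by_contra hc; simp [axisY, hc] at hq
      subst hc
      obtain ⟨h1, h2⟩ := ih (by simpa [axisY] using hq)
      obtain ⟨e1, e2⟩ := FormalOneForm.resY_blowUp_slope_zero h0
      constructor
      · intro h
        obtain ⟨h3, h4⟩ := h1 h
        rw [h3] at e1
        refine ⟨(mul_eq_zero.mp e1.symm).resolve_left (ht _), fun h5 => ?_⟩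
        change resY (FormalOneForm.blowUp _ _).b = 0 at h5
        rw [h5, mul_zero] at e2
        exact h4 ((mul_eq_zero.mp e2).resolve_left PowerSeries.X_ne_zero)
      · intro h h5
        change resY (FormalOneForm.blowUp _ _).a = 0 at h5
        rw [h5, mul_zero] at e1
        exact h2 h e1
    | vertical =>
      cases r with
      | nil => simp [axisY, axisX] at hq
      | cons e p' =>
        simp [axisY, axisX] at hq
        subst hq
        obtain ⟨h1, h2⟩ := axisX_invariant hω (d := e) (p := p')
        obtain ⟨e1, e2⟩ := FormalOneForm.resY_blowUp_vertical h0
        constructor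
        · intro h
          obtain ⟨h3, h4⟩ := h1 h
          rw [h3] at e1
          refine ⟨(mul_eq_zero.mp e1.symm).resolve_left (ht _), fun h5 => ?_⟩
          change resY (FormalOneForm.blowUp _ _).b = 0 at h5
          rw [h5, mul_zero] at e2
          exact h4 ((mul_eq_zero.mp e2).resolve_left PowerSeries.X_ne_zero)
        · intro h h5
          change resY (FormalOneForm.blowUp _ _).a = 0 at h5
          rw [h5, mul_zero] at e1
          exact h2 h e1

/-- The index along the component `p`, before and after the blow-up of a point of `p`. -/
theorem indexX_eq {q p : InfNearPoint} (hq : axisX q = some p) :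
    indexX ω q = indexY ω (.vertical :: q) + (ω.transformAt q).expo - invWeight ω (some p) := by
  cases q with
  | nil => simp [axisX] at hq
  | cons d p' =>
    simp [axisX] at hq
    subst hq
    have h0 := FormalOneForm.ne_zero_or (FormalOneForm.isRelPrime_transformAt hω (d :: p'))
    obtain ⟨e1, e2⟩ := FormalOneForm.resY_blowUp_vertical h0
    obtain ⟨h1, h2⟩ := axisX_invariant hω (d := d) (p := p')
    have ht : ∀ n : ℕ, (𝕥 ^ n) ≠ 0 := fun n => pow_ne_zero _ PowerSeries.X_ne_zero
    have hY : axisY (.vertical :: d :: p') = some p' := rfl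
    have hX : axisX (d :: p') = some p' := rfl
    rw [indexX, indexY, hX, hY]
    by_cases h : (ω.transformAt p').Dicritical
    · rw [invWeight_of_dicritical h, if_pos rfl, if_pos rfl]
      have h3 := h2 h
      rw [e1] at h3
      rw [ordX, e1, ordN_mul (ht _) (right_ne_zero_of_mul h3), ordN_pow PowerSeries.X_ne_zero,
        ordN_X, ordY]
      simp only [FormalOneForm.transformAt]
      push_cast
      ring
    · rw [invWeight_of_not_dicritical h, if_neg one_ne_zero, if_neg one_ne_zero]
      have h3 := (h1 h).2
      have h4 : 𝕥 * resX (ω.transformAt (d :: p')).a ≠ 0 := mul_ne_zero PowerSeries.X_ne_zero h3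
      have h5 := congrArg ordN e2
      rw [e2] at h4
      rw [ordN_mul PowerSeries.X_ne_zero h3, ordN_mul (ht _) (right_ne_zero_of_mul h4),
        ordN_pow PowerSeries.X_ne_zero, ordN_X] at h5
      rw [ordX, ordY]
      simp only [FormalOneForm.transformAt] at h5 ⊢
      omega

/-- The index along the component `p`, before and after the blow-up of a point of `p`. -/
theorem indexY_eq {q p : InfNearPoint} (hq : axisY q = some p) :
    indexY ω q = indexY ω (.slope 0 :: q) + (ω.transformAt q).expo - invWeight ω (some p) := by
  have h0 := FormalOneForm.ne_zero_or (FormalOneForm.isRelPrime_transformAt hω q)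
  obtain ⟨e1, e2⟩ := FormalOneForm.resY_blowUp_slope_zero h0
  obtain ⟨h1, h2⟩ := axisY_invariant hω hq
  have ht : ∀ n : ℕ, (𝕥 ^ n) ≠ 0 := fun n => pow_ne_zero _ PowerSeries.X_ne_zero
  have hY : axisY (.slope 0 :: q) = some p := by simpa [axisY] using hq
  rw [indexY, indexY, hq, hY]
  by_cases h : (ω.transformAt p).Dicritical
  · rw [invWeight_of_dicritical h, if_pos rfl, if_pos rfl]
    have h3 := h2 h
    rw [e1] at h3
    rw [ordY, e1, ordN_mul (ht _) (right_ne_zero_of_mul h3), ordN_pow PowerSeries.X_ne_zero,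
      ordN_X, ordY]
    simp only [FormalOneForm.transformAt]
    push_cast
    ring
  · rw [invWeight_of_not_dicritical h, if_neg one_ne_zero, if_neg one_ne_zero]
    have h3 := (h1 h).2
    have h4 : 𝕥 * resY (ω.transformAt q).b ≠ 0 := mul_ne_zero PowerSeries.X_ne_zero h3
    have h5 := congrArg ordN e2
    rw [e2] at h4
    rw [ordN_mul PowerSeries.X_ne_zero h3, ordN_mul (ht _) (right_ne_zero_of_mul h4),
      ordN_pow PowerSeries.X_ne_zero, ordN_X] at h5
    rw [ordY, ordY]
    simp only [FormalOneForm.transformAt] at h5 ⊢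
    omega

end axes

theorem ordX_of_lin_one {f : 𝕣} (h0 : MvPowerSeries.constantCoeff f = 0) (h1 : f.lin 1 ≠ 0) :
    ordX f = 1 := by
  have h2 : PowerSeries.constantCoeff (resX f) = 0 := by rw [constantCoeff_resX, h0]
  obtain ⟨u, hu⟩ := constantCoeff_eq_zero_iff_X_dvd.mp h2
  have h3 : PowerSeries.constantCoeff u ≠ 0 := by
    have h4 := resX_dy f
    rw [hu, Derivation.leibniz] at h4
    have h5 := congrArg PowerSeries.constantCoeff h4
    simp [smul_eq_mul] at h5
    rw [← h5, ← lin_one_eq]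
    exact h1
  have hu' := (isUnit_iff_constantCoeff_ne_zero).mpr h3
  rw [ordX, hu, ordN_mul PowerSeries.X_ne_zero hu'.ne_zero, ordN_X, ordN_of_isUnit hu']

theorem resY_dx (f : 𝕣) : resY f.dx = PowerSeries.derivative ℂ (resY f) := by
  rw [resY, FormalArc.derivative_ev]
  simp

theorem ordY_of_lin_zero {f : 𝕣} (h0 : MvPowerSeries.constantCoeff f = 0) (h1 : f.lin 0 ≠ 0) :
    ordY f = 1 := by
  have h2 : PowerSeries.constantCoeff (resY f) = 0 := by rw [constantCoeff_resY, h0]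
  obtain ⟨u, hu⟩ := constantCoeff_eq_zero_iff_X_dvd.mp h2
  have h3 : PowerSeries.constantCoeff u ≠ 0 := by
    have h4 := resY_dx f
    rw [hu, Derivation.leibniz] at h4
    have h5 := congrArg PowerSeries.constantCoeff h4
    simp [smul_eq_mul] at h5
    rw [← h5, ← lin_zero_eq]
    exact h1
  have hu' := (isUnit_iff_constantCoeff_ne_zero).mpr h3
  rw [ordY, hu, ordN_mul PowerSeries.X_ne_zero hu'.ne_zero, ordN_X, ordN_of_isUnit hu']

theorem ordX_of_constantCoeff {f : 𝕣} (h : MvPowerSeries.constantCoeff f ≠ 0) : ordX f = 0 :=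
  ordN_of_isUnit ((series_isUnit_iff.mpr h).map resX)

theorem ordY_of_constantCoeff {f : 𝕣} (h : MvPowerSeries.constantCoeff f ≠ 0) : ordY f = 0 :=
  ordN_of_isUnit ((series_isUnit_iff.mpr h).map resY)

theorem constantCoeff_of_dvd {p f : 𝕣} (hp : MvPowerSeries.constantCoeff p = 0) (h : p ∣ f) :
    MvPowerSeries.constantCoeff f = 0 := by
  obtain ⟨k, rfl⟩ := h
  rw [map_mul, hp, zero_mul]

theorem lin_one_of_X0_dvd {f : 𝕣} (h : 𝕩 ∣ f) : f.lin 1 = 0 := by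
  obtain ⟨k, rfl⟩ := h
  rw [lin_one_eq]; simp

/-- At a point of an invariant component where the foliation is regular, the component is the only
separatrix. -/
theorem FormalOneForm.associated_X0_of_regular {ω : FormalOneForm} (hb : 𝕩 ∣ ω.b)
    (ha : MvPowerSeries.constantCoeff ω.a ≠ 0) {f : 𝕣} (hf : ω.IsSeparatrix f) :
    Associated f 𝕩 := by
  have hγ := branchArc_parametrizes hf.1
  by_contra hc
  have hx := hγ.x_ne_zero hc
  have h1 := hf.2
  rw [invariant_iff_onArc hγ.nonConst hf.1 ((hγ.ker _).mpr dvd_rfl), onArc] at h1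
  obtain ⟨b₁, hb₁⟩ := hb
  have hu : IsUnit ((branchArc f).ev ω.a) := (series_isUnit_iff.mpr ha).map _
  set γ := branchArc f
  have hd0 : PowerSeries.derivative ℂ γ.x ≠ 0 := by
    rw [Ne, derivative_eq_zero_iff γ.x_zero]; exact hx
  have h2 : γ.x ∣ PowerSeries.derivative ℂ γ.x := by
    rw [← hu.dvd_mul_left]
    refine ⟨-(γ.ev b₁ * PowerSeries.derivative ℂ γ.y), ?_⟩
    rw [hb₁, map_mul, FormalArc.ev_X0] at h1
    linear_combination h1
  obtain ⟨c, hc⟩ := h2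
  obtain ⟨n, hx1⟩ : ∃ n, γ.x.order = (n + 1 : ℕ) := by
    have h3 : γ.x.order.toNat ≠ 0 := by
      intro h4
      have := (ordN_eq_zero_iff hx).mp h4
      rw [isUnit_iff_constantCoeff_ne_zero] at this
      exact this γ.x_zero
    refine ⟨γ.x.order.toNat - 1, ?_⟩
    rw [Nat.sub_add_cancel (Nat.pos_of_ne_zero h3), PowerSeries.coe_toNat_order hx]
  have h5 := order_derivative hx1
  rw [hc, PowerSeries.order_mul, hx1] at h5
  have h6 : ((n + 1 : ℕ) : ℕ∞) ≤ (n : ℕ) := by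
    rw [← h5]; exact le_self_add
  rw [Nat.cast_le] at h6
  omega

namespace IsBalancedReduction

variable {ω : FormalOneForm} {T : Finset InfNearPoint} {F : FormalMeroFunction}
  (B : IsBalancedReduction ω T F)
include B

theorem isSeparatrix_of_dvd {f : 𝕣} (hf : Irreducible f) (h : f ∣ F.num ∨ f ∣ F.den) :
    ω.IsSeparatrix f := by
  by_contra hc
  have h1 := B.balanced.support f hf hc
  rw [FormalMeroFunction.ordAt, sub_eq_zero, Nat.cast_inj] at h1
  have hfin : ∀ u : 𝕣, u ≠ 0 → f ∣ u → multiplicity f u ≠ 0 := by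
    intro u hu hd h0
    exact (multiplicity_eq_zero.mp h0) hd
  refine hf.not_isUnit (F.coprime ?_ ?_)
  · rcases h with h | h
    · exact h
    · by_contra h2
      rw [multiplicity_eq_zero.mpr h2] at h1
      exact hfin _ F.den_ne_zero h h1.symm
  · rcases h with h | h
    · by_contra h2
      rw [multiplicity_eq_zero.mpr h2] at h1
      exact hfin _ F.num_ne_zero h h1
    · exact h

theorem isUnit_of_no_separatrix {q : InfNearPoint} (h : ∀ g, ¬ IsSeparatrixOffDivisor ω q g) :
    IsUnit (strictTransformAt F.num q) ∧ IsUnit (strictTransformAt F.den q) := by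
  have key : ∀ f, Irreducible f → (f ∣ F.num ∨ f ∣ F.den) → IsUnit (strictTransformAt f q) := by
    intro f hf hd
    by_contra hu
    exact h _ (IsSeparatrixOffDivisor.of_separatrix B.relPrime (B.isSeparatrix_of_dvd hf hd) hu)
  exact ⟨isUnit_strictTransformAt_of_factors F.num_ne_zero fun f hf hd => key f hf (Or.inl hd),
    isUnit_strictTransformAt_of_factors F.den_ne_zero fun f hf hd => key f hf (Or.inr hd)⟩

/-- At a point of the final surface with a branch `f` of separatrix, no other factor of a product of
separatrices passes. -/
theorem exists_strictTransformAt_eq {q : InfNearPoint} (tq : IsTerminalPoint T q) {f : 𝕣}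
    (hf : ω.IsSeparatrix f) (hu : ¬ IsUnit (strictTransformAt f q)) {u : 𝕣} (h0 : u ≠ 0)
    (hd : ∀ g, Irreducible g → g ∣ u → ω.IsSeparatrix g) :
    ∃ v, u = f ^ multiplicity f u * v ∧ ¬ f ∣ v ∧ IsUnit (strictTransformAt v q) := by
  have hfin : FiniteMultiplicity f u := FiniteMultiplicity.of_not_isUnit hf.1.not_isUnit h0
  obtain ⟨v, hv, hfv⟩ := hfin.exists_eq_pow_mul_and_not_dvd
  refine ⟨v, hv, hfv, ?_⟩
  have hv0 : v ≠ 0 := by rintro rfl; exact hfv (dvd_zero _)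
  refine isUnit_strictTransformAt_of_factors hv0 fun g hg hgv => ?_
  by_contra hgu
  have hgs := hd g hg (hv ▸ hgv.mul_left _)
  have h1 := (B.reduced q tq).disjoint _ _
    (IsSeparatrixOffDivisor.of_separatrix B.relPrime hf hu)
    (IsSeparatrixOffDivisor.of_separatrix B.relPrime hgs hgu)
  exact hfv ((associated_of_strictTransformAt hf.1 hg hu h1).dvd.trans hgv)

/-- At a point of the final surface with a branch `f` of separatrix, the divisor of `F` is a multiple
of this branch, which is smooth and transverse to the exceptional divisor. -/
theorem ordXAt_terminal {q : InfNearPoint} (tq : IsTerminalPoint T q) (hq : q ≠ []) {f : 𝕣}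
    (hf : ω.IsSeparatrix f) (hu : ¬ IsUnit (strictTransformAt f q)) :
    ordXAt F q = F.ordAt f := by
  have hord : ordX (strictTransformAt f q) = 1 := by
    refine ordX_of_lin_one ?_ ?_
    · by_contra hc
      exact hu (series_isUnit_iff.mpr hc)
    · exact (B.reduced q tq).transverse hq _
        (IsSeparatrixOffDivisor.of_separatrix B.relPrime hf hu)
  have key : ∀ u : 𝕣, u ≠ 0 → (∀ g, Irreducible g → g ∣ u → ω.IsSeparatrix g) →
      ordX (strictTransformAt u q) = multiplicity f u := by
    intro u h0 hd
    obtain ⟨v, hv, hfv, hvu⟩ := B.exists_strictTransformAt_eq tq hf hu h0 hd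
    have hv0 : v ≠ 0 := by rintro rfl; exact hfv (dvd_zero _)
    have hpow : ∀ n : ℕ, strictTransformAt (f ^ n) q = strictTransformAt f q ^ n ∨ n = 0 := by
      intro n
      induction n with
      | zero => exact Or.inr rfl
      | succ n ih =>
        left
        rcases ih with ih | rfl
        · rw [pow_succ, strictTransformAt_mul (pow_ne_zero _ hf.1.ne_zero) hf.1.ne_zero, ih,
            pow_succ]
        · simp
    have hr := resX_strictTransformAt_ne_zero hf.1.ne_zero hq
    have h2 : strictTransformAt u q =
        strictTransformAt (f ^ multiplicity f u) q * strictTransformAt v q := by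
      rw [← strictTransformAt_mul (pow_ne_zero _ hf.1.ne_zero) hv0, ← hv]
    have h3 : ordX (strictTransformAt (f ^ multiplicity f u) q) = multiplicity f u := by
      rcases hpow (multiplicity f u) with h | h
      · rw [h, ordX, map_pow, ordN_pow hr]
        change _ * ordX _ = _
        rw [hord, mul_one]
      · rw [h, pow_zero]
        exact ordN_of_isUnit ((isUnit_strictTransformAt isUnit_one q).map resX)
    rw [h2, ordX, map_mul, ordN_mul
      (resX_strictTransformAt_ne_zero (pow_ne_zero _ hf.1.ne_zero) hq) (hvu.map resX).ne_zero,
      ordN_of_isUnit (hvu.map resX), add_zero]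
    exact h3
  rw [ordXAt, key _ F.num_ne_zero fun g hg hd => B.isSeparatrix_of_dvd hg (Or.inl hd),
    key _ F.den_ne_zero fun g hg hd => B.isSeparatrix_of_dvd hg (Or.inr hd)]
  rfl

theorem exists_two_separatrices_of_singular {q : InfNearPoint} (tq : IsTerminalPoint T q)
    (h : (ω.transformAt q).IsSingular) :
    ∃ f g, (ω.transformAt q).IsSeparatrix f ∧ (ω.transformAt q).IsSeparatrix g ∧
      ¬ Associated f g :=
  FormalOneForm.exists_two_separatrices ((B.reduced q tq).reduced h) (B.not_saddleNode q tq)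

theorem det_ne_zero {q : InfNearPoint} (tq : IsTerminalPoint T q)
    (h : (ω.transformAt q).IsSingular) :
    (ω.transformAt q).a.lin 0 * (ω.transformAt q).b.lin 1 -
      (ω.transformAt q).a.lin 1 * (ω.transformAt q).b.lin 0 ≠ 0 :=
  FormalOneForm.det_linearPart_ne_zero ((B.reduced q tq).reduced h) (B.not_saddleNode q tq)

/-- The two local relations at a corner of the final surface. No separatrix passes there except for
the components themselves, so that at least one component is invariant. If only one is, the
foliation is regular. If both are, it is singular with a non-degenerate linear part. -/
theorem corner_relations {d : BlowUpDirection} {p r : InfNearPoint}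
    (tq : IsTerminalPoint T (d :: p)) (hY : axisY (d :: p) = some r) :
    (ordXAt F (d :: p) + invWeight ω (some r) =
      indexX ω (d :: p) + (1 - invWeight ω (some p))) ∧
    (ordYAt F (d :: p) + invWeight ω (some p) =
      indexY ω (d :: p) + (1 - invWeight ω (some r))) := by
  have hno := (B.reduced _ tq).no_corner (by rw [hY]; simp)
  obtain ⟨hn, hd⟩ := B.isUnit_of_no_separatrix hno
  have e1 : ordXAt F (d :: p) = 0 := by
    rw [ordXAt, ordX, ordX, ordN_of_isUnit (hn.map resX), ordN_of_isUnit (hd.map resX)]; rfl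
  have e2 : ordYAt F (d :: p) = 0 := by
    rw [ordYAt, ordY, ordY, ordN_of_isUnit (hn.map resY), ordN_of_isUnit (hd.map resY)]; rfl
  have hsep : ∀ g, (ω.transformAt (d :: p)).IsSeparatrix g → Associated g 𝕩 ∨ Associated g 𝕪 := by
    intro g hg
    by_contra hc
    rw [not_or] at hc
    exact hno g ⟨hg, fun _ => hc.1, fun _ => hc.2⟩
  obtain ⟨x1, x2⟩ := axisX_invariant B.relPrime (d := d) (p := p)
  obtain ⟨y1, y2⟩ := axisY_invariant B.relPrime hY
  have hX : axisX (d :: p) = some p := rfl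
  rw [e1, e2, indexX, indexY, hX, hY]
  have hx : (ω.transformAt p).Dicritical →
      ∀ g, (ω.transformAt (d :: p)).IsSeparatrix g → ¬ Associated g 𝕩 := by
    intro h g hg ha
    have := FormalOneForm.invariant_of_associated hg.1 ha hg.2
    rw [FormalOneForm.invariant_X0_iff, X0_dvd_iff] at this
    exact x2 h this
  have hy : (ω.transformAt r).Dicritical →
      ∀ g, (ω.transformAt (d :: p)).IsSeparatrix g → ¬ Associated g 𝕪 := by
    intro h g hg ha
    have := FormalOneForm.invariant_of_associated hg.1 ha hg.2
    rw [FormalOneForm.invariant_X1_iff, X1_dvd_iff] at this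
    exact y2 h this
  by_cases h1 : (ω.transformAt p).Dicritical
  · by_cases h2 : (ω.transformAt r).Dicritical
    · exfalso
      obtain ⟨g, hg⟩ : ∃ g, (ω.transformAt (d :: p)).IsSeparatrix g := by
        by_cases hs : (ω.transformAt (d :: p)).IsSingular
        · obtain ⟨f, _, hf, _⟩ := B.exists_two_separatrices_of_singular tq hs
          exact ⟨f, hf⟩
        · exact FormalOneForm.exists_separatrix_of_regular hs
      exact (hsep g hg).elim (hx h1 g hg) (hy h2 g hg)
    · have ha := constantCoeff_of_dvd (by simp) ((X1_dvd_iff _).mpr (y1 h2).1)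
      have hb : MvPowerSeries.constantCoeff (ω.transformAt (d :: p)).b ≠ 0 := by
        intro hb
        obtain ⟨f, g, hf, hg, hfg⟩ := B.exists_two_separatrices_of_singular tq ⟨ha, hb⟩
        exact hfg (((hsep f hf).resolve_left (hx h1 f hf)).trans
          ((hsep g hg).resolve_left (hx h1 g hg)).symm)
      rw [invWeight_of_dicritical h1, invWeight_of_not_dicritical h2, if_pos rfl,
        if_neg one_ne_zero, ordX_of_constantCoeff hb, ordY_of_constantCoeff hb]
      norm_num
  · have hb := constantCoeff_of_dvd (by simp) ((X0_dvd_iff _).mpr (x1 h1).1)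
    by_cases h2 : (ω.transformAt r).Dicritical
    · have ha : MvPowerSeries.constantCoeff (ω.transformAt (d :: p)).a ≠ 0 := by
        intro ha
        obtain ⟨f, g, hf, hg, hfg⟩ := B.exists_two_separatrices_of_singular tq ⟨ha, hb⟩
        exact hfg (((hsep f hf).resolve_right (hy h2 f hf)).trans
          ((hsep g hg).resolve_right (hy h2 g hg)).symm)
      rw [invWeight_of_not_dicritical h1, invWeight_of_dicritical h2, if_pos rfl,
        if_neg one_ne_zero, ordX_of_constantCoeff ha, ordY_of_constantCoeff ha]
      norm_num
    · have ha := constantCoeff_of_dvd (by simp) ((X1_dvd_iff _).mpr (y1 h2).1)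
      have hdet := B.det_ne_zero tq ⟨ha, hb⟩
      rw [lin_one_of_X0_dvd ((X0_dvd_iff _).mpr (x1 h1).1), mul_zero, zero_sub, neg_ne_zero] at hdet
      rw [invWeight_of_not_dicritical h1, invWeight_of_not_dicritical h2, if_neg one_ne_zero,
        if_neg one_ne_zero, ordX_of_lin_one ha (left_ne_zero_of_mul hdet),
        ordY_of_lin_zero hb (right_ne_zero_of_mul hdet)]
      norm_num

/-- At a point of a dicritical component that is not a corner, a tangency would give a separatrix
tangent to the component, and a singularity two separatrices. -/
theorem transverse_of_dicritical {d : BlowUpDirection} {p : InfNearPoint}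
    (tq : IsTerminalPoint T (d :: p)) (hY : axisY (d :: p) = none)
    (h1 : (ω.transformAt p).Dicritical) :
    MvPowerSeries.constantCoeff (ω.transformAt (d :: p)).b ≠ 0 := by
  have hx := (axisX_invariant B.relPrime (d := d) (p := p)).2 h1
  have hoff : ∀ g, (ω.transformAt (d :: p)).IsSeparatrix g →
      IsSeparatrixOffDivisor ω (d :: p) g := by
    intro g hg
    refine ⟨hg, fun _ ha => ?_, fun h => absurd hY h⟩
    have := FormalOneForm.invariant_of_associated hg.1 ha hg.2
    rw [FormalOneForm.invariant_X0_iff, X0_dvd_iff] at this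
    exact hx this
  intro hb
  by_cases ha : MvPowerSeries.constantCoeff (ω.transformAt (d :: p)).a = 0
  · obtain ⟨f, g, hf, hg, hfg⟩ := B.exists_two_separatrices_of_singular tq ⟨ha, hb⟩
    exact hfg ((B.reduced _ tq).disjoint f g (hoff f hf) (hoff g hg))
  · obtain ⟨f, hf, hl⟩ := FormalOneForm.exists_tangent_separatrix ha hb
    exact (B.reduced _ tq).transverse (by simp) f (hoff f hf) hl

/-- A separatrix meets an invariant component at a singularity. -/
theorem singular_of_separatrix {d : BlowUpDirection} {p : InfNearPoint}
    (h1 : ¬ (ω.transformAt p).Dicritical) {g : 𝕣} (hg : IsSeparatrixOffDivisor ω (d :: p) g) :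
    (ω.transformAt (d :: p)).IsSingular := by
  have hX0 := (X0_dvd_iff _).mpr ((axisX_invariant B.relPrime (d := d) (p := p)).1 h1).1
  refine ⟨?_, constantCoeff_of_dvd (by simp) hX0⟩
  by_contra ha
  exact hg.2.1 (by simp) (FormalOneForm.associated_X0_of_regular hX0 ha hg.1)

/-- The local relation at a point of the final surface that is not a corner. On a dicritical
component, the foliation is regular and transverse. On an invariant component, it is singular
exactly where a separatrix passes; this separatrix is isolated, and has coefficient `1`. -/
theorem smooth_relation {d : BlowUpDirection} {p : InfNearPoint}
    (tq : IsTerminalPoint T (d :: p)) (hY : axisY (d :: p) = none) :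
    ((ω.transformAt p).Dicritical → indexX ω (d :: p) = 0) ∧
    (¬ (ω.transformAt p).Dicritical → ordXAt F (d :: p) = indexX ω (d :: p)) := by
  have hX : axisX (d :: p) = some p := rfl
  rw [indexX, hX]
  constructor
  · intro h1
    rw [invWeight_of_dicritical h1, if_pos rfl,
      ordX_of_constantCoeff (B.transverse_of_dicritical tq hY h1)]
    rfl
  · intro h1
    rw [invWeight_of_not_dicritical h1, if_neg one_ne_zero]
    have hX0 := (X0_dvd_iff _).mpr ((axisX_invariant B.relPrime (d := d) (p := p)).1 h1).1
    have hb := constantCoeff_of_dvd (by simp) hX0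
    by_cases ha : MvPowerSeries.constantCoeff (ω.transformAt (d :: p)).a = 0
    · obtain ⟨f, g, hf, hg, hfg⟩ := B.exists_two_separatrices_of_singular tq ⟨ha, hb⟩
      obtain ⟨k, hk⟩ : ∃ k, IsSeparatrixOffDivisor ω (d :: p) k := by
        by_cases hfx : Associated f 𝕩
        · exact ⟨g, hg, fun _ hgx => hfg (hfx.trans hgx.symm), fun h => absurd hY h⟩
        · exact ⟨f, hf, fun _ => hfx, fun h => absurd hY h⟩
      obtain ⟨f₀, hf₀, hu, _⟩ := hk.exists_separatrix B.relPrime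
      have hdet := B.det_ne_zero tq ⟨ha, hb⟩
      rw [lin_one_of_X0_dvd hX0, mul_zero, zero_sub, neg_ne_zero] at hdet
      rw [ordX_of_lin_one ha (left_ne_zero_of_mul hdet), B.ordXAt_terminal tq (by simp) hf₀ hu,
        B.balanced.isolated f₀ ⟨hf₀, ?_⟩]
      · rfl
      · rintro p' hp' hdic ⟨q', tq', hon, hu'⟩
        obtain rfl := eq_of_terminal B.sequence hf₀.1 tq tq' hu hu'
        rcases hon with h | h
        · rw [hX] at h
          obtain rfl := Option.some.inj h
          exact h1 hdic
        · rw [hY] at h; cases h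
    · have hno : ∀ g, ¬ IsSeparatrixOffDivisor ω (d :: p) g := fun g hg =>
        ha (B.singular_of_separatrix h1 hg).1
      obtain ⟨hn, hd⟩ := B.isUnit_of_no_separatrix hno
      rw [ordXAt, ordX, ordX, ordN_of_isUnit (hn.map resX), ordN_of_isUnit (hd.map resX),
        ordX_of_constantCoeff ha]
      rfl

/-- The contribution of a point of a dicritical component: the order of the divisor of `F`, or
`1` at a corner (or over a corner). -/
theorem finsum_dicritical {p : InfNearPoint} (hp : p ∈ T) (h1 : (ω.transformAt p).Dicritical) :
    ∃ c : BlowUpDirection → ℤ, (Function.support c).Finite ∧ ∑ᶠ d, c d = 2 ∧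
      (∀ d ∈ cornerDirections T p, c d = 1) ∧
      ∀ d ∉ cornerDirections T p, c d = ordXAt F (d :: p) := by
  classical
  obtain ⟨s, hs1, hs2, hs3, hs4⟩ := B.balanced.dicritical p hp h1
  have hterm : ∀ d, d :: p ∉ T → IsTerminalPoint T (d :: p) := fun d hd =>
    ⟨hd, fun d' p' h => (List.cons.inj h).2 ▸ hp⟩
  -- the direction of a curvet
  have hdir : ∀ f ∈ s, ∃ d, d ∉ cornerDirections T p ∧
      ¬ IsUnit (strictTransformAt f (d :: p)) := by
    intro f hf
    obtain ⟨hsep, q, tq, hon, hu⟩ := hs1 f hf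
    have hoff := IsSeparatrixOffDivisor.of_separatrix B.relPrime hsep hu
    have hY : axisY q = none := by
      by_contra hY
      exact (B.reduced q tq).no_corner hY _ hoff
    rcases hon with h | h
    · cases q with
      | nil => simp [axisX] at h
      | cons d p' =>
        simp [axisX] at h
        subst h
        refine ⟨d, ?_, hu⟩
        rintro (h | h)
        · exact tq.1 h
        · exact h hY
    · rw [hY] at h; cases h
  have : Nonempty BlowUpDirection := ⟨.vertical⟩
  choose! φ hφ1 hφ2 using hdir
  have hφ3 : ∀ f ∈ s, IsTerminalPoint T (φ f :: p) := fun f hf =>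
    hterm _ fun h => hφ1 f hf (Or.inl h)
  let c₁ : BlowUpDirection → ℤ := fun d =>
    if d ∈ cornerDirections T p then 0 else ordXAt F (d :: p)
  let c₂ : BlowUpDirection → ℤ := fun d => if d ∈ cornerDirections T p then 1 else 0
  have hord : ∀ f ∈ s, c₁ (φ f) = F.ordAt f := by
    intro f hf
    simp only [c₁, if_neg (hφ1 f hf)]
    exact B.ordXAt_terminal (hφ3 f hf) (by simp) (hs1 f hf).1 (hφ2 f hf)
  have hinj : Set.InjOn φ s := by
    intro f hf g hg h
    refine hs2 f hf g hg ?_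
    have hg2 := hφ2 g hg
    rw [← h] at hg2
    exact associated_of_strictTransformAt (hs1 f hf).1.1 (hs1 g hg).1.1 (hφ2 f hf)
      ((B.reduced _ (hφ3 f hf)).disjoint _ _
        (IsSeparatrixOffDivisor.of_separatrix B.relPrime (hs1 f hf).1 (hφ2 f hf))
        (IsSeparatrixOffDivisor.of_separatrix B.relPrime (hs1 g hg).1 hg2))
  have hsupp : Function.support c₁ ⊆ (s.image φ : Finset BlowUpDirection) := by
    intro d hd
    rw [Function.mem_support] at hd
    have hdc : d ∉ cornerDirections T p := by
      intro h; exact hd (by simp only [c₁, if_pos h])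
    have hd' : ordXAt F (d :: p) ≠ 0 := by simpa only [c₁, if_neg hdc] using hd
    have td := hterm d fun h => hdc (Or.inl h)
    have hex : ∃ g, IsSeparatrixOffDivisor ω (d :: p) g := by
      by_contra hno
      push Not at hno
      obtain ⟨hn, hd⟩ := B.isUnit_of_no_separatrix hno
      apply hd'
      rw [ordXAt, ordX, ordX, ordN_of_isUnit (hn.map resX), ordN_of_isUnit (hd.map resX)]
      rfl
    obtain ⟨g, hg⟩ := hex
    obtain ⟨f₀, hf₀, hu, _⟩ := hg.exists_separatrix B.relPrime
    have hcur : IsCurvet ω T p f₀ := ⟨hf₀, d :: p, td, Or.inl rfl, hu⟩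
    rw [B.ordXAt_terminal td (by simp) hf₀ hu] at hd'
    obtain ⟨f, hf, hass⟩ := hs3 f₀ hcur hd'
    have hu' : ¬ IsUnit (strictTransformAt f₀ (φ f :: p)) := fun h =>
      hφ2 f hf ((strictTransformAt_associated hf₀.1.ne_zero hass _).isUnit h)
    have h2 := eq_of_terminal B.sequence hf₀.1 td (hφ3 f hf) hu hu'
    rw [Finset.coe_image]
    exact ⟨f, hf, ((List.cons.inj h2).1).symm⟩
  have hfin1 : (Function.support c₁).Finite := (Finset.finite_toSet _).subset hsupp
  have hfinC := finite_cornerDirections T p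
  have hsupp2 : Function.support c₂ ⊆ hfinC.toFinset := by
    intro d hd
    rw [Function.mem_support] at hd
    rw [Set.Finite.coe_toFinset]
    by_contra h
    exact hd (by simp only [c₂, if_neg h])
  have hfin2 : (Function.support c₂).Finite := (Finset.finite_toSet _).subset hsupp2
  have e1 : ∑ᶠ d, c₁ d = 2 - (valence T p : ℤ) := by
    rw [finsum_eq_sum_of_support_subset _ hsupp, Finset.sum_image hinj, ← hs4]
    exact Finset.sum_congr rfl hord
  have e2 : ∑ᶠ d, c₂ d = (valence T p : ℤ) := by
    rw [finsum_eq_sum_of_support_subset _ hsupp2, valence_eq B.sequence hp,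
      Set.ncard_eq_toFinset_card _ hfinC, Finset.card_eq_sum_ones]
    push_cast
    refine Finset.sum_congr rfl fun d hd => ?_
    rw [Set.Finite.mem_toFinset] at hd
    simp only [c₂, if_pos hd]
  refine ⟨fun d => c₁ d + c₂ d, ?_, ?_, ?_, ?_⟩
  · exact (hfin1.union hfin2).subset (Function.support_add c₁ c₂)
  · rw [finsum_add_distrib hfin1 hfin2, e1, e2]; ring
  · intro d hd
    simp only [c₁, c₂, if_pos hd]; rfl
  · intro d hd
    simp only [c₁, c₂, if_neg hd]; ring

end IsBalancedReduction

/-! ### The multiplicities of a balanced equation -/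

/-- The contribution of a point `d :: p` to the intersection number of the divisor of `F` with the
component created by the blow-up of `p`, if that component is dicritical. The contributions add up
to `2`, since the curvets contribute `2 - val` and the corners contribute `val`. -/
noncomputable def dicriticalWeight (ω : FormalOneForm) (T : Finset InfNearPoint)
    (F : FormalMeroFunction) (p : InfNearPoint) (d : BlowUpDirection) : ℤ :=
  open Classical in
  if (ω.transformAt p).Dicritical then
    if d ∈ cornerDirections T p then 1 else ordXAt F (d :: p)
  else 0

theorem dicriticalWeight_of_mem_cornerDirections {ω : FormalOneForm} {T : Finset InfNearPoint}
    {F : FormalMeroFunction} {p : InfNearPoint} {d : BlowUpDirection}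
    (h : d ∈ cornerDirections T p) :
    dicriticalWeight ω T F p d = 1 - invWeight ω (some p) := by
  by_cases h1 : (ω.transformAt p).Dicritical
  · rw [dicriticalWeight, if_pos h1, if_pos h, invWeight_of_dicritical h1, sub_zero]
  · rw [dicriticalWeight, if_neg h1, invWeight_of_not_dicritical h1, sub_self]

theorem finsum_invWeight_axisY (ω : FormalOneForm) (p : InfNearPoint) :
    (Function.support fun d => invWeight ω (axisY (d :: p))).Finite ∧
      ∑ᶠ d, invWeight ω (axisY (d :: p)) = invWeight ω (axisX p) + invWeight ω (axisY p) := by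
  classical
  have hs : (Function.support fun d => invWeight ω (axisY (d :: p))) ⊆
      ({.slope 0, .vertical} : Finset BlowUpDirection) := by
    intro d hd
    cases d with
    | slope c =>
      by_cases hc : c = 0
      · simp [hc]
      · simp [axisY, hc, invWeight_none] at hd
    | vertical => simp
  refine ⟨(Finset.finite_toSet _).subset hs, ?_⟩
  rw [finsum_eq_sum_of_support_subset _ hs, Finset.sum_pair (by simp)]
  simp only [axisY, if_true]
  ring

namespace IsBalancedReduction

variable {ω : FormalOneForm} {T : Finset InfNearPoint} {F : FormalMeroFunction}
  (B : IsBalancedReduction ω T F)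
include B

theorem finsum_dicriticalWeight {p : InfNearPoint} (hp : p ∈ T)
    (h : (ω.transformAt p).Dicritical) :
    (Function.support (dicriticalWeight ω T F p)).Finite ∧
      ∑ᶠ d, dicriticalWeight ω T F p d = 2 := by
  obtain ⟨c, h1, h2, h3, h4⟩ := B.finsum_dicritical hp h
  have hc : c = dicriticalWeight ω T F p := by
    funext d
    by_cases hd : d ∈ cornerDirections T p
    · rw [dicriticalWeight, if_pos h, if_pos hd, h3 d hd]
    · rw [dicriticalWeight, if_pos h, if_neg hd, h4 d hd]
  rw [← hc]
  exact ⟨h1, h2⟩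

/-- The comparison of the multiplicities of the divisor of `F` and of the foliation at a center of
the reduction, from the comparison of their orders along the exceptional line. -/
theorem multAt_eq_of_ordXAt_eq {p : InfNearPoint} (hp : p ∈ T)
    (h : ∀ d, ordXAt F (d :: p) + invWeight ω (axisY (d :: p)) =
      indexX ω (d :: p) + dicriticalWeight ω T F p d) :
    multAt F p + invWeight ω (axisX p) + invWeight ω (axisY p) = (ω.transformAt p).nu + 1 := by
  have h0 := FormalOneForm.ne_zero_or (FormalOneForm.isRelPrime_transformAt B.relPrime p)
  obtain ⟨n1, n2⟩ := finsum_ordX_strictTransform (strictTransformAt_ne_zero F.num_ne_zero p)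
  obtain ⟨d1, d2⟩ := finsum_ordX_strictTransform (strictTransformAt_ne_zero F.den_ne_zero p)
  obtain ⟨w1, w2⟩ := finsum_invWeight_axisY ω p
  have hL : ∑ᶠ d, (ordXAt F (d :: p) + invWeight ω (axisY (d :: p))) =
      multAt F p + (invWeight ω (axisX p) + invWeight ω (axisY p)) := by
    have h1 : (Function.support fun d => ordXAt F (d :: p)).Finite :=
      (n1.union d1).subset (Function.support_sub _ _)
    rw [finsum_add_distrib h1 w1, w2, multAt, ← n2, ← d2, ← finsum_sub_distrib n1 d1]
    rfl
  have hR : ∑ᶠ d, (indexX ω (d :: p) + dicriticalWeight ω T F p d) =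
      (ω.transformAt p).nu + 1 := by
    by_cases h1 : (ω.transformAt p).Dicritical
    · obtain ⟨c1, c2⟩ := B.finsum_dicriticalWeight hp h1
      obtain ⟨_, b1, b2⟩ := FormalOneForm.blowUp_of_dicritical h0 h1
      have hi : (fun d => indexX ω (d :: p)) =
          fun d => (ordX (FormalOneForm.blowUp d (ω.transformAt p)).b : ℤ) := by
        funext d
        rw [indexX, show axisX (d :: p) = some p from rfl, invWeight_of_dicritical h1, if_pos rfl]
        rfl
      rw [finsum_add_distrib (by rw [hi]; exact b1) c1, c2, hi, b2]
      ring
    · obtain ⟨_, b1, b2⟩ := FormalOneForm.blowUp_of_not_dicritical h0 h1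
      rw [← b2]
      refine finsum_congr fun d => ?_
      rw [indexX, show axisX (d :: p) = some p from rfl, invWeight_of_not_dicritical h1,
        if_neg one_ne_zero, dicriticalWeight, if_neg h1, add_zero]
      rfl
  rw [finsum_congr h, hR] at hL
  rw [hL]
  ring

/-- The comparison of the divisor of `F` and of the foliation at all points of the blow-ups of the
reduction: their multiplicities at the centers, and their orders along the components of the
exceptional divisor. The induction goes from the points of the final surface downwards. -/
theorem relations {q : InfNearPoint} (hq : q ∈ T ∨ IsTerminalPoint T q) :
    (q ∈ T →
      multAt F q + invWeight ω (axisX q) + invWeight ω (axisY q) = (ω.transformAt q).nu + 1) ∧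
    (∀ d p, q = d :: p → ordXAt F q + invWeight ω (axisY q) =
      indexX ω q + dicriticalWeight ω T F p d) ∧
    (∀ r, axisY q = some r → ordYAt F q + invWeight ω (axisX q) =
      indexY ω q + (1 - invWeight ω (some r))) := by
  obtain ⟨L, hL⟩ : ∃ L, ∀ t ∈ T, t.length < L :=
    ⟨T.sup List.length + 1, fun t ht => Nat.lt_succ_of_le (Finset.le_sup (f := List.length) ht)⟩
  induction hn : L - q.length using Nat.strong_induction_on generalizing q with
  | _ n ih =>
    by_cases hqT : q ∈ T
    · -- the orders at a center follow from its multiplicity and from the orders at the point of the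
      -- same component that is infinitely near to it
      have hstep : ∀ d, _ := fun d => ih (L - (d :: q).length)
        (by have := hL q hqT; simp only [List.length_cons]; omega) (q := d :: q) (by
          by_cases h : d :: q ∈ T
          · exact Or.inl h
          · exact Or.inr ⟨h, fun d' p' h' => (List.cons.inj h').2 ▸ hqT⟩) rfl
      have hm := B.multAt_eq_of_ordXAt_eq hqT fun d => (hstep d).2.1 d q rfl
      have he := expo_eq ω q
      refine ⟨fun _ => hm, ?_, ?_⟩
      · rintro d p rfl
        have h1 := (hstep .vertical).2.2 p rfl
        rw [show axisX (.vertical :: d :: p) = some (d :: p) from rfl] at h1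
        rw [ordXAt_eq F (by simp), indexX_eq B.relPrime (p := p) rfl, he,
          dicriticalWeight_of_mem_cornerDirections (Or.inl hqT)]
        rw [show axisX (d :: p) = some p from rfl] at hm
        linarith
      · intro r hr
        have h1 := (hstep (.slope 0)).2.2 r (by simpa [axisY] using hr)
        rw [show axisX (.slope 0 :: q) = some q from rfl] at h1
        rw [ordYAt_eq F (by rw [hr]; simp), indexY_eq B.relPrime hr, he]
        rw [hr] at hm
        linarith
    · have tq := hq.resolve_left hqT
      refine ⟨fun h => absurd h hqT, ?_, ?_⟩
      · rintro d p rfl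
        cases hY : axisY (d :: p) with
        | some r =>
          rw [dicriticalWeight_of_mem_cornerDirections (Or.inr (by rw [hY]; simp))]
          exact (B.corner_relations tq hY).1
        | none =>
          obtain ⟨h1, h2⟩ := B.smooth_relation tq hY
          rw [invWeight_none, add_zero]
          by_cases hd : (ω.transformAt p).Dicritical
          · rw [h1 hd, dicriticalWeight, if_pos hd, if_neg, zero_add]
            rintro (h | h)
            · exact hqT h
            · exact h hY
          · rw [h2 hd, dicriticalWeight, if_neg hd, add_zero]
      · intro r hr
        cases q with
        | nil => simp [axisY] at hr
        | cons d p => exact (B.corner_relations tq hr).2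

end IsBalancedReduction

/-! ### The foliation and its balanced equation along a separatrix -/

theorem FormalArc.ev_dx_mul {γ : FormalArc} {f : 𝕣} (h : γ.ev f = 0) (u : 𝕣) :
    γ.ev (f * u).dx = γ.ev u * γ.ev f.dx := by
  simp only [FormalSeries.dx, Derivation.leibniz, smul_eq_mul, map_add, map_mul, h, zero_mul,
    zero_add]

theorem FormalArc.ev_dy_mul {γ : FormalArc} {f : 𝕣} (h : γ.ev f = 0) (u : 𝕣) :
    γ.ev (f * u).dy = γ.ev u * γ.ev f.dy := by
  simp only [FormalSeries.dy, Derivation.leibniz, smul_eq_mul, map_add, map_mul, h, zero_mul,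
    zero_add]

theorem FormalArc.minOrd_eq_zero {γ : FormalArc} {P Q : 𝕣}
    (h : MvPowerSeries.constantCoeff P ≠ 0 ∨ MvPowerSeries.constantCoeff Q ≠ 0) :
    γ.minOrd P Q = 0 := by
  have key : ∀ P : 𝕣, MvPowerSeries.constantCoeff P ≠ 0 → (γ.ev P).order = 0 := by
    intro P hP
    have hu := (series_isUnit_iff.mpr hP).map γ.ev
    rw [← coe_ordN hu.ne_zero, ordN_of_isUnit hu]
    rfl
  rw [FormalArc.minOrd]
  rcases h with h | h
  · rw [key P h, min_eq_left zero_le]; rfl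
  · rw [key Q h, min_eq_right zero_le]; rfl

theorem FormalOneForm.pullBack_differential (d : BlowUpDirection) (f : 𝕣) :
    (FormalOneForm.pullBack d ⟨f.dx, f.dy⟩).a = (blow d f).dx ∧
      (FormalOneForm.pullBack d ⟨f.dx, f.dy⟩).b = (blow d f).dy := by
  have e1 := derivation_substPair (MvPowerSeries.pderiv ℂ 0) (constantCoeff_blowUpChart d 0)
    (constantCoeff_blowUpChart d 1) f
  have e2 := derivation_substPair (MvPowerSeries.pderiv ℂ 1) (constantCoeff_blowUpChart d 0)
    (constantCoeff_blowUpChart d 1) f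
  change (blow d f).dx = blow d f.dx * (blowUpChart d 0).dx +
    blow d f.dy * (blowUpChart d 1).dx at e1
  change (blow d f).dy = blow d f.dx * (blowUpChart d 0).dy +
    blow d f.dy * (blowUpChart d 1).dy at e2
  rw [e1, e2]
  cases d with
  | slope c =>
    rw [FormalOneForm.pullBack_slope_a, FormalOneForm.pullBack_slope_b]
    simp [blowUpChart]
    constructor <;> ring
  | vertical =>
    rw [FormalOneForm.pullBack_vertical_a, FormalOneForm.pullBack_vertical_b]
    simp [blowUpChart]
    constructor <;> ring

/-- Two forms that are proportional along the image of an arc have pull-backs that are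
proportional along the arc. -/
theorem FormalOneForm.pullBack_proportional {ω η : FormalOneForm} {γ : FormalArc}
    {d : BlowUpDirection} {k l : 𝕆} (h1 : l * (γ.blowDown d).ev ω.a = k * (γ.blowDown d).ev η.a)
    (h2 : l * (γ.blowDown d).ev ω.b = k * (γ.blowDown d).ev η.b) :
    l * γ.ev (FormalOneForm.pullBack d ω).a = k * γ.ev (FormalOneForm.pullBack d η).a ∧
      l * γ.ev (FormalOneForm.pullBack d ω).b = k * γ.ev (FormalOneForm.pullBack d η).b := by
  rw [← FormalArc.ev_blow, ← FormalArc.ev_blow] at h1 h2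
  cases d with
  | slope c =>
    simp only [FormalOneForm.pullBack_slope_a, FormalOneForm.pullBack_slope_b, map_add, map_mul]
    constructor
    · linear_combination h1 + (γ.ev 𝕪 + γ.ev (MvPowerSeries.C c)) * h2
    · linear_combination γ.ev 𝕩 * h2
  | vertical =>
    simp only [FormalOneForm.pullBack_vertical_a, FormalOneForm.pullBack_vertical_b, map_add,
      map_mul]
    constructor
    · linear_combination γ.ev 𝕪 * h1 + h2
    · linear_combination γ.ev 𝕩 * h1

/-- The intersection number of an arc through an infinitely near point with the invariant
components of the exceptional divisor. -/
noncomputable def invariantOrd (ω : FormalOneForm) (q : InfNearPoint) (γ : FormalArc) : ℤ :=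
  invWeight ω (axisX q) * ordN γ.x + invWeight ω (axisY q) * ordN γ.y

/-- On an arc `γ` through the point `q` where `F` vanishes, the foliation at `q` and the
differential of the numerator of the transform of `F` are proportional. The order of the factor of
proportionality, corrected by the orders of the denominator of `F` and of the invariant components
of the exceptional divisor, is `N`. -/
structure IsComparison (ω : FormalOneForm) (F : FormalMeroFunction) (q : InfNearPoint)
    (γ : FormalArc) (N : ℤ) : Prop where
  x_ne_zero : q ≠ [] → γ.x ≠ 0
  y_ne_zero : axisY q ≠ none → γ.y ≠ 0
  den_ne_zero : γ.ev (strictTransformAt F.den q) ≠ 0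
  exists_factor : ∃ k l : 𝕆, k ≠ 0 ∧ l ≠ 0 ∧
    l * γ.ev (ω.transformAt q).a = k * γ.ev (strictTransformAt F.num q).dx ∧
    l * γ.ev (ω.transformAt q).b = k * γ.ev (strictTransformAt F.num q).dy ∧
    ordN k - ordN l + ordN (γ.ev (strictTransformAt F.den q)) - invariantOrd ω q γ = N

/-- The order of an arc along the invariant components, before and after a blow-up: the total
transform of each component through `q` contains the new component once. -/
theorem invariantOrd_blowDown (ω : FormalOneForm) {q : InfNearPoint} {d : BlowUpDirection}
    {γ : FormalArc} (hx : γ.x ≠ 0) (hX : q ≠ [] → (γ.blowDown d).x ≠ 0)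
    (hY : axisY q ≠ none → (γ.blowDown d).y ≠ 0) :
    (axisY (d :: q) ≠ none → γ.y ≠ 0) ∧
    invariantOrd ω q (γ.blowDown d) + invWeight ω (some q) * ordN γ.x =
      invariantOrd ω (d :: q) γ +
        (invWeight ω (axisX q) + invWeight ω (axisY q)) * ordN γ.x := by
  have hX0 : axisX (d :: q) = some q := rfl
  cases d with
  | slope c =>
    rw [FormalArc.blowDown_slope_y] at hY
    by_cases hc : c = 0
    · subst hc
      have hYq : axisY (.slope 0 :: q) = axisY q := by simp [axisY]
      rw [map_zero, add_zero] at hY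
      rw [invariantOrd, invariantOrd, hX0, hYq, FormalArc.blowDown_slope_x,
        FormalArc.blowDown_slope_y, map_zero, add_zero]
      refine ⟨fun h => right_ne_zero_of_mul (hY h), ?_⟩
      cases h : axisY q with
      | none => rw [invWeight_none]; ring
      | some r =>
        rw [ordN_mul hx (right_ne_zero_of_mul (hY (by rw [h]; simp)))]
        push_cast
        ring
    · have hYq : axisY (.slope c :: q) = none := by simp [axisY, hc]
      have hu : IsUnit (γ.y + PowerSeries.C c) := by
        rw [isUnit_iff_constantCoeff_ne_zero]
        simpa [γ.y_zero] using hc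
      rw [invariantOrd, invariantOrd, hX0, hYq, FormalArc.blowDown_slope_x,
        FormalArc.blowDown_slope_y, ordN_mul hx hu.ne_zero, ordN_of_isUnit hu, invWeight_none]
      refine ⟨fun h => absurd rfl h, ?_⟩
      push_cast
      ring
  | vertical =>
    have hYq : axisY (.vertical :: q) = axisX q := rfl
    rw [FormalArc.blowDown_vertical_x] at hX
    rw [invariantOrd, invariantOrd, hX0, hYq, FormalArc.blowDown_vertical_x,
      FormalArc.blowDown_vertical_y]
    cases q with
    | nil =>
      rw [show axisX ([] : InfNearPoint) = none from rfl, invWeight_none]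
      exact ⟨fun h => absurd rfl h, by ring⟩
    | cons e p =>
      have hy := right_ne_zero_of_mul (hX (by simp))
      refine ⟨fun _ => hy, ?_⟩
      rw [ordN_mul hx hy]
      push_cast
      ring

namespace IsBalancedReduction

variable {ω : FormalOneForm} {T : Finset InfNearPoint} {F : FormalMeroFunction}
  (B : IsBalancedReduction ω T F)
include B

/-- The corrected order of the factor of proportionality is invariant by blow-up, because of the
relation between the multiplicities of `F` and of the foliation at the center. -/
theorem isComparison_cons {q : InfNearPoint} (hq : q ∈ T) {d : BlowUpDirection} {γ : FormalArc}
    {N : ℤ} (hx : γ.x ≠ 0) (hnum : γ.ev (strictTransformAt F.num (d :: q)) = 0)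
    (h : IsComparison ω F q (γ.blowDown d) N) : IsComparison ω F (d :: q) γ N := by
  have hω := FormalOneForm.ne_zero_or (FormalOneForm.isRelPrime_transformAt B.relPrime q)
  have hn0 := strictTransformAt_ne_zero F.num_ne_zero q
  have hd0 := strictTransformAt_ne_zero F.den_ne_zero q
  obtain ⟨hy, hI⟩ := invariantOrd_blowDown ω hx h.x_ne_zero h.y_ne_zero
  obtain ⟨k, l, hk, hl, h1, h2, hN⟩ := h.exists_factor
  have hden := h.den_ne_zero
  have eden := FormalArc.ev_blowDown hd0 γ d
  rw [eden] at hden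
  refine ⟨fun _ => hx, hy, right_ne_zero_of_mul hden, k * γ.x ^ mult (strictTransformAt F.num q),
    l * γ.x ^ (ω.transformAt q).expo, mul_ne_zero hk (pow_ne_zero _ hx),
    mul_ne_zero hl (pow_ne_zero _ hx), ?_, ?_, ?_⟩
  rotate_left 2
  · have hm := (B.relations (Or.inl hq)).1 hq
    have he := expo_eq ω q
    rw [eden, ordN_mul (pow_ne_zero _ hx) (right_ne_zero_of_mul hden), ordN_pow hx] at hN
    rw [ordN_mul hk (pow_ne_zero _ hx), ordN_mul hl (pow_ne_zero _ hx), ordN_pow hx, ordN_pow hx,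
      ← hN]
    rw [multAt] at hm
    simp only [strictTransformAt] at hI ⊢
    push_cast
    linear_combination hI + (ordN γ.x : ℤ) * hm - (ordN γ.x : ℤ) * he
  all_goals
    obtain ⟨p1, p2⟩ := FormalOneForm.pullBack_proportional (ω := ω.transformAt q)
      (η := ⟨(strictTransformAt F.num q).dx, (strictTransformAt F.num q).dy⟩) h1 h2
    obtain ⟨e1, e2, _⟩ := FormalOneForm.pullBack_eq hω d
    obtain ⟨e3, e4⟩ := FormalOneForm.pullBack_differential d (strictTransformAt F.num q)
    rw [e1, e3, blow_eq hn0] at p1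
    rw [e2, e4, blow_eq hn0] at p2
    rw [strictTransformAt] at hnum
    simp only [FormalSeries.dx, FormalSeries.dy, Derivation.leibniz, smul_eq_mul, map_add, map_mul,
      map_pow, FormalArc.ev_X0, hnum, zero_mul, add_zero] at p1 p2
    simp only [strictTransformAt, FormalOneForm.transformAt, FormalSeries.dx, FormalSeries.dy]
  · linear_combination p1
  · linear_combination p2

/-- At a point of the final surface, the corrected order vanishes: the transform of `F` is a unit
times the equation of the smooth branch, and the foliation is regular (on a dicritical component,
or if there is no blow-up), or has a non-degenerate linear part (on an invariant component). -/
theorem isComparison_terminal {q : InfNearPoint} (tq : IsTerminalPoint T q) {f u : 𝕣}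
    (hf : ω.IsSeparatrix f) (hnum : F.num = f * u) (hfu : ¬ f ∣ u)
    (hfq : ¬ IsUnit (strictTransformAt f q)) {γ : FormalArc}
    (hγ : γ.Parametrizes (strictTransformAt f q)) {N : ℤ} (h : IsComparison ω F q γ N) :
    N = 0 := by
  have hu0 : u ≠ 0 := by rintro rfl; exact hfu (dvd_zero _)
  have huq : IsUnit (strictTransformAt u q) := by
    obtain ⟨v, hv, _, hvu⟩ := B.exists_strictTransformAt_eq tq hf hfq hu0 fun g hg hgu =>
      B.isSeparatrix_of_dvd hg (Or.inl (hnum ▸ hgu.mul_left _))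
    rw [multiplicity_eq_zero.mpr hfu, pow_zero, one_mul] at hv
    rwa [hv]
  have hdq : IsUnit (strictTransformAt F.den q) := by
    obtain ⟨v, hv, _, hvu⟩ := B.exists_strictTransformAt_eq tq hf hfq F.den_ne_zero fun g hg hgu =>
      B.isSeparatrix_of_dvd hg (Or.inr hgu)
    rw [multiplicity_eq_zero.mpr (ordAt_of_simple hf.1 hnum hfu).1, pow_zero, one_mul] at hv
    rwa [hv]
  have hoff := IsSeparatrixOffDivisor.of_separatrix B.relPrime hf hfq
  have hev : γ.ev (strictTransformAt f q) = 0 := (hγ.ker _).mpr dvd_rfl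
  obtain ⟨k, l, hk, hl, h1, h2, hN⟩ := h.exists_factor
  rw [hnum, strictTransformAt_mul hf.1.ne_zero hu0] at h1 h2
  rw [FormalArc.ev_dx_mul hev] at h1
  rw [FormalArc.ev_dy_mul hev] at h2
  rw [ordN_of_isUnit (hdq.map γ.ev)] at hN
  have hU := huq.map γ.ev
  cases q with
  | nil =>
    have hreg : ¬ ω.IsSingular := fun hs => by
      obtain ⟨f₁, f₂, hf₁, hf₂, hne⟩ := B.exists_two_separatrices_of_singular tq hs
      exact hne ((B.reduced _ tq).disjoint _ _
        ⟨hf₁, fun h => absurd rfl h, fun h => absurd rfl h⟩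
        ⟨hf₂, fun h => absurd rfl h, fun h => absurd rfl h⟩)
    have hsm := (B.reduced _ tq).smooth _ hoff
    rw [lin_zero_eq, lin_one_eq] at hsm
    have hab : γ.ev ω.a ≠ 0 ∨ γ.ev ω.b ≠ 0 := by
      rw [Ne, Ne, hγ.ker, hγ.ker]
      exact FormalOneForm.not_dvd_or B.relPrime hf.1
    rw [FormalOneForm.IsSingular, not_and_or] at hreg
    rw [← mul_assoc] at h1 h2
    have h3 := (FormalArc.minOrd_add_eq hl hab h1 h2).1
    rw [FormalArc.minOrd_eq_zero hreg, FormalArc.minOrd_eq_zero hsm, ordN_mul hk hU.ne_zero,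
      ordN_of_isUnit hU] at h3
    rw [← hN, invariantOrd, show axisX ([] : InfNearPoint) = none from rfl,
      show axisY ([] : InfNearPoint) = none from rfl, invWeight_none]
    push_cast
    omega
  | cons d p =>
    have hY : axisY (d :: p) = none := by
      by_contra hY
      exact (B.reduced _ tq).no_corner hY _ hoff
    have hlin := (B.reduced _ tq).transverse (by simp) _ hoff
    rw [lin_one_eq] at hlin
    have hdy : IsUnit (γ.ev (strictTransformAt f (d :: p)).dy) :=
      (series_isUnit_iff.mpr hlin).map _
    have hb0 : γ.ev (ω.transformAt (d :: p)).b ≠ 0 := fun hb0 => by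
      rw [hb0, mul_zero] at h2
      exact mul_ne_zero hk (mul_ne_zero hU.ne_zero hdy.ne_zero) h2.symm
    have h3 := congrArg ordN h2
    rw [ordN_mul hl hb0, ordN_mul hk (mul_ne_zero hU.ne_zero hdy.ne_zero),
      ordN_of_isUnit (hU.mul hdy)] at h3
    rw [← hN, invariantOrd, hY, invWeight_none, show axisX (d :: p) = some p from rfl]
    by_cases hd : (ω.transformAt p).Dicritical
    · have hb := (series_isUnit_iff.mpr (B.transverse_of_dicritical tq hY hd)).map γ.ev
      rw [ordN_of_isUnit hb] at h3
      rw [invWeight_of_dicritical hd]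
      push_cast
      omega
    · have hs := B.singular_of_separatrix hd hoff
      have hdet := B.det_ne_zero tq hs
      have hX := (X0_dvd_iff _).mpr ((axisX_invariant B.relPrime (d := d) (p := p)).1 hd).1
      rw [lin_one_of_X0_dvd hX, mul_zero, zero_sub, neg_ne_zero] at hdet
      obtain ⟨b₁, hb₁⟩ := hX
      have hb₁u : IsUnit b₁ := by
        rw [series_isUnit_iff]
        have h4 := right_ne_zero_of_mul hdet
        rw [hb₁, lin_zero_eq] at h4
        simpa [FormalSeries.dx, Derivation.leibniz] using h4
      rw [hb₁, map_mul, FormalArc.ev_X0, ordN_mul (h.x_ne_zero (by simp)) (hb₁u.map γ.ev).ne_zero,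
        ordN_of_isUnit (hb₁u.map γ.ev)] at h3
      rw [invWeight_of_not_dicritical hd]
      push_cast
      omega

/-- The corrected order vanishes everywhere, as a branch passes through a point of the final
surface. -/
theorem isComparison_eq_zero {q : InfNearPoint} (hq : q ∈ T ∨ IsTerminalPoint T q) {f u : 𝕣}
    (hf : ω.IsSeparatrix f) (hnum : F.num = f * u) (hfu : ¬ f ∣ u)
    (hfq : ¬ IsUnit (strictTransformAt f q)) {γ : FormalArc}
    (hγ : γ.Parametrizes (strictTransformAt f q)) {N : ℤ} (h : IsComparison ω F q γ N) :
    N = 0 := by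
  obtain ⟨L, hL⟩ : ∃ L, ∀ t ∈ T, t.length < L :=
    ⟨T.sup List.length + 1, fun t ht => Nat.lt_succ_of_le (Finset.le_sup (f := List.length) ht)⟩
  induction hn : L - q.length using Nat.strong_induction_on generalizing q γ with
  | _ n ih =>
    by_cases hqT : q ∈ T
    · obtain ⟨d, γ', hx, rfl, hγ', _⟩ := hγ.exists_lift
      have hu0 : u ≠ 0 := by rintro rfl; exact hfu (dvd_zero _)
      refine ih (L - (d :: q).length)
        (by have := hL q hqT; simp only [List.length_cons]; omega) (q := d :: q) ?_
        hγ'.irreducible.not_isUnit hγ' (B.isComparison_cons hqT hx ?_ h) rfl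
      · by_cases h : d :: q ∈ T
        · exact Or.inl h
        · exact Or.inr ⟨h, fun d' p' h' => (List.cons.inj h').2 ▸ hqT⟩
      · rw [hnum, strictTransformAt_mul hf.1.ne_zero hu0, map_mul]
        exact mul_eq_zero_of_left ((hγ'.ker _).mpr dvd_rfl) _
    · exact B.isComparison_terminal (hq.resolve_left hqT) hf hnum hfu hfq hγ h

/-- Without saddle-nodes, the polar intersection numbers of the foliation and of its balanced
equation agree along each separatrix that is a simple zero. -/
theorem polarIntersection_eq {f u : 𝕣} (hf : ω.IsSeparatrix f) (hnum : F.num = f * u)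
    (hfu : ¬ f ∣ u) :
    polarIntersection ω.toMero f = polarIntersection F.differential f := by
  have hden := (ordAt_of_simple hf.1 hnum hfu).1
  rw [polarIntersection_toMero B.relPrime hf.1, polarIntersection_differential hf.1 hnum hfu hden]
  have hγ := branchArc_parametrizes hf.1
  set γ := branchArc f
  have hev : γ.ev f = 0 := (hγ.ker _).mpr dvd_rfl
  have hU : γ.ev u ≠ 0 := fun h => hfu ((hγ.ker _).mp h)
  have hab : γ.ev ω.a ≠ 0 ∨ γ.ev ω.b ≠ 0 := by
    rw [Ne, Ne, hγ.ker, hγ.ker]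
    exact FormalOneForm.not_dvd_or B.relPrime hf.1
  have hxy : γ.ev f.dx ≠ 0 ∨ γ.ev f.dy ≠ 0 := by
    rw [Ne, Ne, hγ.ker, hγ.ker]
    exact not_dvd_dx_or_not_dvd_dy hf.1
  have hinv : γ.ev ω.a * γ.ev f.dy = γ.ev ω.b * γ.ev f.dx := by
    have h := (hγ.ker _).mpr hf.2
    rw [map_sub, map_mul, map_mul] at h
    exact sub_eq_zero.mp h
  obtain ⟨k, l, hl, h1, h2⟩ : ∃ k l : 𝕆, l ≠ 0 ∧ l * γ.ev ω.a = k * γ.ev f.dx ∧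
      l * γ.ev ω.b = k * γ.ev f.dy := by
    rcases hxy with h | h
    · exact ⟨γ.ev ω.a, γ.ev f.dx, h, by ring, by linear_combination -hinv⟩
    · exact ⟨γ.ev ω.b, γ.ev f.dy, h, by linear_combination hinv, by ring⟩
  obtain ⟨h3, hk⟩ := FormalArc.minOrd_add_eq hl hab h1 h2
  have hroot : ([] : InfNearPoint) ∈ T ∨ IsTerminalPoint T [] := by
    by_cases h : ([] : InfNearPoint) ∈ T
    · exact Or.inl h
    · exact Or.inr ⟨h, fun d p h => by simp at h⟩
  have h4 := B.isComparison_eq_zero hroot hf hnum hfu hf.1.not_isUnit hγ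
    (N := ordN k - ordN (l * γ.ev u) + ordN (γ.ev F.den) - 0)
    ⟨fun h => absurd rfl h, fun h => absurd rfl h, fun h => hden ((hγ.ker _).mp h), k, l * γ.ev u,
      hk, mul_ne_zero hl hU, ?_, ?_, ?_⟩
  · rw [ordN_mul hl hU] at h4
    push_cast at h4
    omega
  · change _ * γ.ev ω.a = k * γ.ev F.num.dx
    rw [hnum, FormalArc.ev_dx_mul hev]
    linear_combination γ.ev u * h1
  · change _ * γ.ev ω.b = k * γ.ev F.num.dy
    rw [hnum, FormalArc.ev_dy_mul hev]
    linear_combination γ.ev u * h2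
  · rw [invariantOrd, show axisX ([] : InfNearPoint) = none from rfl,
      show axisY ([] : InfNearPoint) = none from rfl, invWeight_none, zero_mul, zero_mul, add_zero]
    rfl

end IsBalancedReduction

/-! ### Minimal reductions -/

/-- A point of the surface of `T ∩ T'` is a point of the surface of `T` or of that of `T'`. -/
theorem IsReduction.inter {ω : FormalOneForm} {T T' : Finset InfNearPoint} [DecidableEq InfNearPoint]
    (h : IsReduction ω T) (h' : IsReduction ω T') : IsReduction ω (T ∩ T') := by
  refine ⟨fun d p hp => ?_, fun q hq => ?_⟩
  · rw [Finset.mem_inter] at hp ⊢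
    exact ⟨h.1 d p hp.1, h'.1 d p hp.2⟩
  · by_cases hqT : q ∈ T
    · exact h'.2 q ⟨fun hc => hq.1 (Finset.mem_inter.mpr ⟨hqT, hc⟩),
        fun d p hp => (Finset.mem_inter.mp (hq.2 d p hp)).2⟩
    · exact h.2 q ⟨hqT, fun d p hp => (Finset.mem_inter.mp (hq.2 d p hp)).1⟩

/-- The minimal reduction is unique: the balanced equation and the condition on saddle-nodes refer to
the same one. -/
theorem IsMinimalReduction.eq {ω : FormalOneForm} {T T' : Finset InfNearPoint}
    (h : IsMinimalReduction ω T) (h' : IsMinimalReduction ω T') : T = T' := by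
  classical
  have hi := IsReduction.inter h.1 h'.1
  exact ((h.2 hi Finset.inter_subset_left).trans Finset.inter_subset_right).antisymm
    ((h'.2 hi Finset.inter_subset_right).trans Finset.inter_subset_left)

theorem theoremB (ω : FormalOneForm) (hω : IsRelPrime ω.a ω.b)
    (F : FormalMeroFunction) (hF : IsBalancedEquation ω F)
    -- `C` lists the (distinct) branches of a curve contained in `(F)_0`; they are simple zeros
    -- of `F`, and `g` is an equation of the remaining part of `(F)_0`
    (C : List FormalSeries) (hirr : ∀ f ∈ C, Irreducible f)
    (hdist : C.Pairwise fun f f' => ¬ Associated f f')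
    (g : FormalSeries) (hnum : F.num = C.prod * g) (hsimple : ∀ f ∈ C, ¬ f ∣ g) :
    gsvIndex ω C =
        polarExcess ω F C + intersectionNumber C.prod g - intersectionNumber C.prod F.den ∧
      (IsGeneralizedCurve ω → IsUnit g →
        gsvIndex ω C = - intersectionNumber F.num F.den) := by
  obtain ⟨T, hT, hbal⟩ := hF
  have hsep : ∀ f ∈ C, ω.IsSeparatrix f := by
    intro f hf
    obtain ⟨u, hu, hfu⟩ := exists_cofactor hirr hdist hnum hsimple hf
    by_contra hc
    have h1 := (ordAt_of_simple (hirr f hf) hu hfu).2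
    rw [hbal.support f (hirr f hf) hc] at h1
    exact zero_ne_one h1
  have hgsv := gsvIndex_eq hω hirr hdist hnum hsimple hsep
  refine ⟨hgsv, ?_⟩
  rintro ⟨T', hT', hns⟩ hg
  obtain rfl := hT.eq hT'
  have B : IsBalancedReduction ω T F := ⟨hω, hT.1.1, hT.1.2, hns, hbal⟩
  have hexc : polarExcess ω F C = 0 := by
    rw [polarExcess]
    refine List.sum_eq_zero fun n hn => ?_
    obtain ⟨f, hf, rfl⟩ := List.mem_map.mp hn
    obtain ⟨u, hu, hfu⟩ := exists_cofactor hirr hdist hnum hsimple hf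
    rw [B.polarIntersection_eq (hsep f hf) hu hfu, sub_self]
  have hg0 : intersectionNumber C.prod g = 0 := by
    rw [intersectionNumber_list_prod hirr hsimple]
    refine List.sum_eq_zero fun n hn => ?_
    obtain ⟨f, hf, rfl⟩ := List.mem_map.mp hn
    rw [ordN_of_isUnit (hg.map _)]
    rfl
  have hnd : intersectionNumber F.num F.den = intersectionNumber C.prod F.den := by
    have hideal : Ideal.span ({F.num, F.den} : Set FormalSeries) =
        Ideal.span {C.prod, F.den} := by
      rw [Ideal.span_insert, Ideal.span_insert, hnum, Ideal.span_singleton_mul_right_unit hg]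
    rw [intersectionNumber, intersectionNumber, hideal]
  rw [hgsv, hexc, hg0, hnd]
  ring
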